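/- **Setting.** Let $\mathcal H$ be a separable complex Hilbert space, $\mathfrak S(\mathcal H)$ the set of density matrices (positive trace class operators of trace one), and $h$ a self-adjoint operator on $\mathcal H$ that is bounded below and has a compact resolvent, with spectral resolution $h=\sum_{e\in\mathrm{Spec}(h)}e\,P_e$. Let $\mathcal H_2=\mathcal H\otimes\mathcal H$, let $H_2$ be the closure of $h\otimes 1+1\otimes h$, and let $\mathcal A_2$ be the algebra of bounded operators on $\mathcal H_2$ of the form $f(H_2)$. A *collision specification* $(\mathcal C,U,\nu)$ consists of a compact metric space $\mathcal C$, a one-to-one map $U$ from $\mathcal C$ to the unitary operators on $\mathcal H_2$ that is continuous for the strong operator topology, and a Borel probability measure $\nu$ on $\mathcal C$ that charges every nonempty open set, such that: (i) each $U(\sigma)$ commutes with $H_2$; (ii) $U(\sigma_0)=1$ for some $\sigma_0\in\mathcal C$; (iii) $\{U(\sigma)\}=\{U^*(\sigma)\}$, and the map $\sigma\mapsto\sigma'$ with $U(\sigma')=U^*(\sigma)$ is measurable and leaves $\nu$ invariant; (iv) with $V(\phi\otimes\psi)=\psi\otimes\phi$, $\{U(\sigma)\}=\{VU(\sigma)V^*\}$,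 and the map $\sigma\mapsto\sigma'$ with $U(\sigma')=VU(\sigma)V^*$ is measurable and leaves $\nu$ invariant. It is *ergodic* if the commutant of $\{U(\sigma):\sigma\in\mathcal C\}$ is $\mathcal A_2$. Fix an ergodic collision specification and put $$A\star B=\mathrm{Tr}_2\Big[\int_{\mathcal C}U(\sigma)(A\otimes B)U^*(\sigma)\,d\nu(\sigma)\Big]$$ for trace class $A,B$. A *solution of the quantum Kac–Boltzmann equation (QKBE)* is a function $\rho:[0,\infty)\to\mathfrak S(\mathcal H)$, differentiable in operator norm (one-sidedly at $0$), with $\rho'(t)=2(\rho(t)\star\rho(t)-\rho(t))$ for all $t\ge0$. Let $\mathfrak S_{\infty,h}$ be the set of $\rho\in\mathfrak S(\mathcal H)$ of the form $\rho=\sum_{e\in\mathrm{Spec}(h)}\lambda_eP_e$ with $\lambda_e\ge0$ such that $\log\lambda_{e_1}+\log\lambda_{e_2}=\log\lambda_{e_3}+\log\lambda_{e_4}$ in $[-\infty,\infty)$ whenever $e_i\in\mathrm{Spec}(h)$ and $e_1+e_2=e_3+e_4$ (with $\log0=-\infty$), and let $\mathfrak S_{\infty,h}^\circ$ be the set of the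 strictly positive ones (those for which zero is not an eigenvalue). A *collision invariant* is a self-adjoint operator $A=\log\rho_\infty$ with $\rho_\infty\in\mathfrak S_{\infty,h}^\circ$. Since such an $A$ satisfies $A\le0$, $\mathrm{Tr}[A\rho]\in[-\infty,0]$ is defined for every $\rho\in\mathfrak S(\mathcal H)$. The relative entropy $D(\rho\|\sigma)=\mathrm{Tr}[\rho\log\rho]-\mathrm{Tr}[\rho\log\sigma]$ of density matrices is taken in $[0,\infty]$, in the usual sense $D(\rho\|\sigma)=\sum_{i,j}|\langle\phi_i,\chi_j\rangle|^2\,(r_i\log r_i-r_i\log s_j+s_j-r_i)$ for orthonormal eigenbases $\rho\phi_i=r_i\phi_i$, $\sigma\chi_j=s_j\chi_j$ (with $0\log 0=0$, also for $0\cdot(-\infty)$). **Theorem.** 1. If $\rho_\infty\in\mathfrak S_{\infty,h}^\circ$, then $\mathrm{Tr}[\log(\rho_\infty)\rho]=\mathrm{Tr}[\log(\rho_\infty)(\rho\star\rho)]$ in $[-\infty,0]$ for all $\rho\in\mathfrak S(\mathcal H)$. 2. For every solution $\rho(t)$ of the QKBE and every collision invariant $A$, $\mathrm{Tr}[A\rho(t)]$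 does not depend on $t\ge0$. 3. For every $\rho_\infty\in\mathfrak S_{\infty,h}$ (strictly positive or not) and every solution $\rho(t)$ of the QKBE that is not constant in time, $D(\rho(t)\|\rho_\infty)$ is strictly decreasing as long as it is finite: if $0\le s<t$ and $D(\rho(s)\|\rho_\infty)<\infty$, then $D(\rho(t)\|\rho_\infty)<D(\rho(s)\|\rho_\infty)$. -/

import Mathlib

open scoped TensorProduct InnerProductSpace ENNReal
open MeasureTheory UniformSpace

noncomputable section

namespace QuantumKac

variable {H : Type*} [NormedAddCommGroup H] [InnerProductSpace ℂ H]

/-! ### Eigenspaces, traces, density matrices -/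

/-- The eigenspace of a (possibly unbounded) operator at the real number `e`. -/
def eig (T : H →ₗ.[ℂ] H) (e : ℝ) : Set H := {x | (x, (e : ℂ) • x) ∈ T.graph}

/-- The set of (real) eigenvalues.  For a self-adjoint operator with compact resolvent this is its
spectrum. -/
def spec (T : H →ₗ.[ℂ] H) : Set ℝ := {e | ∃ x ∈ eig T e, x ≠ 0}

/-- The eigenspace of a bounded operator at the real number `s`. -/
def eigB (T : H →L[ℂ] H) (s : ℝ) : Set H := {x | T x = (s : ℂ) • x}

/-- For a set `S` which is a closed subspace and an operator `T` which is positive on `S`, this is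
`Tr[P T P]`, with `P` the orthogonal projection onto `S`: the supremum of the partial sums
`∑ ⟪x, T x⟫` over the finite orthonormal families in `S`. -/
def traceOn (S : Set H) (T : H →L[ℂ] H) : ℝ≥0∞ :=
  ⨆ (F : Finset H) (_ : (F : Set H) ⊆ S ∧ Orthonormal ℂ (fun x : F => (x : H))),
    ∑ x ∈ F, ENNReal.ofReal (⟪x, T x⟫_ℂ).re

/-- Density matrices: positive operators of trace one. -/
def IsDensity (ρ : H →L[ℂ] H) : Prop := ρ.IsPositive ∧ traceOn Set.univ ρ = 1

/-- Strict positivity of a positive operator, that is, zero is not an eigenvalue. -/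
def StrictlyPositive (ρ : H →L[ℂ] H) : Prop := ∀ x : H, x ≠ 0 → 0 < (⟪x, ρ x⟫_ℂ).re

/-- `Tr[A ρ]` for a positive trace class `ρ` and a self-adjoint operator `A = ∑ₐ a Pₐ`
with pure point spectrum: `∑ₐ a Tr[Pₐ ρ Pₐ]`, the positive part minus the negative part. -/
def trMul (A : H →ₗ.[ℂ] H) (ρ : H →L[ℂ] H) : EReal :=
  ((∑' a : ℝ, ENNReal.ofReal a * traceOn (eig A a) ρ : ℝ≥0∞) : EReal) -
    ((∑' a : ℝ, ENNReal.ofReal (-a) * traceOn (eig A a) ρ : ℝ≥0∞) : EReal)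

/-- The graph of `log σ` for a strictly positive compact operator `σ = ∑ₛ s Pₛ`: the pairs `(x, y)`
with `Pₛ y = log s • Pₛ x` for every `s`. -/
def logGraph (σ : H →L[ℂ] H) : Submodule ℂ (H × H) where
  carrier := {p | ∀ s : ℝ, ∀ u ∈ eigB σ s, ⟪u, p.2⟫_ℂ = (Real.log s : ℂ) * ⟪u, p.1⟫_ℂ}
  add_mem' := by
    intro p q hp hq s u hu
    simp only [Prod.fst_add, Prod.snd_add, inner_add_right, hp s u hu, hq s u hu, mul_add]
  zero_mem' := by
    intro s u _
    simp
  smul_mem' := by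
    intro c p hp s u hu
    simp only [Prod.smul_fst, Prod.smul_snd, inner_smul_right, hp s u hu]
    ring

/-- The self-adjoint operator `log σ`, for `σ` strictly positive and compact.  It is unbounded when
`H` is infinite dimensional. -/
def logOp (σ : H →L[ℂ] H) : H →ₗ.[ℂ] H := (logGraph σ).toLinearPMap

/-- The relative entropy `D(ρ‖σ) = Tr[ρ log ρ] - Tr[ρ log σ]` of density matrices, as an element of
`[0,∞]`, in the standard form
`∑_{i,j} |⟪φ i, χ j⟫|² (r i log (r i) - r i log (s j) + s j - r i)`, where `ρ φ i = r i φ i` and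
`σ χ j = s j χ j` (every summand is nonnegative, so that no `∞ - ∞` occurs).  The sum over `i` and
over the `j` with `s j = s` is
`Tr[Pₛ (ρ log ρ - log s • ρ + s - ρ) Pₛ]`, with `Pₛ` the eigenprojection of `σ`; for `s = 0` it is
`∞ * Tr[P₀ ρ P₀]`, where `∞ * 0 = 0`. -/
def relEntropy [CompleteSpace H] (ρ σ : H →L[ℂ] H) : ℝ≥0∞ :=
  ∑' s : ℝ, if s = 0 then ⊤ * traceOn (eigB σ 0) ρ else
    traceOn (eigB σ s) (cfc (fun x : ℝ => x * Real.log x - x * Real.log s + s - x) ρ)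

/-! ### The single particle Hamiltonian -/

/-- A self-adjoint operator that is bounded below and has a compact resolvent. -/
structure IsHamiltonian [CompleteSpace H] (h : H →ₗ.[ℂ] H) : Prop where
  selfAdjoint : IsSelfAdjoint h
  boundedBelow : ∃ c : ℝ, ∀ x : h.domain, c * ‖(x : H)‖ ^ 2 ≤ (⟪(x : H), h x⟫_ℂ).re
  /-- For some `z` the operator `h - z` has a bounded everywhere defined inverse `R`, and `R` is
  compact. -/
  compactResolvent : ∃ (z : ℂ) (R : H →L[ℂ] H), IsCompactOperator R ∧
    (∀ y : H, (R y, y + z • R y) ∈ h.graph) ∧ ∀ x : h.domain, R (h x - z • (x : H)) = x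

/-! ### The two particle space -/

variable (H) in
/-- The Hilbert space tensor product `H ⊗ H`. -/
abbrev Two : Type _ := Completion (H ⊗[ℂ] H)

/-- The vector `x ⊗ y` of the two particle space. -/
def tmul (x y : H) : Two H := ((x ⊗ₜ[ℂ] y : H ⊗[ℂ] H) : Two H)

/-- The bounded operator `x ↦ x ⊗ y`. -/
def tmulRight (y : H) : H →L[ℂ] Two H :=
  (Completion.toComplL : (H ⊗[ℂ] H) →L[ℂ] Two H).comp ((TensorProduct.mkL ℂ H H).flip y)

/-- The swap `x ⊗ y ↦ y ⊗ x`. -/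
def swap : Two H →L[ℂ] Two H :=
  ((TensorProduct.commIsometry ℂ H H).toContinuousLinearEquiv :
    (H ⊗[ℂ] H) →L[ℂ] (H ⊗[ℂ] H)).completion

/-- The two particle Hamiltonian `H₂ = h ⊗ 1 + 1 ⊗ h`: the closure of the operator that is defined
on the algebraic tensor product of two copies of the domain of `h`. -/
def ham₂ (h : H →ₗ.[ℂ] H) : Two H →ₗ.[ℂ] Two H :=
  (Submodule.span ℂ {p : Two H × Two H | ∃ x y : h.domain,
    p = (tmul (x : H) y, tmul (h x) y + tmul (x : H) (h y))}).topologicalClosure.toLinearPMap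

/-- The energy algebra: the bounded operators `f(H₂) = ∑_E f(E) P_E`. -/
def energyAlgebra (h : H →ₗ.[ℂ] H) : Set (Two H →L[ℂ] Two H) :=
  {A | ∃ f : ℝ → ℂ, ∀ E : ℝ, ∀ z ∈ eig (ham₂ h) E, A z = f E • z}

section Complete

variable [CompleteSpace H]

theorem inner_map_map_eq (A B : H →L[ℂ] H) (z w : H ⊗[ℂ] H) :
    ⟪TensorProduct.map (A : H →ₗ[ℂ] H) (B : H →ₗ[ℂ] H) z, w⟫_ℂ =
      ⟪z, TensorProduct.map (A.adjoint : H →ₗ[ℂ] H) (B.adjoint : H →ₗ[ℂ] H) w⟫_ℂ := by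
  induction z with
  | zero => simp
  | add z z' hz hz' => simp only [map_add, inner_add_left, hz, hz']
  | tmul x y =>
    induction w with
    | zero => simp
    | add w w' hw hw' => simp only [map_add, inner_add_right, hw, hw']
    | tmul x' y' => simp [TensorProduct.inner_tmul, ContinuousLinearMap.adjoint_inner_right]

theorem norm_map_one_le (A : H →L[ℂ] H) (z : H ⊗[ℂ] H) :
    ‖TensorProduct.map (A : H →ₗ[ℂ] H) LinearMap.id z‖ ≤ ‖A‖ * ‖z‖ := by
  have key : ∀ B : H →L[ℂ] H,
      ⟪TensorProduct.map ((star B * B : H →L[ℂ] H) : H →ₗ[ℂ] H) LinearMap.id z, z⟫_ℂ =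
        ((‖TensorProduct.map (B : H →ₗ[ℂ] H) LinearMap.id z‖ ^ 2 : ℝ) : ℂ) := by
    intro B
    have h1 := inner_map_map_eq (star B) 1
      (TensorProduct.map (B : H →ₗ[ℂ] H) LinearMap.id z) z
    have h2 : TensorProduct.map ((star B * B : H →L[ℂ] H) : H →ₗ[ℂ] H) LinearMap.id z =
        TensorProduct.map ((star B : H →L[ℂ] H) : H →ₗ[ℂ] H)
          ((1 : H →L[ℂ] H) : H →ₗ[ℂ] H)
          (TensorProduct.map (B : H →ₗ[ℂ] H) LinearMap.id z) := by
      rw [← LinearMap.comp_apply, ← TensorProduct.map_comp]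
      rfl
    have h3 : ((ContinuousLinearMap.adjoint (1 : H →L[ℂ] H)) : H →ₗ[ℂ] H) = LinearMap.id := by
      rw [← ContinuousLinearMap.star_eq_adjoint, star_one]
      rfl
    rw [h2, h1, h3, ContinuousLinearMap.star_eq_adjoint, ContinuousLinearMap.adjoint_adjoint]
    rw [Complex.ofReal_pow]
    exact inner_self_eq_norm_sq_to_K (𝕜 := ℂ)
      (TensorProduct.map (B : H →ₗ[ℂ] H) LinearMap.id z)
  have hle : 0 ≤ algebraMap ℝ (H →L[ℂ] H) (‖A‖ ^ 2) - star A * A :=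
    sub_nonneg.mpr CStarAlgebra.star_mul_le_algebraMap_norm_sq
  obtain ⟨C, hC⟩ := CStarAlgebra.nonneg_iff_eq_star_mul_self.mp hle
  have hsum : algebraMap ℝ (H →L[ℂ] H) (‖A‖ ^ 2) = star C * C + star A * A := by
    rw [← hC]; abel
  have e1 : TensorProduct.map
      ((algebraMap ℝ (H →L[ℂ] H) (‖A‖ ^ 2) : H →L[ℂ] H) : H →ₗ[ℂ] H) LinearMap.id z =
        (((‖A‖ ^ 2 : ℝ) : ℂ)) • z := by
    have : ((algebraMap ℝ (H →L[ℂ] H) (‖A‖ ^ 2) : H →L[ℂ] H) : H →ₗ[ℂ] H) =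
        (((‖A‖ ^ 2 : ℝ) : ℂ)) • LinearMap.id := by
      ext x
      simp only [Algebra.algebraMap_eq_smul_one, LinearMap.smul_apply, LinearMap.id_apply,
        Complex.coe_smul]
      rfl
    rw [this, TensorProduct.map_smul_left, TensorProduct.map_id]
    rfl
  have e2 : TensorProduct.map
      ((algebraMap ℝ (H →L[ℂ] H) (‖A‖ ^ 2) : H →L[ℂ] H) : H →ₗ[ℂ] H) LinearMap.id z =
        TensorProduct.map ((star C * C : H →L[ℂ] H) : H →ₗ[ℂ] H) LinearMap.id z +
          TensorProduct.map ((star A * A : H →L[ℂ] H) : H →ₗ[ℂ] H) LinearMap.id z := by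
    rw [hsum, ContinuousLinearMap.toLinearMap_add, TensorProduct.map_add_left]
    rfl
  have e3 := congrArg (fun w => ⟪w, z⟫_ℂ) (e1.symm.trans e2)
  have e5 : ⟪(((‖A‖ ^ 2 : ℝ) : ℂ)) • z, z⟫_ℂ = ((‖A‖ ^ 2 * ‖z‖ ^ 2 : ℝ) : ℂ) := by
    refine (inner_smul_left (𝕜 := ℂ) z z _).trans ?_
    rw [Complex.conj_ofReal, Complex.ofReal_mul, Complex.ofReal_pow ‖z‖]
    exact congrArg _ (inner_self_eq_norm_sq_to_K (𝕜 := ℂ) z)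
  rw [inner_add_left, key, key] at e3
  have e6 := e5.symm.trans e3
  have e4 : ‖A‖ ^ 2 * ‖z‖ ^ 2 = ‖TensorProduct.map (C : H →ₗ[ℂ] H) LinearMap.id z‖ ^ 2 +
      ‖TensorProduct.map (A : H →ₗ[ℂ] H) LinearMap.id z‖ ^ 2 := by
    exact_mod_cast e6
  refine le_of_sq_le_sq ?_ (by positivity)
  rw [mul_pow, e4]
  nlinarith [sq_nonneg ‖TensorProduct.map (C : H →ₗ[ℂ] H) LinearMap.id z‖]

theorem norm_map_le (A B : H →L[ℂ] H) (z : H ⊗[ℂ] H) :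
    ‖TensorProduct.map (A : H →ₗ[ℂ] H) (B : H →ₗ[ℂ] H) z‖ ≤ ‖A‖ * ‖B‖ * ‖z‖ := by
  have h1 : TensorProduct.map (A : H →ₗ[ℂ] H) (B : H →ₗ[ℂ] H) z =
      TensorProduct.map (A : H →ₗ[ℂ] H) LinearMap.id (TensorProduct.comm ℂ H H
        (TensorProduct.map (B : H →ₗ[ℂ] H) LinearMap.id (TensorProduct.comm ℂ H H z))) := by
    induction z with
    | zero => simp
    | add z z' hz hz' => simp only [map_add, hz, hz']
    | tmul x y => simp
  rw [h1, mul_assoc]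
  refine (norm_map_one_le A _).trans (mul_le_mul_of_nonneg_left ?_ (norm_nonneg _))
  rw [TensorProduct.norm_comm]
  refine (norm_map_one_le B _).trans ?_
  rw [TensorProduct.norm_comm]

/-- The bounded operator `A ⊗ B` on the two particle space. -/
def opTensor (A B : H →L[ℂ] H) : Two H →L[ℂ] Two H :=
  ((TensorProduct.map (A : H →ₗ[ℂ] H) (B : H →ₗ[ℂ] H)).mkContinuous (‖A‖ * ‖B‖)
    (norm_map_le A B)).completion

variable (H) in
/-- An orthonormal basis of `H`. -/
def stdBasis : HilbertBasis (exists_hilbertBasis ℂ H).choose ℂ H :=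
  (exists_hilbertBasis ℂ H).choose_spec.choose

/-- The partial trace over the second factor,
`⟪x, (Tr₂ X) y⟫ = ∑ⱼ ⟪x ⊗ bⱼ, X (y ⊗ bⱼ)⟫` with an orthonormal basis `b`.  For trace class `X` the
sum converges absolutely and does not depend on the basis. -/
def partialTrace (X : Two H →L[ℂ] Two H) : H →L[ℂ] H :=
  ∑' j, (tmulRight (stdBasis H j)).adjoint ∘L X ∘L tmulRight (stdBasis H j)

/-! ### Collision specifications and the Wild convolution -/

/-- A collision specification: a compact metric space `C` (a parameter), a one-to-one strongly
continuous map `U` to the unitaries of the two particle space and a Borel probability measure `ν`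
that charges all nonempty open sets, subject to (i) conservation of energy, (ii) presence of the
trivial collision, (iii) time reversibility and (iv) symmetry under the swap of the particles. -/
structure CollisionSpec (h : H →ₗ.[ℂ] H) (C : Type*) [MetricSpace C] [CompactSpace C]
    [MeasurableSpace C] [BorelSpace C] where
  U : C → unitary (Two H →L[ℂ] Two H)
  ν : Measure C
  continuous_U : ∀ z : Two H, Continuous fun σ => (U σ : Two H →L[ℂ] Two H) z
  injective_U : Function.Injective U
  isProbability : IsProbabilityMeasure ν
  isOpenPos : ν.IsOpenPosMeasure
  /-- `U σ` maps the domain of `H₂` to itself, and `H₂ U σ = U σ H₂` there. -/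
  commute : ∀ σ, ∀ p ∈ (ham₂ h).graph,
    ((U σ : Two H →L[ℂ] Two H) p.1, (U σ : Two H →L[ℂ] Two H) p.2) ∈ (ham₂ h).graph
  trivial_mem : ∃ σ₀, U σ₀ = 1
  reversible : ∃ r : C → C, MeasurePreserving r ν ν ∧ ∀ σ, U (r σ) = star (U σ)
  symmetric : ∃ r : C → C, MeasurePreserving r ν ν ∧
    ∀ σ, (U (r σ) : Two H →L[ℂ] Two H) = swap * (U σ : Two H →L[ℂ] Two H) * star swap

variable {h : H →ₗ.[ℂ] H} {C : Type*} [MetricSpace C] [CompactSpace C] [MeasurableSpace C]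
  [BorelSpace C]

/-- Ergodicity: the commutant of the collisions is the energy algebra. -/
def CollisionSpec.Ergodic (S : CollisionSpec h C) : Prop :=
  {A : Two H →L[ℂ] Two H | ∀ σ, A * (S.U σ : Two H →L[ℂ] Two H) = S.U σ * A} = energyAlgebra h

theorem norm_unitary_apply (V : unitary (Two H →L[ℂ] Two H)) (z : Two H) :
    ‖(V : Two H →L[ℂ] Two H) z‖ = ‖z‖ :=
  ContinuousLinearMap.norm_map_of_mem_unitary V.2 z

theorem CollisionSpec.norm_conj_le (S : CollisionSpec h C) (A : Two H →L[ℂ] Two H)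
    (z : Two H) (σ : C) :
    ‖(S.U σ : Two H →L[ℂ] Two H) (A ((star (S.U σ) : Two H →L[ℂ] Two H) z))‖ ≤ ‖A‖ * ‖z‖ := by
  rw [norm_unitary_apply]
  refine (A.le_opNorm _).trans (le_of_eq ?_)
  rw [← Unitary.coe_star, norm_unitary_apply]

theorem CollisionSpec.continuous_conj (S : CollisionSpec h C) (A : Two H →L[ℂ] Two H)
    (z : Two H) : Continuous fun σ =>
      (S.U σ : Two H →L[ℂ] Two H) (A ((star (S.U σ) : Two H →L[ℂ] Two H) z)) := by
  have main : ∀ f : C → Two H, Continuous f →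
      Continuous fun σ => (S.U σ : Two H →L[ℂ] Two H) (f σ) := by
    intro f hf
    refine continuous_iff_continuousAt.mpr fun τ => ?_
    have h1 : Filter.Tendsto (fun σ => (S.U σ : Two H →L[ℂ] Two H) (f σ - f τ))
        (nhds τ) (nhds 0) := by
      rw [tendsto_zero_iff_norm_tendsto_zero]
      simp only [norm_unitary_apply]
      exact tendsto_iff_norm_sub_tendsto_zero.mp (hf.tendsto τ)
    have h2 := h1.add ((S.continuous_U (f τ)).tendsto τ)
    simpa [ContinuousAt, ← map_add] using h2
  refine main _ (A.continuous.comp ?_)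
  refine continuous_iff_continuousAt.mpr fun τ => ?_
  have h1 : ∀ (V : unitary (Two H →L[ℂ] Two H)) (w : Two H),
      (V : Two H →L[ℂ] Two H) ((star (V : Two H →L[ℂ] Two H)) w) = w := fun V w => by
    rw [← mul_apply_eq_comp, Unitary.mul_star_self_of_mem V.2, one_apply_eq_self]
  rw [ContinuousAt, tendsto_iff_norm_sub_tendsto_zero]
  have h2 := (S.continuous_U ((star (S.U τ : Two H →L[ℂ] Two H)) z)).tendsto τ
  rw [h1, tendsto_iff_norm_sub_tendsto_zero] at h2
  refine h2.congr fun σ => ?_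
  rw [← norm_unitary_apply (S.U σ) ((star (S.U σ : Two H →L[ℂ] Two H)) z - _), map_sub, h1,
    norm_sub_rev]

theorem CollisionSpec.integrable_conj (S : CollisionSpec h C) (A : Two H →L[ℂ] Two H)
    (z : Two H) : Integrable (fun σ =>
      (S.U σ : Two H →L[ℂ] Two H) (A ((star (S.U σ) : Two H →L[ℂ] Two H) z))) S.ν := by
  have := S.isProbability
  exact (S.continuous_conj A z).integrable_of_hasCompactSupport
    (HasCompactSupport.of_compactSpace _)

/-- The collision operator `A ↦ ∫ U(σ) A U(σ)* dν(σ)`, the integral being taken in the strong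
sense. -/
def CollisionSpec.collision (S : CollisionSpec h C) (A : Two H →L[ℂ] Two H) :
    Two H →L[ℂ] Two H :=
  LinearMap.mkContinuous
    { toFun := fun z => ∫ σ, (S.U σ : Two H →L[ℂ] Two H)
        (A ((star (S.U σ) : Two H →L[ℂ] Two H) z)) ∂S.ν
      map_add' := fun z w => by
        simp only [map_add]
        exact integral_add (S.integrable_conj A z) (S.integrable_conj A w)
      map_smul' := fun c z => by
        simp only [map_smul, RingHom.id_apply]
        exact integral_smul c _ }
    ‖A‖ fun z => by
      have := S.isProbability
      simpa using norm_integral_le_of_norm_le_const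
        (Filter.Eventually.of_forall (S.norm_conj_le A z)) (μ := S.ν)

/-- The quantum Wild convolution `A ⋆ B = Tr₂ [∫ U(σ) (A ⊗ B) U(σ)* dν(σ)]`. -/
def CollisionSpec.wild (S : CollisionSpec h C) (A B : H →L[ℂ] H) : H →L[ℂ] H :=
  partialTrace (S.collision (opTensor A B))

/-- Solutions on `[0,∞)`, with values in the density matrices, of the quantum Kac-Boltzmann equation
`ρ'(t) = 2 (ρ(t) ⋆ ρ(t) - ρ(t))`. -/
def CollisionSpec.IsSolution (S : CollisionSpec h C) (ρ : ℝ → H →L[ℂ] H) : Prop :=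
  ∀ t, 0 ≤ t → IsDensity (ρ t) ∧
    HasDerivWithinAt ρ ((2 : ℝ) • (S.wild (ρ t) (ρ t) - ρ t)) (Set.Ici 0) t

/-! ### Steady states and collision invariants -/

/-- The density matrices `∑ₑ λₑ Pₑ`, with `Pₑ` the spectral projections of `h`, such that
`log λ_{e₁} + log λ_{e₂} = log λ_{e₃} + log λ_{e₄}` in `[-∞,∞)` whenever
`e₁ + e₂ = e₃ + e₄`, where `log 0 = -∞`. -/
def IsSteady (h : H →ₗ.[ℂ] H) (ρ : H →L[ℂ] H) : Prop :=
  IsDensity ρ ∧ ∃ l : ℝ → ℝ, (∀ e ∈ spec h, 0 ≤ l e) ∧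
    (∀ e, ∀ x ∈ eig h e, ρ x = (l e : ℂ) • x) ∧
    ∀ e₁ ∈ spec h, ∀ e₂ ∈ spec h, ∀ e₃ ∈ spec h, ∀ e₄ ∈ spec h, e₁ + e₂ = e₃ + e₄ →
      (ENNReal.ofReal (l e₁)).log + (ENNReal.ofReal (l e₂)).log =
        (ENNReal.ofReal (l e₃)).log + (ENNReal.ofReal (l e₄)).log

/-- The collision invariants: the logarithms of the strictly positive steady states. -/
def IsCollisionInvariant (h : H →ₗ.[ℂ] H) (A : H →ₗ.[ℂ] H) : Prop :=
  ∃ ρ : H →L[ℂ] H, IsSteady h ρ ∧ StrictlyPositive ρ ∧ A = logOp ρ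

end Complete

end QuantumKac

end

open QuantumKac

open scoped TensorProduct InnerProductSpace ENNReal
open MeasureTheory UniformSpace

noncomputable section

namespace QuantumKac

-- Let `Q n` be the normalized Wild terms started at `ρ t` (`wildTerm`): `Q 0 = ρ t`, and `Q (n+1)`
-- is the average of `Q k ⋆ Q (n-k)` over `k ≤ n`. In the variable σ = 1 - e^(-2v), the function y =
-- e^(2v) ρ(t+v) solves dy/dσ = y ⋆ y. Hence ρ(t+v) = ∑ e^(-2v) σ^n `Q n`, a mixture of density
-- matrices whose weights are all positive for v > 0 (`hasSum_wildTerm`). It remains to control a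
-- single convolution.
--
-- In an eigenbasis of `h` a steady state ρ∞ has eigenvalues s with s_p s_q a function of the total
-- energy e_p + e_q, and collisions do not change the distribution of the total energy
-- (`tsum_weight_map`). The averaged collision of A ⊗ B has first marginal A ⋆ B and, by swap
-- symmetry, second marginal B ⋆ A. Since log(ρ∞ ⊗ ρ∞) splits into its two marginals, the mean of
-- -log ρ∞, summed over both orders, is conserved (`negLogMean_wild`). The same invariance and
-- superadditivity of relative entropy give D(A ⋆ B) + D(B ⋆ A) ≤ D(A) + D(B)
-- (`basisEntropy_wild_le`). The average that defines `Q (n+1)` is symmetric under k ↦ n - k, so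
-- both facts pass to all `Q n` by induction and then to the solution, for the entropy by convexity.
--
-- For strictness, convexity is proved with a quadratic remainder (`basisEntropy_mixture_le`). If
-- the entropy does not drop between t and t', every `Q n` equals ρ(t'), so ρ(t) = `Q 0` = `Q 1` =
-- ρ(t) ⋆ ρ(t). A solution that meets a fixed point is constant, also backward in time, because it
-- is analytic in σ (`eq_of_wild_eq`).
--
-- Convexity and superadditivity both come from a change of reference: D(Q‖σ) - D(Q‖τ) is affine in
-- Q, and D(Q‖τ) ≥ 0. Here τ diagonalizes the compression of the target state to finitely many
-- eigenvectors of σ and agrees with σ elsewhere. Only finitely many terms change, so all identities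
-- hold in [0,∞] without subtraction; then the finite set exhausts the basis.

universe u

/-! ### Parseval sums, quadratic forms and traces of positive operators, in [0,∞]. -/

section Basics

variable {K : Type*} [NormedAddCommGroup K] [InnerProductSpace ℂ K]
  {L : Type*} [NormedAddCommGroup L] [InnerProductSpace ℂ L] {ι κ : Type*}

theorem ofReal_norm_sq {E : Type*} [SeminormedAddCommGroup E] (x : E) :
    ENNReal.ofReal (‖x‖ ^ 2) = ‖x‖ₑ ^ 2 := by
  rw [ENNReal.ofReal_pow (norm_nonneg _), ofReal_norm]

theorem enorm_inner_symm (x y : K) : ‖⟪x, y⟫_ℂ‖ₑ = ‖⟪y, x⟫_ℂ‖ₑ := by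
  rw [← ofReal_norm, ← ofReal_norm, norm_inner_symm]

theorem hasSum_norm_inner_sq (b : HilbertBasis ι ℂ K) (x : K) :
    HasSum (fun i => ‖⟪b i, x⟫_ℂ‖ ^ 2) (‖x‖ ^ 2) := by
  have h := Complex.hasSum_re (b.hasSum_inner_mul_inner x x)
  convert h using 1
  · funext i
    rw [← inner_conj_symm x (b i), ← Complex.normSq_eq_conj_mul_self, Complex.ofReal_re,
      Complex.normSq_eq_norm_sq]
  · exact (inner_self_eq_norm_sq (𝕜 := ℂ) x).symm

/-- Parseval's identity in `[0,∞]`. -/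
theorem tsum_enorm_inner (b : HilbertBasis ι ℂ K) (x : K) :
    ∑' i, ‖⟪b i, x⟫_ℂ‖ₑ ^ 2 = ‖x‖ₑ ^ 2 := by
  have h := hasSum_norm_inner_sq b x
  rw [← ofReal_norm_sq x, ← h.tsum_eq, ENNReal.ofReal_tsum_of_nonneg (fun _ => sq_nonneg _)
    h.summable]
  simp only [ofReal_norm_sq]

theorem tsum_enorm_inner' (b : HilbertBasis ι ℂ K) (x : K) :
    ∑' i, ‖⟪x, b i⟫_ℂ‖ₑ ^ 2 = ‖x‖ₑ ^ 2 := by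
  simp only [enorm_inner_symm x, tsum_enorm_inner]

theorem eq_zero_of_inner_basis (b : HilbertBasis ι ℂ K) {x : K} (h : ∀ i, ⟪b i, x⟫_ℂ = 0) :
    x = 0 := by
  have := tsum_enorm_inner b x
  simp only [h, enorm_zero] at this
  simpa using this.symm

theorem norm_basis (b : HilbertBasis ι ℂ K) (i : ι) : ‖b i‖ = 1 := b.orthonormal.1 i

theorem enorm_basis (b : HilbertBasis ι ℂ K) (i : ι) : ‖b i‖ₑ = 1 := by
  rw [← ofReal_norm, norm_basis, ENNReal.ofReal_one]

theorem inner_basis [DecidableEq ι] (b : HilbertBasis ι ℂ K) (i j : ι) :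
    ⟪b i, b j⟫_ℂ = if i = j then 1 else 0 :=
  orthonormal_iff_ite.mp b.orthonormal i j

/-- Bessel's inequality for a finite orthonormal set. -/
theorem sum_enorm_inner_le {F : Finset K} (hF : Orthonormal ℂ (fun x : F => (x : K))) (y : K) :
    ∑ x ∈ F, ‖⟪x, y⟫_ℂ‖ₑ ^ 2 ≤ ‖y‖ₑ ^ 2 := by
  have h := hF.sum_inner_products_le y (s := Finset.univ)
  rw [← Finset.sum_coe_sort F]
  simp only [← ofReal_norm_sq]
  rw [← ENNReal.ofReal_sum_of_nonneg fun _ _ => sq_nonneg _]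
  exact ENNReal.ofReal_le_ofReal h

/-- Distinct basis vectors are at distance at least 1, so the balls of radius 1/2 around them are
disjoint open sets. Countability is needed to exchange basis sums with the integral over collisions.
-/
theorem countable_of_basis [TopologicalSpace.SeparableSpace K] (b : HilbertBasis ι ℂ K) :
    Countable ι := by
  classical
  have hd : ∀ i j, i ≠ j → 1 ≤ dist (b i) (b j) := by
    intro i j hij
    rw [dist_eq_norm]
    have h := norm_sub_sq (𝕜 := ℂ) (b i) (b j)
    rw [inner_basis, if_neg hij, norm_basis, norm_basis] at h
    simp only [map_zero] at h
    nlinarith [norm_nonneg (b i - b j)]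
  have := Set.PairwiseDisjoint.countable_of_isOpen (s := fun i => Metric.ball (b i) (1 / 2))
    (a := Set.univ) (fun i _ j _ hij => Metric.ball_disjoint_ball (by linarith [hd i j hij]))
    (fun _ _ => Metric.isOpen_ball) (fun i _ => ⟨b i, by simp⟩)
  exact Set.countable_univ_iff.mp this

/-- Regroups a sum over basis indices by the value of `g`. It links the definitions that sum over
eigenvalues to sums over a basis. -/
theorem tsum_fiber {α : Type*} (c : α → ℝ≥0∞) (g : ι → α) [DecidableEq α] (f : ι → ℝ≥0∞) :
    ∑' a, c a * ∑' p, (if g p = a then f p else 0) = ∑' p, c (g p) * f p := by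
  simp only [← ENNReal.tsum_mul_left]
  rw [ENNReal.tsum_comm]
  refine tsum_congr fun p => ?_
  rw [tsum_eq_single (g p) fun a ha => by rw [if_neg ha.symm, mul_zero], if_pos rfl]

/-! ### Quadratic forms of positive operators -/

/-- The quadratic form of a positive operator, as an element of `[0,∞]`. -/
def qf (T : K →L[ℂ] K) (x : K) : ℝ≥0∞ := ENNReal.ofReal (⟪x, T x⟫_ℂ).re

theorem re_inner_nonneg {T : K →L[ℂ] K} (hT : T.IsPositive) (x : K) : 0 ≤ (⟪x, T x⟫_ℂ).re :=
  hT.re_inner_nonneg_right x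

theorem inner_self_symm {T : K →L[ℂ] K} (hT : T.IsPositive) (x y : K) :
    ⟪T x, y⟫_ℂ = ⟪x, T y⟫_ℂ := hT.isSymmetric x y

theorem qf_add {A B : K →L[ℂ] K} (hA : A.IsPositive) (hB : B.IsPositive) (x : K) :
    qf (A + B) x = qf A x + qf B x := by
  unfold qf
  rw [add_apply, inner_add_right, Complex.add_re,
    ENNReal.ofReal_add (re_inner_nonneg hA x) (re_inner_nonneg hB x)]

theorem qf_smul (c : ℝ) (hc : 0 ≤ c) (A : K →L[ℂ] K) (x : K) :
    qf (c • A) x = ENNReal.ofReal c * qf A x := by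
  unfold qf
  rw [smul_apply, ← Complex.coe_smul, inner_smul_right, Complex.re_ofReal_mul,
    ENNReal.ofReal_mul hc]

theorem qf_zero (x : K) : qf (0 : K →L[ℂ] K) x = 0 := by simp [qf]

theorem qf_sum {s : Finset ι} {A : ι → K →L[ℂ] K} (hA : ∀ i ∈ s, (A i).IsPositive) (x : K) :
    qf (∑ i ∈ s, A i) x = ∑ i ∈ s, qf (A i) x := by
  unfold qf
  rw [sum_apply, inner_sum, Complex.re_sum,
    ENNReal.ofReal_sum_of_nonneg fun i hi => re_inner_nonneg (hA i hi) x]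

theorem isPositive_sum {s : Finset ι} {A : ι → K →L[ℂ] K} (hA : ∀ i ∈ s, (A i).IsPositive) :
    (∑ i ∈ s, A i).IsPositive := by
  refine Finset.sum_induction A (fun T => T.IsPositive) (fun _ _ => ContinuousLinearMap.IsPositive.add) ?_ hA
  exact ContinuousLinearMap.isPositive_zero

theorem isPositive_smul {c : ℝ} (hc : 0 ≤ c) {A : K →L[ℂ] K} (hA : A.IsPositive) :
    (c • A).IsPositive := by
  rw [← Complex.coe_smul]
  exact hA.smul_of_nonneg (by exact_mod_cast hc)

/-- Two positive operators with the same quadratic form agree. -/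
theorem eq_of_qf {A B : K →L[ℂ] K} (hA : A.IsPositive) (hB : B.IsPositive)
    (h : ∀ x, qf A x = qf B x) : A = B := by
  refine ContinuousLinearMap.coe_injective ((ext_inner_map (A : K →ₗ[ℂ] K) B).mp fun x => ?_)
  have h1 : (⟪A x, x⟫_ℂ).re = (⟪B x, x⟫_ℂ).re := by
    have := (ENNReal.ofReal_eq_ofReal_iff (re_inner_nonneg hA x) (re_inner_nonneg hB x)).mp (h x)
    rwa [← inner_self_symm hA, ← inner_self_symm hB] at this
  have im (T : K →L[ℂ] K) (hT : T.IsPositive) : (⟪T x, x⟫_ℂ).im = 0 := by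
    have := hT.isSymmetric.conj_inner_sym x x
    exact Complex.conj_eq_iff_im.mp this
  exact Complex.ext h1 ((im A hA).trans (im B hB).symm)

variable [CompleteSpace K] [CompleteSpace L]

/-- The factor turns quadratic forms into squared norms, and thus traces into Hilbert-Schmidt norms,
where Parseval applies. -/
theorem exists_factor {T : K →L[ℂ] K} (hT : T.IsPositive) :
    ∃ Y : K →L[ℂ] K, T = Y.adjoint ∘L Y ∧ ∀ x, qf T x = ‖Y x‖ₑ ^ 2 := by
  obtain ⟨Y, hY⟩ := CStarAlgebra.nonneg_iff_eq_star_mul_self.mp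
    ((ContinuousLinearMap.nonneg_iff_isPositive T).mpr hT)
  refine ⟨Y, hY, fun x => ?_⟩
  have : T x = Y.adjoint (Y x) := by rw [hY]; rfl
  rw [qf, this, ContinuousLinearMap.adjoint_inner_right, ← ofReal_norm_sq]
  congr 1
  exact inner_self_eq_norm_sq (𝕜 := ℂ) (Y x)

/-- The Hilbert-Schmidt norm of an operator and of its adjoint agree. -/
theorem tsum_enorm_adjoint (T : K →L[ℂ] L) (b : HilbertBasis ι ℂ K) (c : HilbertBasis κ ℂ L) :
    ∑' i, ‖T (b i)‖ₑ ^ 2 = ∑' j, ‖T.adjoint (c j)‖ₑ ^ 2 := by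
  calc ∑' i, ‖T (b i)‖ₑ ^ 2 = ∑' i, ∑' j, ‖⟪c j, T (b i)⟫_ℂ‖ₑ ^ 2 := by
        simp only [tsum_enorm_inner]
    _ = ∑' j, ∑' i, ‖⟪T.adjoint (c j), b i⟫_ℂ‖ₑ ^ 2 := by
        rw [ENNReal.tsum_comm]
        simp only [ContinuousLinearMap.adjoint_inner_left]
    _ = _ := by simp only [tsum_enorm_inner']

theorem tsum_enorm_map_basis (T : K →L[ℂ] L) (b : HilbertBasis ι ℂ K) (c : HilbertBasis κ ℂ K) :
    ∑' i, ‖T (b i)‖ₑ ^ 2 = ∑' j, ‖T (c j)‖ₑ ^ 2 := by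
  obtain ⟨_, d, _⟩ := exists_hilbertBasis ℂ L
  rw [tsum_enorm_adjoint T b d, tsum_enorm_adjoint T c d]

theorem tsum_qf_basis {T : K →L[ℂ] K} (hT : T.IsPositive) (b : HilbertBasis ι ℂ K)
    (c : HilbertBasis κ ℂ K) : ∑' i, qf T (b i) = ∑' j, qf T (c j) := by
  obtain ⟨Y, -, hY⟩ := exists_factor hT
  simp only [hY, tsum_enorm_map_basis Y b c]

/-- The set is the closed span of the `b p` with `P p`, and finite parts of this basis give the
lower bound. For the upper bound, factor `T = Y* Y` and expand `Y x` in `b`: Bessel's inequality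
inside the subspace applies to each `Y* (b q)`, and the sums are interchanged. -/
theorem traceOn_eq {T : K →L[ℂ] K} (hT : T.IsPositive) (b : HilbertBasis ι ℂ K)
    (P : ι → Prop) [DecidablePred P] :
    traceOn {z | ∀ p, ¬ P p → ⟪b p, z⟫_ℂ = 0} T = ∑' p, if P p then qf T (b p) else 0 := by
  classical
  obtain ⟨Y, -, hY⟩ := exists_factor hT
  apply le_antisymm
  · refine iSup₂_le fun F hF => ?_
    change ∑ x ∈ F, qf T x ≤ _
    have hb (y : K) : ∑ x ∈ F, ‖⟪x, y⟫_ℂ‖ₑ ^ 2 ≤ ∑' p, if P p then ‖⟪b p, y⟫_ℂ‖ₑ ^ 2 else 0 := by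
      let S : Submodule ℂ K := ⨅ p : {p // ¬ P p}, (innerSL ℂ (b p)).ker
      have hS (z : K) : z ∈ S ↔ ∀ p, ¬ P p → ⟪b p, z⟫_ℂ = 0 := by
        simp [S, Submodule.mem_iInf]
      have : IsClosed (S : Set K) := by
        rw [Submodule.coe_iInf]
        exact isClosed_iInter fun p => ContinuousLinearMap.isClosed_ker (innerSL ℂ (b (p : ι)))
      have : CompleteSpace S := this.completeSpace_coe
      have h1 (x : K) (hx : x ∈ S) : ⟪x, y⟫_ℂ = ⟪x, S.starProjection y⟫_ℂ := by
        rw [← Submodule.inner_starProjection_left_eq_right,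
          Submodule.starProjection_eq_self_iff.mpr hx]
      rw [Finset.sum_congr rfl fun x hx => by rw [h1 x ((hS x).mpr (hF.1 hx))]]
      refine (sum_enorm_inner_le hF.2 _).trans (le_of_eq ?_)
      rw [← tsum_enorm_inner b]
      refine tsum_congr fun p => ?_
      split_ifs with hp
      · rw [← h1 _ ((hS _).mpr fun q hq => by
          rw [inner_basis, if_neg]; rintro rfl; exact hq hp)]
      · rw [(hS _).mp (Submodule.starProjection_apply_mem S y) p hp]; simp
    calc ∑ x ∈ F, qf T x = ∑ x ∈ F, ∑' q, ‖⟪x, Y.adjoint (b q)⟫_ℂ‖ₑ ^ 2 := by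
          refine Finset.sum_congr rfl fun x _ => ?_
          rw [hY, ← tsum_enorm_inner' b]
          simp only [ContinuousLinearMap.adjoint_inner_right]
      _ = ∑' q, ∑ x ∈ F, ‖⟪x, Y.adjoint (b q)⟫_ℂ‖ₑ ^ 2 :=
          (Summable.tsum_finsetSum fun _ _ => ENNReal.summable).symm
      _ ≤ ∑' q, ∑' p, if P p then ‖⟪b p, Y.adjoint (b q)⟫_ℂ‖ₑ ^ 2 else 0 :=
          ENNReal.tsum_le_tsum fun q => hb _
      _ = _ := by
          rw [ENNReal.tsum_comm]
          refine tsum_congr fun p => ?_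
          split_ifs
          · rw [hY, ← tsum_enorm_inner' b]
            simp only [ContinuousLinearMap.adjoint_inner_right]
          · simp
  · rw [ENNReal.tsum_eq_iSup_sum]
    refine iSup_le fun s => ?_
    have hinj : Function.Injective b := b.orthonormal.linearIndependent.injective
    rw [← Finset.sum_filter]
    refine le_trans (le_of_eq ?_) (le_iSup₂_of_le (f := fun (F : Finset K)
      (_ : (F : Set K) ⊆ {z | ∀ p, ¬ P p → ⟪b p, z⟫_ℂ = 0} ∧ Orthonormal ℂ (fun x : F => (x : K)))
        => ∑ x ∈ F, ENNReal.ofReal (⟪x, T x⟫_ℂ).re) ((s.filter P).image b) ⟨?_, ?_⟩ le_rfl)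
    · rw [Finset.sum_image hinj.injOn]; rfl
    · intro z hz p hp
      simp only [Finset.coe_image, Set.mem_image, Finset.mem_coe, Finset.mem_filter] at hz
      obtain ⟨q, ⟨_, hq⟩, rfl⟩ := hz
      rw [inner_basis, if_neg]; rintro rfl; exact hp hq
    · refine b.orthonormal.toSubtypeRange.comp
        (fun x : (s.filter P).image b => ⟨x, ?_⟩) ?_
      · obtain ⟨q, _, hq⟩ := Finset.mem_image.mp x.2
        exact ⟨q, hq⟩
      · intro x y hxy
        exact Subtype.ext (congrArg (fun z : Set.range b => (z : K)) hxy)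

theorem traceOn_univ_eq {T : K →L[ℂ] K} (hT : T.IsPositive) (b : HilbertBasis ι ℂ K) :
    traceOn Set.univ T = ∑' p, qf T (b p) := by
  have := traceOn_eq hT b (fun _ => True)
  simpa using this

theorem qf_le_trace {T : K →L[ℂ] K} (hT : T.IsPositive) (x : K) :
    qf T x ≤ traceOn Set.univ T * ‖x‖ₑ ^ 2 := by
  obtain ⟨_, b, _⟩ := exists_hilbertBasis ℂ K
  obtain ⟨Y, -, hY⟩ := exists_factor hT
  have hle (y : K) : ‖⟪y, x⟫_ℂ‖ₑ ^ 2 ≤ ‖y‖ₑ ^ 2 * ‖x‖ₑ ^ 2 := by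
    rw [← mul_pow]
    gcongr
    simp only [← ofReal_norm]
    rw [← ENNReal.ofReal_mul (norm_nonneg _)]
    exact ENNReal.ofReal_le_ofReal (norm_inner_le_norm y x)
  calc qf T x = ∑' q, ‖⟪Y.adjoint (b q), x⟫_ℂ‖ₑ ^ 2 := by
        rw [hY, ← tsum_enorm_inner b]
        simp only [ContinuousLinearMap.adjoint_inner_left]
    _ ≤ ∑' q, ‖Y.adjoint (b q)‖ₑ ^ 2 * ‖x‖ₑ ^ 2 := ENNReal.tsum_le_tsum fun q => hle _
    _ = traceOn Set.univ T * ‖x‖ₑ ^ 2 := by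
        rw [ENNReal.tsum_mul_right, traceOn_univ_eq hT b, ← tsum_enorm_adjoint Y b b]
        simp only [hY]

/-- The trace bounds the quadratic form, hence ‖Y‖² for `T = Y* Y`. Series and remainders of
positive operators are estimated in norm through their traces. -/
theorem norm_le_trace {T : K →L[ℂ] K} (hT : T.IsPositive) {c : ℝ} (hc : 0 ≤ c)
    (h : traceOn Set.univ T ≤ ENNReal.ofReal c) : ‖T‖ ≤ c := by
  obtain ⟨Y, hTY, hY⟩ := exists_factor hT
  have h1 : ‖Y‖ ≤ Real.sqrt c := by
    refine Y.opNorm_le_bound (Real.sqrt_nonneg _) fun x => ?_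
    have h2 := (qf_le_trace hT x).trans (mul_le_mul_left h _)
    rw [hY, ← ofReal_norm_sq, ← ofReal_norm_sq, ← ENNReal.ofReal_mul hc,
      ENNReal.ofReal_le_ofReal_iff (by positivity)] at h2
    refine le_of_sq_le_sq ?_ (by positivity)
    rwa [mul_pow, Real.sq_sqrt hc]
  calc ‖T‖ ≤ ‖Y.adjoint‖ * ‖Y‖ := by rw [hTY]; exact ContinuousLinearMap.opNorm_comp_le _ _
    _ = ‖Y‖ * ‖Y‖ := by rw [LinearIsometryEquiv.norm_map]
    _ ≤ Real.sqrt c * Real.sqrt c := by gcongr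
    _ = c := Real.mul_self_sqrt hc

end Basics

/-! ### Spectral theorem for positive compact operators, compressions, functional calculus. -/

section Spectral

variable {K : Type*} [NormedAddCommGroup K] [InnerProductSpace ℂ K] [CompleteSpace K] {ι κ : Type*}

/-- Orthonormal bases of the members of a total orthogonal family make up a basis of the space. -/
theorem exists_basis_of_orthogonal {K : Type u} [NormedAddCommGroup K] [InnerProductSpace ℂ K]
    [CompleteSpace K] (V : ℝ → Submodule ℂ K) (hc : ∀ e, IsClosed (V e : Set K))
    (ho : ∀ e f, e ≠ f → ∀ x ∈ V e, ∀ y ∈ V f, ⟪x, y⟫_ℂ = 0)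
    (ht : ∀ x, (∀ e, ∀ y ∈ V e, ⟪y, x⟫_ℂ = 0) → x = 0) :
    ∃ (ι : Type u) (b : HilbertBasis ι ℂ K) (e : ι → ℝ), ∀ i, b i ∈ V (e i) := by
  have hcs : ∀ e, CompleteSpace (V e) := fun e => (hc e).completeSpace_coe
  choose w b hb using fun e => exists_hilbertBasis ℂ (V e)
  have hon : Orthonormal ℂ (fun p : Σ e, w e => ((b p.1 p.2 : V p.1) : K)) := by
    constructor
    · intro p
      exact norm_basis (b p.1) p.2
    · rintro ⟨e, i⟩ ⟨f, j⟩ hij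
      by_cases hef : e = f
      · subst hef
        have : i ≠ j := fun h => hij (by rw [h])
        exact (b e).orthonormal.2 this
      · exact ho e f hef _ (b e i).2 _ (b f j).2
  refine ⟨Σ e, w e, HilbertBasis.mkOfOrthogonalEqBot hon ?_, Sigma.fst, fun i => ?_⟩
  · rw [Submodule.eq_bot_iff]
    intro x hx
    refine ht x fun e y hy => ?_
    have hp : (V e).orthogonalProjectionOnto x = 0 := by
      refine eq_zero_of_inner_basis (b e) fun i => ?_
      rw [Submodule.inner_orthogonalProjectionOnto_eq_of_mem_left]
      exact (Submodule.mem_orthogonal _ _).mp hx _ (Submodule.subset_span ⟨⟨e, i⟩, rfl⟩)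
    have := Submodule.inner_orthogonalProjectionOnto_eq_of_mem_left (K := V e) ⟨y, hy⟩ x
    rw [hp, inner_zero_right] at this
    exact this.symm
  · rw [HilbertBasis.coe_mkOfOrthogonalEqBot]
    exact (b i.1 i.2).2

/-- Spectral theorem for positive compact operators. -/
theorem exists_eigenbasis {K : Type u} [NormedAddCommGroup K] [InnerProductSpace ℂ K]
    [CompleteSpace K] {T : K →L[ℂ] K} (hT : T.IsPositive) (hc : IsCompactOperator T) :
    ∃ (ι : Type u) (b : HilbertBasis ι ℂ K) (a : ι → ℝ), (∀ i, 0 ≤ a i) ∧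
      ∀ i, T (b i) = (a i : ℂ) • b i := by
  have hsym : (T : K →ₗ[ℂ] K).IsSymmetric := hT.isSymmetric
  obtain ⟨ι, b, a, hb⟩ := exists_basis_of_orthogonal
    (fun e => Module.End.eigenspace (T : K →ₗ[ℂ] K) (e : ℂ))
    (fun e => by
      have : (Module.End.eigenspace (T : K →ₗ[ℂ] K) (e : ℂ) : Set K) =
          {x | T x = (e : ℂ) • x} := by
        ext x; simp
      rw [this]
      exact isClosed_eq T.continuous (by fun_prop))
    (fun e f hef x hx y hy => hsym.orthogonalFamily_eigenspaces
      (by exact_mod_cast hef : (e : ℂ) ≠ (f : ℂ)) ⟨x, hx⟩ ⟨y, hy⟩)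
    (fun x hx => by
      have h := ContinuousLinearMap.orthogonalComplement_iSup_eigenspaces_eq_bot hc hsym
      rw [Submodule.eq_bot_iff] at h
      refine h x ?_
      rw [Submodule.mem_orthogonal]
      intro u hu
      -- Eigenvalues of a symmetric operator are real, so the family indexed by `ℝ` misses no
      -- nonzero eigenspace.
      have : (⨆ μ, Module.End.eigenspace (T : K →ₗ[ℂ] K) μ) ≤ (ℂ ∙ x)ᗮ := by
        refine iSup_le fun μ y hy => ?_
        rw [Submodule.mem_orthogonal_singleton_iff_inner_left]
        by_cases hy0 : y = 0
        · rw [hy0, inner_zero_left]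
        · have hm := hsym.conj_eigenvalue_eq_self
            (Module.End.hasEigenvalue_of_hasEigenvector ⟨hy, hy0⟩)
          obtain ⟨r, hr⟩ := Complex.conj_eq_iff_real.mp hm
          exact hx r y (hr ▸ hy)
      exact Submodule.mem_orthogonal_singleton_iff_inner_left.mp (this hu))
  have hb' : ∀ i, T (b i) = (a i : ℂ) • b i := fun i => Module.End.mem_eigenspace_iff.mp (hb i)
  refine ⟨ι, b, a, fun i => ?_, hb'⟩
  have := re_inner_nonneg hT (b i)
  rw [hb', inner_smul_right, inner_self_eq_norm_sq_to_K, norm_basis] at this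
  simpa using this

theorem qf_eq_tsum {T : K →L[ℂ] K} (hT : T.IsPositive) (b : HilbertBasis ι ℂ K) (a : ι → ℝ)
    (ha : ∀ i, 0 ≤ a i) (hb : ∀ i, T (b i) = (a i : ℂ) • b i) (x : K) :
    qf T x = ∑' i, ENNReal.ofReal (a i) * ‖⟪b i, x⟫_ℂ‖ₑ ^ 2 := by
  have h := Complex.hasSum_re (b.hasSum_inner_mul_inner x (T x))
  have h2 : ∀ i, (⟪x, b i⟫_ℂ * ⟪b i, T x⟫_ℂ).re = a i * ‖⟪b i, x⟫_ℂ‖ ^ 2 := fun i => by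
    rw [← inner_self_symm hT, hb, inner_smul_left, Complex.conj_ofReal, mul_left_comm,
      Complex.re_ofReal_mul, ← inner_conj_symm x (b i), ← Complex.normSq_eq_conj_mul_self,
      Complex.ofReal_re, Complex.normSq_eq_norm_sq]
  simp only [h2] at h
  rw [qf, ← h.tsum_eq, ENNReal.ofReal_tsum_of_nonneg (fun i => mul_nonneg (ha i) (sq_nonneg _))
    h.summable]
  simp only [ENNReal.ofReal_mul (ha _), ofReal_norm_sq]

theorem qf_eigenvector {T : K →L[ℂ] K} {x : K} {a : ℝ} (h : T x = (a : ℂ) • x) (hx : ‖x‖ = 1) :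
    qf T x = ENNReal.ofReal a := by
  rw [qf, h, inner_smul_right, inner_self_eq_norm_sq_to_K, hx]
  simp

theorem trace_eq_tsum {T : K →L[ℂ] K} (hT : T.IsPositive) (b : HilbertBasis ι ℂ K) (a : ι → ℝ)
    (hb : ∀ i, T (b i) = (a i : ℂ) • b i) :
    traceOn Set.univ T = ∑' i, ENNReal.ofReal (a i) := by
  rw [traceOn_univ_eq hT b]
  exact tsum_congr fun i => qf_eigenvector (hb i) (norm_basis b i)

/-! ### Compressions to finitely many basis vectors -/

/-- The orthogonal projection onto the span of finitely many basis vectors. -/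
def proj (b : HilbertBasis ι ℂ K) (F : Finset ι) : K →L[ℂ] K :=
  ∑ p ∈ F, (innerSL ℂ (b p)).smulRight (b p)

theorem proj_apply (b : HilbertBasis ι ℂ K) (F : Finset ι) (x : K) :
    proj b F x = ∑ p ∈ F, ⟪b p, x⟫_ℂ • b p := by
  simp [proj, sum_apply]

theorem inner_proj [DecidableEq ι] (b : HilbertBasis ι ℂ K) (F : Finset ι) (x : K) (p : ι) :
    ⟪b p, proj b F x⟫_ℂ = if p ∈ F then ⟪b p, x⟫_ℂ else 0 := by
  rw [proj_apply, inner_sum]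
  simp only [inner_smul_right, inner_basis, mul_ite, mul_one, mul_zero, Finset.sum_ite_eq]

theorem proj_symm (b : HilbertBasis ι ℂ K) (F : Finset ι) (x y : K) :
    ⟪proj b F x, y⟫_ℂ = ⟪x, proj b F y⟫_ℂ := by
  rw [proj_apply, proj_apply, sum_inner, inner_sum]
  refine Finset.sum_congr rfl fun p _ => ?_
  rw [inner_smul_left, inner_smul_right, inner_conj_symm, mul_comm]

theorem adjoint_proj (b : HilbertBasis ι ℂ K) (F : Finset ι) :
    (proj b F).adjoint = proj b F :=
  ((ContinuousLinearMap.eq_adjoint_iff _ _).mpr (proj_symm b F)).symm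

theorem proj_basis [DecidableEq ι] (b : HilbertBasis ι ℂ K) (F : Finset ι) (p : ι) :
    proj b F (b p) = if p ∈ F then b p else 0 := by
  rw [proj_apply]
  simp only [inner_basis, ite_smul, one_smul, zero_smul, Finset.sum_ite_eq']

/-- The compression of an operator to the span of finitely many basis vectors. -/
def compress (b : HilbertBasis ι ℂ K) (F : Finset ι) (T : K →L[ℂ] K) : K →L[ℂ] K :=
  proj b F ∘L T ∘L proj b F

theorem compress_isPositive (b : HilbertBasis ι ℂ K) (F : Finset ι) {T : K →L[ℂ] K}
    (hT : T.IsPositive) : (compress b F T).IsPositive := by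
  have := hT.conj_adjoint (proj b F)
  rwa [adjoint_proj] at this

theorem proj_isCompact (b : HilbertBasis ι ℂ K) (F : Finset ι) : IsCompactOperator (proj b F) := by
  classical
  unfold proj
  induction F using Finset.induction_on with
  | empty => simpa using isCompactOperator_zero
  | insert p F hp ih =>
    rw [Finset.sum_insert hp]
    refine IsCompactOperator.add ?_ ih
    have h : IsCompactOperator (ContinuousLinearMap.toSpanSingleton ℂ (b p)) :=
      ⟨_, ProperSpace.isCompact_closedBall (0 : ℂ) 1 |>.image
        (ContinuousLinearMap.toSpanSingleton ℂ (b p)).continuous, by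
        refine Filter.mem_of_superset (Metric.closedBall_mem_nhds 0 one_pos) ?_
        exact Set.subset_preimage_image _ _⟩
    have h2 := h.comp_clm (innerSL ℂ (b p))
    exact h2

theorem compress_isCompact (b : HilbertBasis ι ℂ K) (F : Finset ι) (T : K →L[ℂ] K) :
    IsCompactOperator (compress b F T) :=
  (proj_isCompact b F).comp_clm (T ∘L proj b F)

theorem norm_proj_le (b : HilbertBasis ι ℂ K) (F : Finset ι) : ‖proj b F‖ ≤ 1 := by
  classical
  refine ContinuousLinearMap.opNorm_le_bound _ zero_le_one fun x => ?_
  rw [one_mul]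
  refine le_of_sq_le_sq ?_ (norm_nonneg _)
  refine hasSum_le (fun p => ?_) (hasSum_norm_inner_sq b (proj b F x)) (hasSum_norm_inner_sq b x)
  rw [inner_proj]
  split_ifs
  · rfl
  · simp

/-- Compressions of a positive trace class operator converge in norm. -/
theorem tendsto_compress (b : HilbertBasis ι ℂ K) {T : K →L[ℂ] K} (hT : T.IsPositive)
    (htr : traceOn Set.univ T ≠ ⊤) :
    Filter.Tendsto (fun F => compress b F T) Filter.atTop (nhds T) := by
  classical
  obtain ⟨Y, hTY, hY⟩ := exists_factor hT
  rw [traceOn_univ_eq hT b] at htr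
  simp only [hY] at htr
  have hsum : Summable fun p => ‖Y (b p)‖ ^ 2 := by
    have := ENNReal.summable_toReal htr
    simpa using this
  -- The operator norm of Y(1 - P) is at most its Hilbert-Schmidt norm, whose square is the tail of
  -- a convergent series.
  have hbound : ∀ F, ‖Y - Y ∘L proj b F‖ ^ 2 ≤ ∑' p : {p // p ∉ F}, ‖Y (b p)‖ ^ 2 := by
    intro F
    set Z := Y - Y ∘L proj b F with hZ
    rw [sq, ← ContinuousLinearMap.norm_adjoint_comp_self]
    have hpos : (Z.adjoint ∘L Z).IsPositive := ContinuousLinearMap.isPositive_adjoint_comp_self Z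
    refine norm_le_trace hpos (tsum_nonneg fun _ => sq_nonneg _) (le_of_eq ?_)
    have hq (p : ι) : qf (Z.adjoint ∘L Z) (b p) = if p ∈ F then 0 else ‖Y (b p)‖ₑ ^ 2 := by
      rw [qf, ContinuousLinearMap.comp_apply, ContinuousLinearMap.adjoint_inner_right,
        inner_self_eq_norm_sq_to_K]
      have : Z (b p) = if p ∈ F then 0 else Y (b p) := by
        rw [hZ, sub_apply, ContinuousLinearMap.comp_apply, proj_basis]
        split_ifs <;> simp
      rw [this]
      split_ifs
      · simp
      · rw [← ofReal_norm_sq]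
        norm_cast
    rw [traceOn_univ_eq hpos b, ENNReal.ofReal_tsum_of_nonneg (fun _ => sq_nonneg _)
      (hsum.subtype _)]
    simp only [hq, ofReal_norm_sq]
    refine Eq.trans ?_ (tsum_subtype {p | p ∉ F} fun p => ‖Y (b p)‖ₑ ^ 2).symm
    refine tsum_congr fun p => ?_
    by_cases hp : p ∈ F <;> simp [hp]
  have hlim : Filter.Tendsto (fun F => ‖Y - Y ∘L proj b F‖) Filter.atTop (nhds 0) := by
    have h1 := tendsto_of_tendsto_of_tendsto_of_le_of_le tendsto_const_nhds
      (tendsto_tsum_compl_atTop_zero fun p => ‖Y (b p)‖ ^ 2) (fun F => sq_nonneg _) hbound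
    have h2 := (Real.continuous_sqrt.tendsto _).comp h1
    simpa [Function.comp_def, Real.sqrt_sq (norm_nonneg _)] using h2
  rw [tendsto_iff_norm_sub_tendsto_zero]
  refine squeeze_zero (fun _ => norm_nonneg _) (fun F => ?_)
    (by simpa using hlim.const_mul (2 * ‖Y‖) : Filter.Tendsto
      (fun F => 2 * ‖Y‖ * ‖Y - Y ∘L proj b F‖) Filter.atTop (nhds 0))
  -- With Z = Y - YP this reads PTP - T = -(Y* Z + Z* Y P), so Z → 0 suffices.
  have hdec : compress b F T - T = -(Y.adjoint ∘L (Y - Y ∘L proj b F) +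
      (Y - Y ∘L proj b F).adjoint ∘L (Y ∘L proj b F)) := by
    rw [map_sub, ContinuousLinearMap.adjoint_comp, adjoint_proj, compress, hTY]
    ext x
    simp
  rw [hdec, norm_neg]
  refine (norm_add_le _ _).trans ?_
  have h1 := ContinuousLinearMap.opNorm_comp_le Y.adjoint (Y - Y ∘L proj b F)
  have h2 := ContinuousLinearMap.opNorm_comp_le (Y - Y ∘L proj b F).adjoint (Y ∘L proj b F)
  have h3 := ContinuousLinearMap.opNorm_comp_le Y (proj b F)
  rw [LinearIsometryEquiv.norm_map] at h1 h2
  have h4 : ‖Y ∘L proj b F‖ ≤ ‖Y‖ :=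
    h3.trans (mul_le_of_le_one_right (norm_nonneg _) (norm_proj_le b F))
  have h5 := mul_le_mul_of_nonneg_left h4 (norm_nonneg (Y - Y ∘L proj b F))
  linarith

theorem isCompact_of_trace {T : K →L[ℂ] K} (hT : T.IsPositive)
    (htr : traceOn Set.univ T ≠ ⊤) : IsCompactOperator T := by
  obtain ⟨_, b, _⟩ := exists_hilbertBasis ℂ K
  exact isCompactOperator_of_tendsto (tendsto_compress b hT htr)
    (Filter.Eventually.of_forall fun F => compress_isCompact b F T)

theorem exists_eigenbasis_of_trace {K : Type u} [NormedAddCommGroup K] [InnerProductSpace ℂ K]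
    [CompleteSpace K] {T : K →L[ℂ] K} (hT : T.IsPositive) (htr : traceOn Set.univ T ≠ ⊤) :
    ∃ (ι : Type u) (b : HilbertBasis ι ℂ K) (a : ι → ℝ), (∀ i, 0 ≤ a i) ∧
      ∀ i, T (b i) = (a i : ℂ) • b i :=
  exists_eigenbasis hT (isCompact_of_trace hT htr)

/-! ### Functional calculus on eigenvectors -/

/-- The identity holds for constants and for the coordinate function, and survives sums, products
and uniform limits, so Stone-Weierstrass gives all continuous functions on the spectrum. Evaluation
at `a` makes sense because an eigenvalue with a nonzero eigenvector lies in the spectrum. -/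
theorem cfc_apply_eigenvector {T : K →L[ℂ] K} (hT : IsSelfAdjoint T) {f : ℝ → ℝ}
    (hf : Continuous f) {x : K} {a : ℝ} (hx : T x = (a : ℂ) • x) :
    cfc f T x = (f a : ℂ) • x := by
  by_cases hx0 : x = 0
  · simp [hx0]
  have ha : a ∈ spectrum ℝ T := by
    rw [spectrum.mem_iff]
    intro hu
    obtain ⟨v, hv⟩ := hu
    have h1 : (v : K →L[ℂ] K) x = 0 := by
      rw [hv, sub_apply, Algebra.algebraMap_eq_smul_one, smul_apply, one_apply_eq_self, hx]
      simp
    have h2 : ((v⁻¹ : (K →L[ℂ] K)ˣ) * (v : K →L[ℂ] K)) x = 0 := by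
      rw [mul_apply_eq_comp, h1, map_zero]
    rw [Units.inv_mul, one_apply_eq_self] at h2
    exact hx0 h2
  rw [cfc_apply f T hT hf.continuousOn]
  suffices h : ∀ g : C(spectrum ℝ T, ℝ), cfcHom hT g x = ((g ⟨a, ha⟩ : ℝ) : ℂ) • x from h _
  intro g
  induction g using ContinuousMap.induction_on_of_compact with
  | const r =>
    have : ContinuousMap.const (spectrum ℝ T) r = algebraMap ℝ C(spectrum ℝ T, ℝ) r := rfl
    rw [this, AlgHomClass.commutes, Algebra.algebraMap_eq_smul_one]
    simp
  | id => rw [cfcHom_id hT]; exact hx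
  | star_id => rw [star_trivial, cfcHom_id hT]; exact hx
  | add f g hf hg => rw [map_add, add_apply, hf, hg, ← add_smul]; simp
  | mul f g hf hg =>
    rw [map_mul, mul_apply_eq_comp, hg, map_smul, hf, smul_smul]
    simp [mul_comm]
  | frequently f hf =>
    have hcl : IsClosed {g : C(spectrum ℝ T, ℝ) |
        cfcHom hT g x = ((g ⟨a, ha⟩ : ℝ) : ℂ) • x} := by
      refine isClosed_eq ?_ ?_
      · exact (ContinuousLinearMap.apply ℂ K x).continuous.comp (cfcHom_continuous hT)
      · exact (Complex.continuous_ofReal.comp (continuous_eval_const _)).smul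
          continuous_const
    exact hcl.mem_of_frequently_of_tendsto hf Filter.tendsto_id

theorem inner_cfc_eq_tsum {T : K →L[ℂ] K} (hT : IsSelfAdjoint T) (b : HilbertBasis ι ℂ K)
    (a : ι → ℝ) (hb : ∀ i, T (b i) = (a i : ℂ) • b i) {f : ℝ → ℝ} (hf : Continuous f) (x : K) :
    HasSum (fun i => f (a i) * ‖⟪b i, x⟫_ℂ‖ ^ 2) (⟪x, cfc f T x⟫_ℂ).re := by
  have h := Complex.hasSum_re (b.hasSum_inner_mul_inner x (cfc f T x))
  convert h using 2 with i
  have hs : IsSelfAdjoint (cfc f T) := cfc_predicate f T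
  have h1 := hs.isSymmetric (b i) x
  simp only [ContinuousLinearMap.coe_coe] at h1
  rw [← h1, cfc_apply_eigenvector hT hf (hb i), inner_smul_left, Complex.conj_ofReal,
    mul_left_comm, Complex.re_ofReal_mul, ← inner_conj_symm x (b i),
    ← Complex.normSq_eq_conj_mul_self, Complex.ofReal_re, Complex.normSq_eq_norm_sq]

end Spectral

/-! ### An orthonormal eigenbasis of the one-particle Hamiltonian. -/

section Hamiltonian

variable {H : Type*} [NormedAddCommGroup H] [InnerProductSpace ℂ H] [CompleteSpace H]
  {h : H →ₗ.[ℂ] H}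

theorem graph_symm (hs : IsSelfAdjoint h) {p q : H × H} (hp : p ∈ h.graph) (hq : q ∈ h.graph) :
    ⟪p.2, q.1⟫_ℂ = ⟪p.1, q.2⟫_ℂ := by
  rw [LinearPMap.mem_graph_iff] at hp hq
  obtain ⟨x, hx1, hx2⟩ := hp
  obtain ⟨y, hy1, hy2⟩ := hq
  have h1 := LinearPMap.adjoint_isFormalAdjoint hs.dense_domain
  rw [LinearPMap.isSelfAdjoint_def.mp hs] at h1
  rw [← hx1, ← hx2, ← hy1, ← hy2]
  exact h1 x y

theorem mem_graph_of_forall (hs : IsSelfAdjoint h) {y w : H}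
    (hyw : ∀ x : h.domain, ⟪w, (x : H)⟫_ℂ = ⟪y, h x⟫_ℂ) : (y, w) ∈ h.graph := by
  have hy := LinearPMap.mem_adjoint_domain_of_exists (T := h) y ⟨w, hyw⟩
  have h1 : h.adjoint ⟨y, hy⟩ = w := LinearPMap.adjoint_apply_eq hs.dense_domain ⟨y, hy⟩ hyw
  have h2 : (y, w) ∈ h.adjoint.graph := by
    rw [LinearPMap.mem_graph_iff]
    exact ⟨⟨y, hy⟩, rfl, h1⟩
  rwa [LinearPMap.isSelfAdjoint_def.mp hs] at h2

/-- The eigenspace of an operator as a submodule. -/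
def eigSub (h : H →ₗ.[ℂ] H) (e : ℝ) : Submodule ℂ H :=
  h.graph.comap (LinearMap.id.prod ((e : ℂ) • LinearMap.id))

theorem inner_eq_zero_of_eig (hs : IsSelfAdjoint h) {e f : ℝ} (hef : e ≠ f) {x y : H}
    (hx : x ∈ eig h e) (hy : y ∈ eig h f) : ⟪x, y⟫_ℂ = 0 := by
  have h1 := graph_symm hs hx hy
  simp only [inner_smul_left, inner_smul_right, Complex.conj_ofReal] at h1
  rw [← sub_eq_zero, ← sub_mul, mul_eq_zero] at h1
  refine h1.resolve_left fun h2 => hef ?_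
  exact_mod_cast sub_eq_zero.mp h2

/-- A Hamiltonian has an orthonormal basis of eigenvectors. -/
theorem IsHamiltonian.exists_basis {H : Type u} [NormedAddCommGroup H] [InnerProductSpace ℂ H]
    [CompleteSpace H] {h : H →ₗ.[ℂ] H} (hh : IsHamiltonian h) :
    ∃ (ι : Type u) (b : HilbertBasis ι ℂ H) (e : ι → ℝ), ∀ i, b i ∈ eig h (e i) := by
  have hs := hh.selfAdjoint
  obtain ⟨z, R, hRc, hR1, hR2⟩ := hh.compactResolvent
  -- The adjoint of the resolvent at `z` is the resolvent at the conjugate of `z`. As `z` need not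
  -- be real, `R` is only normal, and it is `R* R` that gets diagonalized.
  have hRadj (y : H) :
      (R.adjoint y, y + (starRingEnd ℂ z) • R.adjoint y) ∈ h.graph := by
    refine mem_graph_of_forall hs fun x => ?_
    have h1 : R (h x) = x + z • R x := by
      have := hR2 x
      rw [map_sub, map_smul, sub_eq_iff_eq_add] at this
      exact this
    rw [ContinuousLinearMap.adjoint_inner_left, h1, inner_add_left, inner_add_right,
      inner_smul_left, inner_smul_right, Complex.conj_conj, ContinuousLinearMap.adjoint_inner_left]
  have hinv (p : H × H) (hp : p ∈ h.graph) : R (p.2 - z • p.1) = p.1 := by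
    obtain ⟨x, hx1, hx2⟩ := LinearPMap.mem_graph_iff h |>.mp hp
    rw [← hx1, ← hx2]
    exact hR2 x
  have hinj (x : H) (hx : R x = 0) : x = 0 := by
    have h1 := hR1 x
    rw [hx, smul_zero, add_zero] at h1
    exact LinearPMap.graph_fst_eq_zero_snd h h1 rfl
  have hinvadj (p : H × H) (hp : p ∈ h.graph) :
      R.adjoint (p.2 - (starRingEnd ℂ z) • p.1) = p.1 := by
    refine ext_inner_right ℂ fun u => ?_
    have h1 := graph_symm hs hp (hR1 u)
    rw [ContinuousLinearMap.adjoint_inner_left, inner_sub_left, inner_smul_left, Complex.conj_conj,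
      h1, inner_add_right, inner_smul_right, add_sub_cancel_right]
  have hnormal (y : H) : R (R.adjoint y) = R.adjoint (R y) := by
    have h1 := hinv _ (hRadj y)
    have h2 := hinvadj _ (hR1 y)
    simp only [map_sub, map_add, map_smul] at h1 h2
    -- The resolvent identity kills the commutator of `R` and `R*` unless `z` is real, and in that
    -- case `R = R*`.
    have h3 : (starRingEnd ℂ z - z) • (R (R.adjoint y) - R.adjoint (R y)) = 0 := by
      have : (starRingEnd ℂ z - z) • (R (R.adjoint y) - R.adjoint (R y)) =
        (R y + (starRingEnd ℂ z) • R (R.adjoint y) - z • R (R.adjoint y) - R.adjoint y) +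
        (R.adjoint y + z • R.adjoint (R y) - (starRingEnd ℂ z) • R.adjoint (R y) - R y) := by
        module
      rw [this, h1, h2, sub_self, sub_self, add_zero]
    rcases smul_eq_zero.mp h3 with h4 | h4
    · have h5 (y : H) : R y = R.adjoint y := by
        have := hinv _ (hRadj y)
        rwa [sub_eq_zero.mp h4, add_sub_cancel_right] at this
      rw [← h5, ← h5]
    · exact sub_eq_zero.mp h4
  obtain ⟨κ, b, a, -, hb⟩ := exists_eigenbasis
    (ContinuousLinearMap.isPositive_adjoint_comp_self R) (hRc.clm_comp R.adjoint)
  refine exists_basis_of_orthogonal (eigSub h) (fun e => ?_)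
    (fun e f hef x hx y hy => inner_eq_zero_of_eig hs hef hx hy) fun x hx =>
      eq_zero_of_inner_basis b fun i => ?_
  · exact hs.isClosed.preimage (f := fun x : H => (x, (e : ℂ) • x)) (by fun_prop)
  set T : H →L[ℂ] H := R.adjoint ∘L R with hT
  have ha : (a i : ℂ) ≠ 0 := by
    intro h0
    have h1 := hb i
    rw [h0, zero_smul] at h1
    have h2 : R (b i) = 0 := by
      rw [← inner_self_eq_zero (𝕜 := ℂ), ← ContinuousLinearMap.adjoint_inner_right]
      exact (congrArg _ h1).trans (inner_zero_right _)
    have h3 := norm_basis b i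
    rw [hinj _ h2, norm_zero] at h3
    exact zero_ne_one h3
  -- This eigenspace of `R* R` is finite dimensional and invariant under the injective `R`, so `R`
  -- is invertible on it. There `h = R⁻¹ + z` is a symmetric operator in finite dimension, and its
  -- eigenvectors span a space containing `b i`.
  set E := Module.End.eigenspace (T : H →ₗ[ℂ] H) (a i : ℂ)
  have hmem (x : H) : x ∈ E ↔ T x = (a i : ℂ) • x := Module.End.mem_eigenspace_iff
  have hfin : FiniteDimensional ℂ E :=
    ContinuousLinearMap.finite_dimensional_eigenspace (hRc.clm_comp R.adjoint) _ ha
  have hRE : ∀ x ∈ E, (R : H →ₗ[ℂ] H) x ∈ E := by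
    intro x hx
    rw [hmem] at hx ⊢
    have h1 : T (R x) = R (T x) := (hnormal (R x)).symm
    rw [ContinuousLinearMap.coe_coe, h1, hx, map_smul]
  let RE : E →ₗ[ℂ] E := (R : H →ₗ[ℂ] H).restrict hRE
  have hREi : Function.Injective RE := by
    rw [injective_iff_map_eq_zero]
    intro x hx
    exact Subtype.ext (hinj x (congrArg Subtype.val hx))
  have hREs : Function.Surjective RE := LinearMap.surjective_of_injective hREi
  let eqv := LinearEquiv.ofBijective RE ⟨hREi, hREs⟩
  let A : E →ₗ[ℂ] E := eqv.symm.toLinearMap + z • LinearMap.id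
  have hA (u : E) : ((u : H), (A u : H)) ∈ h.graph := by
    have h1 := hR1 (eqv.symm u : E)
    have h2 : R (eqv.symm u : E) = (u : H) := congrArg Subtype.val (eqv.apply_symm_apply u)
    rw [h2] at h1
    exact h1
  have hAs : A.IsSymmetric := fun u v => graph_symm hs (hA u) (hA v)
  let c := hAs.eigenvectorBasis rfl
  have hc (k) : ((c k : E) : H) ∈ eig h (hAs.eigenvalues rfl k) := by
    have h1 := hA (c k)
    rw [hAs.apply_eigenvectorBasis rfl k] at h1
    exact h1
  have hbi : b i ∈ E := (hmem _).mpr (hb i)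
  have hsum := congrArg Subtype.val (c.sum_repr ⟨b i, hbi⟩)
  simp only at hsum
  rw [← hsum, Submodule.coe_sum, sum_inner]
  refine Finset.sum_eq_zero fun k _ => ?_
  rw [Submodule.coe_smul, inner_smul_left, hx _ _ (hc k), mul_zero]

end Hamiltonian

/-! ### The two-particle space: product bases and marginals. -/

section TwoParticles

variable {H : Type*} [NormedAddCommGroup H] [InnerProductSpace ℂ H] {ι κ : Type*}

/-- The bounded operator `y ↦ x ⊗ y`. -/
def tmulLeft (x : H) : H →L[ℂ] Two H :=
  (Completion.toComplL : (H ⊗[ℂ] H) →L[ℂ] Two H).comp (TensorProduct.mkL ℂ H H x)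

@[simp] theorem tmulLeft_apply (x y : H) : tmulLeft x y = tmul x y := rfl

@[simp] theorem tmulRight_apply (x y : H) : tmulRight y x = tmul x y := rfl

theorem inner_tmul (x y x' y' : H) : ⟪tmul x y, tmul x' y'⟫_ℂ = ⟪x, x'⟫_ℂ * ⟪y, y'⟫_ℂ := by
  rw [tmul, tmul, Completion.inner_coe, TensorProduct.inner_tmul]

theorem eq_zero_of_inner_tmul {z : Two H} (hz : ∀ x y : H, ⟪tmul x y, z⟫_ℂ = 0) : z = 0 := by
  have h1 : ∀ w : Two H, ⟪w, z⟫_ℂ = 0 := by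
    intro w
    induction w using Completion.induction_on with
    | hp => exact isClosed_eq (by fun_prop) continuous_const
    | ih w =>
      induction w with
      | zero => rw [Completion.coe_zero, inner_zero_left]
      | add a b ha hb => rw [Completion.coe_add, inner_add_left, ha, hb, add_zero]
      | tmul x y => exact hz x y
  exact inner_self_eq_zero.mp (h1 z)

theorem clm_ext_tmul {L : Type*} [NormedAddCommGroup L] [InnerProductSpace ℂ L]
    {A B : Two H →L[ℂ] L}
    (hAB : ∀ x y : H, A (tmul x y) = B (tmul x y)) : A = B := by
  ext w
  induction w using Completion.induction_on with
  | hp => exact isClosed_eq A.continuous B.continuous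
  | ih w =>
    induction w with
    | zero => rw [Completion.coe_zero, map_zero, map_zero]
    | add a b ha hb => rw [Completion.coe_add, map_add, map_add, ha, hb]
    | tmul x y => exact hAB x y

theorem swap_tmul (x y : H) : swap (tmul x y) = tmul y x := by
  rw [swap, tmul, ContinuousLinearMap.completion_apply_coe]
  rfl

theorem star_swap [CompleteSpace H] : star (swap : Two H →L[ℂ] Two H) = swap := by
  rw [ContinuousLinearMap.star_eq_adjoint]
  refine clm_ext_tmul fun x y => ?_
  rw [← sub_eq_zero]
  refine eq_zero_of_inner_tmul fun x' y' => ?_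
  rw [inner_sub_right, ContinuousLinearMap.adjoint_inner_right, swap_tmul, swap_tmul, inner_tmul,
    inner_tmul, mul_comm, sub_self]

variable [CompleteSpace H]

theorem opTensor_tmul (A B : H →L[ℂ] H) (x y : H) :
    opTensor A B (tmul x y) = tmul (A x) (B y) := by
  rw [opTensor, tmul, ContinuousLinearMap.completion_apply_coe]
  rfl

theorem tmul_add_left (x x' y : H) : tmul (x + x') y = tmul x y + tmul x' y :=
  map_add (tmulRight y) x x'

theorem tmul_add_right (x y y' : H) : tmul x (y + y') = tmul x y + tmul x y' :=
  map_add (tmulLeft x) y y'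

theorem tmul_smul_left (c : ℂ) (x y : H) : tmul (c • x) y = c • tmul x y :=
  map_smul (tmulRight y) c x

theorem tmul_smul_right (c : ℂ) (x y : H) : tmul x (c • y) = c • tmul x y :=
  map_smul (tmulLeft x) c y

theorem opTensor_add_left (A A' B : H →L[ℂ] H) :
    opTensor (A + A') B = opTensor A B + opTensor A' B :=
  clm_ext_tmul fun x y => by simp only [opTensor_tmul, add_apply, tmul_add_left]

theorem opTensor_add_right (A B B' : H →L[ℂ] H) :
    opTensor A (B + B') = opTensor A B + opTensor A B' :=
  clm_ext_tmul fun x y => by simp only [opTensor_tmul, add_apply, tmul_add_right]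

theorem opTensor_smul_left (c : ℝ) (A B : H →L[ℂ] H) :
    opTensor (c • A) B = c • opTensor A B :=
  clm_ext_tmul fun x y => by
    simp only [opTensor_tmul, ← Complex.coe_smul, smul_apply, tmul_smul_left]

theorem opTensor_smul_right (c : ℝ) (A B : H →L[ℂ] H) :
    opTensor A (c • B) = c • opTensor A B :=
  clm_ext_tmul fun x y => by
    simp only [opTensor_tmul, ← Complex.coe_smul, smul_apply, tmul_smul_right]

theorem adjoint_opTensor (A B : H →L[ℂ] H) :
    (opTensor A B).adjoint = opTensor A.adjoint B.adjoint := by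
  refine clm_ext_tmul fun x y => ?_
  rw [← sub_eq_zero]
  refine eq_zero_of_inner_tmul fun x' y' => ?_
  rw [inner_sub_right, ContinuousLinearMap.adjoint_inner_right, opTensor_tmul, opTensor_tmul,
    inner_tmul, inner_tmul, ContinuousLinearMap.adjoint_inner_right,
    ContinuousLinearMap.adjoint_inner_right, sub_self]

theorem opTensor_isPositive {A B : H →L[ℂ] H} (hA : A.IsPositive) (hB : B.IsPositive) :
    (opTensor A B).IsPositive := by
  obtain ⟨Y, hY, -⟩ := exists_factor hA
  obtain ⟨Z, hZ, -⟩ := exists_factor hB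
  have : opTensor A B = (opTensor Y Z).adjoint ∘L opTensor Y Z := by
    rw [adjoint_opTensor, hY, hZ]
    exact clm_ext_tmul fun x y => by simp [opTensor_tmul]
  rw [this]
  exact ContinuousLinearMap.isPositive_adjoint_comp_self _

/-- The product of two orthonormal bases. -/
def prodBasis (b : HilbertBasis ι ℂ H) (c : HilbertBasis κ ℂ H) :
    HilbertBasis (ι × κ) ℂ (Two H) :=
  HilbertBasis.mkOfOrthogonalEqBot (v := fun p : ι × κ => tmul (b p.1) (c p.2))
    (by
      classical
      rw [orthonormal_iff_ite]
      rintro ⟨i, j⟩ ⟨i', j'⟩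
      rw [inner_tmul, inner_basis, inner_basis]
      by_cases hi : i = i' <;> by_cases hj : j = j' <;> simp [hi, hj])
    (by
      rw [Submodule.eq_bot_iff]
      intro z hz
      have h1 (i j) : ⟪tmul (b i) (c j), z⟫_ℂ = 0 :=
        (Submodule.mem_orthogonal _ _).mp hz _ (Submodule.subset_span ⟨(i, j), rfl⟩)
      have h2 (x : H) (j) : ⟪tmul x (c j), z⟫_ℂ = 0 := by
        have : (tmulRight (c j)).adjoint z = 0 := eq_zero_of_inner_basis b fun i => by
          rw [ContinuousLinearMap.adjoint_inner_right, tmulRight_apply, h1]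
        rw [← tmulRight_apply, ← ContinuousLinearMap.adjoint_inner_right, this, inner_zero_right]
      refine eq_zero_of_inner_tmul fun x y => ?_
      have : (tmulLeft x).adjoint z = 0 := eq_zero_of_inner_basis c fun j => by
        rw [ContinuousLinearMap.adjoint_inner_right, tmulLeft_apply, h2]
      rw [← tmulLeft_apply, ← ContinuousLinearMap.adjoint_inner_right, this, inner_zero_right])

@[simp] theorem prodBasis_apply (b : HilbertBasis ι ℂ H) (c : HilbertBasis κ ℂ H) (p : ι × κ) :
    prodBasis b c p = tmul (b p.1) (c p.2) := by
  rw [prodBasis, HilbertBasis.coe_mkOfOrthogonalEqBot]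

/-- The squared norm of the first marginal of `u` at `x`. -/
def marg₁ (x : H) (u : Two H) : ℝ≥0∞ := ‖(tmulLeft x).adjoint u‖ₑ ^ 2

/-- The squared norm of the second marginal of `u` at `y`. -/
def marg₂ (y : H) (u : Two H) : ℝ≥0∞ := ‖(tmulRight y).adjoint u‖ₑ ^ 2

theorem marg₁_eq (c : HilbertBasis κ ℂ H) (x : H) (u : Two H) :
    marg₁ x u = ∑' j, ‖⟪tmul x (c j), u⟫_ℂ‖ₑ ^ 2 := by
  rw [marg₁, ← tsum_enorm_inner c]
  simp only [ContinuousLinearMap.adjoint_inner_right, tmulLeft_apply]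

theorem marg₂_eq (b : HilbertBasis ι ℂ H) (y : H) (u : Two H) :
    marg₂ y u = ∑' i, ‖⟪tmul (b i) y, u⟫_ℂ‖ₑ ^ 2 := by
  rw [marg₂, ← tsum_enorm_inner b]
  simp only [ContinuousLinearMap.adjoint_inner_right, tmulRight_apply]

/-- Additive weights on a product basis see only the two marginals. This is how the logarithm of a
product state splits into one-particle terms. -/
theorem tsum_prod_marg (b : HilbertBasis ι ℂ H) (c : HilbertBasis κ ℂ H) (f : ι → ℝ≥0∞)
    (g : κ → ℝ≥0∞) (u : Two H) :
    ∑' p : ι × κ, (f p.1 + g p.2) * ‖⟪prodBasis b c p, u⟫_ℂ‖ₑ ^ 2 =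
      ∑' i, f i * marg₁ (b i) u + ∑' j, g j * marg₂ (c j) u := by
  simp only [add_mul, prodBasis_apply]
  rw [ENNReal.tsum_add]
  congr 1
  · rw [ENNReal.tsum_prod']
    simp only [ENNReal.tsum_mul_left, marg₁_eq c]
  · rw [ENNReal.tsum_prod', ENNReal.tsum_comm]
    simp only [ENNReal.tsum_mul_left, marg₂_eq b]

end TwoParticles

/-! ### Isometries that conserve the energy. -/

section Blocks

variable {K : Type*} [NormedAddCommGroup K] [InnerProductSpace ℂ K] [CompleteSpace K] {κ : Type*}

/-- The part of a vector along a subset of an orthonormal basis. -/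
theorem exists_restrict (b : HilbertBasis κ ℂ K) (P : κ → Prop) [DecidablePred P] (v : K) :
    ∃ p, ∀ k, ⟪b k, p⟫_ℂ = if P k then ⟪b k, v⟫_ℂ else 0 := by
  have hm : Memℓp (fun k => if P k then ⟪b k, v⟫_ℂ else 0) 2 := by
    refine memℓp_gen ?_
    refine Summable.of_nonneg_of_le (fun _ => by positivity) (fun k => ?_)
      (hasSum_norm_inner_sq b v).summable
    split_ifs <;> simp
  refine ⟨b.repr.symm ⟨_, hm⟩, fun k => ?_⟩
  rw [← b.repr_apply_apply, LinearIsometryEquiv.apply_symm_apply]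

theorem enorm_ite_sq (P : Prop) [Decidable P] (c : ℂ) :
    ‖(if P then c else 0)‖ₑ ^ 2 = if P then ‖c‖ₑ ^ 2 else 0 := by
  split_ifs <;> simp

/-- An isometry that preserves the energy does not change the distribution of the energy. -/
theorem tsum_weight_map (b : HilbertBasis κ ℂ K) (E : κ → ℝ) (U : K →L[ℂ] K)
    (hU : ∀ z, ‖U z‖ = ‖z‖) (hE : ∀ k i, E k ≠ E i → ⟪b k, U (b i)⟫_ℂ = 0) (w : κ → ℝ≥0∞)
    (hw : ∀ k i, E k = E i → w k = w i) (v : K) :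
    ∑' k, w k * ‖⟪b k, U v⟫_ℂ‖ₑ ^ 2 = ∑' k, w k * ‖⟪b k, v⟫_ℂ‖ₑ ^ 2 := by
  classical
  have hUi (k : κ) (x : K) : ⟪b k, U x⟫_ℂ = ∑' i, ⟪b k, U (b i)⟫_ℂ * ⟪b i, x⟫_ℂ := by
    rw [← ContinuousLinearMap.adjoint_inner_left, ← b.tsum_inner_mul_inner]
    simp only [ContinuousLinearMap.adjoint_inner_left]
  -- The part of `v` at energy `e` is mapped by `U` to the part of `U v` at energy `e`, so the two
  -- have the same norm.
  have key (e : ℝ) : ∑' k, (if E k = e then ‖⟪b k, U v⟫_ℂ‖ₑ ^ 2 else 0) =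
      ∑' k, if E k = e then ‖⟪b k, v⟫_ℂ‖ₑ ^ 2 else 0 := by
    obtain ⟨p, hp⟩ := exists_restrict b (fun k => E k = e) v
    have h1 (k : κ) : ⟪b k, U p⟫_ℂ = if E k = e then ⟪b k, U v⟫_ℂ else 0 := by
      rw [hUi, hUi]
      split_ifs with hk
      · refine tsum_congr fun i => ?_
        by_cases hki : E k = E i
        · rw [hp, if_pos (hki.symm.trans hk)]
        · rw [hE k i hki, zero_mul, zero_mul]
      · rw [← tsum_zero (α := ℂ) (β := κ)]
        refine tsum_congr fun i => ?_
        by_cases hki : E k = E i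
        · rw [hp, if_neg (hki ▸ hk), mul_zero]
        · rw [hE k i hki, zero_mul]
    have h2 := tsum_enorm_inner b (U p)
    have h3 := tsum_enorm_inner b p
    simp only [h1, enorm_ite_sq] at h2
    simp only [hp, enorm_ite_sq] at h3
    rw [h2, h3, ← ofReal_norm_sq, hU, ofReal_norm_sq]
  -- The weight as a function of the energy alone; the value 0 at energies that do not occur is
  -- never used.
  let c : ℝ → ℝ≥0∞ := fun e => if h : ∃ k, E k = e then w h.choose else 0
  have hc (k : κ) : c (E k) = w k := by
    have h : ∃ k', E k' = E k := ⟨k, rfl⟩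
    rw [show c (E k) = w h.choose from dif_pos h]
    exact hw _ _ h.choose_spec
  simp only [← hc]
  rw [← tsum_fiber c E, ← tsum_fiber c E]
  simp only [key]

end Blocks

/-! ### The two-particle Hamiltonian and the averaged collision operator. -/

section Collisions

variable {H : Type*} [NormedAddCommGroup H] [InnerProductSpace ℂ H] [CompleteSpace H] {ι κ : Type*}
  {h : H →ₗ.[ℂ] H}

/-- For fixed `k` the relation is linear and closed in `p`, so it needs checking only on the
generators, where it is the symmetry of `h` against the eigenvectors `φ`. -/
theorem inner_snd_ham₂ (hs : IsSelfAdjoint h) (φ : HilbertBasis ι ℂ H) (e : ι → ℝ)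
    (hφ : ∀ i, φ i ∈ eig h (e i)) {p : Two H × Two H}
    (hp : p ∈ (Submodule.span ℂ {p : Two H × Two H | ∃ x y : h.domain,
      p = (tmul (x : H) y, tmul (h x) y + tmul (x : H) (h y))}).topologicalClosure) (k : ι × ι) :
    ⟪prodBasis φ φ k, p.2⟫_ℂ = ((e k.1 + e k.2 : ℝ) : ℂ) * ⟪prodBasis φ φ k, p.1⟫_ℂ := by
  let S : Submodule ℂ (Two H × Two H) :=
    ((innerSL ℂ (prodBasis φ φ k)).comp (ContinuousLinearMap.snd ℂ (Two H) (Two H)) -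
      ((e k.1 + e k.2 : ℝ) : ℂ) • (innerSL ℂ (prodBasis φ φ k)).comp
        (ContinuousLinearMap.fst ℂ (Two H) (Two H))).ker
  have hS (p : Two H × Two H) : p ∈ S ↔
      ⟪prodBasis φ φ k, p.2⟫_ℂ = ((e k.1 + e k.2 : ℝ) : ℂ) * ⟪prodBasis φ φ k, p.1⟫_ℂ := by
    rw [← sub_eq_zero (a := ⟪prodBasis φ φ k, p.2⟫_ℂ)]
    exact LinearMap.mem_ker
  refine (hS p).mp (Submodule.topologicalClosure_minimal _ (Submodule.span_le.mpr ?_)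
    (ContinuousLinearMap.isClosed_ker _) hp)
  rintro _ ⟨x, y, rfl⟩
  refine (hS _).mpr ?_
  have h1 := graph_symm hs (hφ k.1) (LinearPMap.mem_graph h x)
  have h2 := graph_symm hs (hφ k.2) (LinearPMap.mem_graph h y)
  simp only [inner_smul_left, Complex.conj_ofReal] at h1 h2
  simp only [prodBasis_apply, inner_add_right, inner_tmul, ← h1, ← h2]
  push_cast
  ring

/-- `toLinearPMap` has the prescribed graph only if the relation is single valued. If (0, y) lies in
the closure, `inner_snd_ham₂` makes y orthogonal to the product basis. -/
theorem graph_ham₂ (hs : IsSelfAdjoint h) (φ : HilbertBasis ι ℂ H) (e : ι → ℝ)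
    (hφ : ∀ i, φ i ∈ eig h (e i)) :
    (ham₂ h).graph = (Submodule.span ℂ {p : Two H × Two H | ∃ x y : h.domain,
      p = (tmul (x : H) y, tmul (h x) y + tmul (x : H) (h y))}).topologicalClosure := by
  refine Submodule.toLinearPMap_graph_eq _ fun p hp h0 => ?_
  refine eq_zero_of_inner_basis (prodBasis φ φ) fun k => ?_
  rw [inner_snd_ham₂ hs φ e hφ hp, h0, inner_zero_right, mul_zero]

theorem prodBasis_mem_eig (hs : IsSelfAdjoint h) (φ : HilbertBasis ι ℂ H) (e : ι → ℝ)
    (hφ : ∀ i, φ i ∈ eig h (e i)) (k : ι × ι) :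
    prodBasis φ φ k ∈ eig (ham₂ h) (e k.1 + e k.2) := by
  rw [eig, Set.mem_ofPred_eq, graph_ham₂ hs φ e hφ]
  refine Submodule.le_topologicalClosure _ (Submodule.subset_span ?_)
  obtain ⟨x, hx1, hx2⟩ := (LinearPMap.mem_graph_iff h).mp (hφ k.1)
  obtain ⟨y, hy1, hy2⟩ := (LinearPMap.mem_graph_iff h).mp (hφ k.2)
  refine ⟨x, y, ?_⟩
  simp only at hx1 hx2 hy1 hy2
  rw [hx1, hx2, hy1, hy2, tmul_smul_left, tmul_smul_right, ← add_smul, prodBasis_apply]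
  push_cast
  rfl

variable {C : Type*} [MetricSpace C] [CompactSpace C] [MeasurableSpace C] [BorelSpace C]

theorem CollisionSpec.norm_U (S : CollisionSpec h C) (σ : C) (z : Two H) :
    ‖(S.U σ : Two H →L[ℂ] Two H) z‖ = ‖z‖ := norm_unitary_apply _ z

/-- A collision maps an eigenvector of `H₂` to an eigenvector with the same eigenvalue, which has no
component at another energy. -/
theorem CollisionSpec.inner_U (S : CollisionSpec h C) (hs : IsSelfAdjoint h)
    (φ : HilbertBasis ι ℂ H) (e : ι → ℝ) (hφ : ∀ i, φ i ∈ eig h (e i)) (σ : C) (k i : ι × ι)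
    (hki : e k.1 + e k.2 ≠ e i.1 + e i.2) :
    ⟪prodBasis φ φ k, (S.U σ : Two H →L[ℂ] Two H) (prodBasis φ φ i)⟫_ℂ = 0 := by
  have h1 := S.commute σ _ (prodBasis_mem_eig hs φ e hφ i)
  rw [graph_ham₂ hs φ e hφ] at h1
  have h2 := inner_snd_ham₂ hs φ e hφ h1 k
  simp only [map_smul, inner_smul_right] at h2
  rw [← sub_eq_zero, ← sub_mul, mul_eq_zero] at h2
  refine h2.resolve_left fun h3 => hki ?_
  exact_mod_cast (sub_eq_zero.mp h3).symm

theorem CollisionSpec.tsum_weight (S : CollisionSpec h C) (hs : IsSelfAdjoint h)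
    (φ : HilbertBasis ι ℂ H) (e : ι → ℝ) (hφ : ∀ i, φ i ∈ eig h (e i)) (σ : C)
    (w : ι × ι → ℝ≥0∞)
    (hw : ∀ k i : ι × ι, e k.1 + e k.2 = e i.1 + e i.2 → w k = w i) (v : Two H) :
    ∑' k, w k * ‖⟪prodBasis φ φ k, (S.U σ : Two H →L[ℂ] Two H) v⟫_ℂ‖ₑ ^ 2 =
      ∑' k, w k * ‖⟪prodBasis φ φ k, v⟫_ℂ‖ₑ ^ 2 :=
  tsum_weight_map (prodBasis φ φ) (fun k => e k.1 + e k.2) _ (S.norm_U σ)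
    (S.inner_U hs φ e hφ σ) w hw v

/-! ### The collision operator -/

theorem CollisionSpec.inner_star_U (S : CollisionSpec h C) (σ : C) (z w : Two H) :
    ⟪(star (S.U σ) : Two H →L[ℂ] Two H) z, w⟫_ℂ = ⟪z, (S.U σ : Two H →L[ℂ] Two H) w⟫_ℂ := by
  rw [ContinuousLinearMap.star_eq_adjoint, ContinuousLinearMap.adjoint_inner_left]

theorem CollisionSpec.collision_apply (S : CollisionSpec h C) (X : Two H →L[ℂ] Two H) (z : Two H) :
    S.collision X z = ∫ σ, (S.U σ : Two H →L[ℂ] Two H)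
      (X ((star (S.U σ) : Two H →L[ℂ] Two H) z)) ∂S.ν := rfl

theorem CollisionSpec.inner_collision (S : CollisionSpec h C) (X : Two H →L[ℂ] Two H)
    (z w : Two H) : ⟪w, S.collision X z⟫_ℂ = ∫ σ, ⟪(star (S.U σ) : Two H →L[ℂ] Two H) w,
      X ((star (S.U σ) : Two H →L[ℂ] Two H) z)⟫_ℂ ∂S.ν := by
  rw [S.collision_apply, ← integral_inner (S.integrable_conj X z)]
  simp only [S.inner_star_U]

theorem isPositive_of_inner {K : Type*} [NormedAddCommGroup K] [InnerProductSpace ℂ K]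
    {T : K →L[ℂ] K} (hT : ∀ x y, ⟪T x, y⟫_ℂ = ⟪x, T y⟫_ℂ) (hp : ∀ x, 0 ≤ (⟪x, T x⟫_ℂ).re) :
    T.IsPositive :=
  ContinuousLinearMap.isPositive_def.mpr ⟨hT, fun x => by
    rw [ContinuousLinearMap.reApplyInnerSelf, hT]
    exact hp x⟩

theorem CollisionSpec.integrable_inner (S : CollisionSpec h C) (X : Two H →L[ℂ] Two H)
    (z w : Two H) : Integrable (fun σ => ⟪(star (S.U σ) : Two H →L[ℂ] Two H) w,
      X ((star (S.U σ) : Two H →L[ℂ] Two H) z)⟫_ℂ) S.ν := by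
  simp only [S.inner_star_U]
  exact (S.integrable_conj X z).const_inner w

theorem CollisionSpec.re_inner_collision (S : CollisionSpec h C) (X : Two H →L[ℂ] Two H)
    (z : Two H) : (⟪z, S.collision X z⟫_ℂ).re = ∫ σ, (⟪(star (S.U σ) : Two H →L[ℂ] Two H) z,
      X ((star (S.U σ) : Two H →L[ℂ] Two H) z)⟫_ℂ).re ∂S.ν := by
  rw [S.inner_collision]
  exact (Complex.reCLM.integral_comp_comm (S.integrable_inner X z z)).symm

theorem CollisionSpec.collision_isPositive (S : CollisionSpec h C) {X : Two H →L[ℂ] Two H}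
    (hX : X.IsPositive) : (S.collision X).IsPositive := by
  refine isPositive_of_inner (fun z w => ?_) fun z => ?_
  · rw [← inner_conj_symm, S.inner_collision, S.inner_collision, ← integral_conj]
    refine integral_congr_ae (Filter.Eventually.of_forall fun σ => ?_)
    simp only [inner_conj_symm]
    exact inner_self_symm hX _ _
  · rw [S.re_inner_collision]
    exact integral_nonneg fun σ => re_inner_nonneg hX _

theorem CollisionSpec.qf_collision (S : CollisionSpec h C) {X : Two H →L[ℂ] Two H}
    (hX : X.IsPositive) (z : Two H) :
    qf (S.collision X) z = ∫⁻ σ, qf X ((star (S.U σ) : Two H →L[ℂ] Two H) z) ∂S.ν := by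
  rw [qf, S.re_inner_collision]
  exact ofReal_integral_eq_lintegral_ofReal
    (S.integrable_inner X z z).re (Filter.Eventually.of_forall fun σ => re_inner_nonneg hX _)

theorem CollisionSpec.measurable_qf (S : CollisionSpec h C) (X : Two H →L[ℂ] Two H) (z : Two H) :
    Measurable fun σ => qf X ((star (S.U σ) : Two H →L[ℂ] Two H) z) := by
  unfold qf
  simp only [S.inner_star_U]
  exact (Complex.continuous_re.comp
    (continuous_const.inner (S.continuous_conj X z))).measurable.ennreal_ofReal

theorem CollisionSpec.collision_add (S : CollisionSpec h C) (X Y : Two H →L[ℂ] Two H) :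
    S.collision (X + Y) = S.collision X + S.collision Y := by
  ext z
  simp only [add_apply, S.collision_apply, map_add]
  exact integral_add (S.integrable_conj X z) (S.integrable_conj Y z)

theorem CollisionSpec.collision_smul (S : CollisionSpec h C) (c : ℝ) (X : Two H →L[ℂ] Two H) :
    S.collision (c • X) = c • S.collision X := by
  ext z
  simp only [smul_apply, S.collision_apply, ← Complex.coe_smul, map_smul]
  exact integral_smul (c : ℂ) _

end Collisions

/-! ### Trace calculus for sums and series of positive operators. -/

section Traces

variable {K : Type*} [NormedAddCommGroup K] [InnerProductSpace ℂ K] {ι κ : Type*}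

/-- The trace of a positive operator, in `[0,∞]`. -/
abbrev tr (A : K →L[ℂ] K) : ℝ≥0∞ := traceOn Set.univ A

/-- Positive trace class operators. -/
structure IsTrPos (A : K →L[ℂ] K) : Prop where
  pos : A.IsPositive
  tr_ne_top : tr A ≠ ⊤

theorem IsDensity.isTrPos {A : K →L[ℂ] K} (hA : IsDensity A) : IsTrPos A :=
  ⟨hA.1, by rw [tr, hA.2]; exact ENNReal.one_ne_top⟩

variable [CompleteSpace K]

theorem tr_add {A B : K →L[ℂ] K} (hA : A.IsPositive) (hB : B.IsPositive) :
    tr (A + B) = tr A + tr B := by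
  obtain ⟨_, b, _⟩ := exists_hilbertBasis ℂ K
  simp only [tr, traceOn_univ_eq hA b, traceOn_univ_eq hB b, traceOn_univ_eq (hA.add hB) b,
    qf_add hA hB, ENNReal.tsum_add]

theorem tr_smul {c : ℝ} (hc : 0 ≤ c) {A : K →L[ℂ] K} (hA : A.IsPositive) :
    tr (c • A) = ENNReal.ofReal c * tr A := by
  obtain ⟨_, b, _⟩ := exists_hilbertBasis ℂ K
  simp only [tr, traceOn_univ_eq hA b, traceOn_univ_eq (isPositive_smul hc hA) b,
    qf_smul c hc, ENNReal.tsum_mul_left]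

theorem tr_zero : tr (0 : K →L[ℂ] K) = 0 := by
  obtain ⟨_, b, _⟩ := exists_hilbertBasis ℂ K
  simp only [tr, traceOn_univ_eq ContinuousLinearMap.isPositive_zero b, qf_zero, tsum_zero]

theorem tr_sum {s : Finset ι} {A : ι → K →L[ℂ] K} (hA : ∀ i ∈ s, (A i).IsPositive) :
    tr (∑ i ∈ s, A i) = ∑ i ∈ s, tr (A i) := by
  classical
  induction s using Finset.induction_on with
  | empty => simp only [Finset.sum_empty, tr_zero]
  | insert i s hi ih =>
    rw [Finset.sum_insert hi, Finset.sum_insert hi, tr_add (hA i (Finset.mem_insert_self _ _))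
      (isPositive_sum fun j hj => hA j (Finset.mem_insert_of_mem hj)),
      ih fun j hj => hA j (Finset.mem_insert_of_mem hj)]

theorem IsTrPos.add {A B : K →L[ℂ] K} (hA : IsTrPos A) (hB : IsTrPos B) : IsTrPos (A + B) :=
  ⟨hA.pos.add hB.pos, by
    rw [tr_add hA.pos hB.pos]; exact ENNReal.add_ne_top.mpr ⟨hA.2, hB.2⟩⟩

theorem IsTrPos.smul {c : ℝ} (hc : 0 ≤ c) {A : K →L[ℂ] K} (hA : IsTrPos A) : IsTrPos (c • A) :=
  ⟨isPositive_smul hc hA.pos, by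
    rw [tr_smul hc hA.pos]; exact ENNReal.mul_ne_top ENNReal.ofReal_ne_top hA.2⟩

theorem IsTrPos.sum {s : Finset ι} {A : ι → K →L[ℂ] K} (hA : ∀ i ∈ s, IsTrPos (A i)) :
    IsTrPos (∑ i ∈ s, A i) :=
  ⟨isPositive_sum fun i hi => (hA i hi).pos, by
    rw [tr_sum fun i hi => (hA i hi).pos]
    exact ENNReal.sum_ne_top.mpr fun i hi => (hA i hi).2⟩

/-- Positivity passes to the sum of a series, and so does the quadratic form. -/
theorem isPositive_of_hasSum {A : ι → K →L[ℂ] K} {B : K →L[ℂ] K} (hA : ∀ i, (A i).IsPositive)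
    (h : HasSum A B) : B.IsPositive ∧ ∀ x, qf B x = ∑' i, qf (A i) x := by
  have h1 (x y : K) : HasSum (fun i => ⟪x, A i y⟫_ℂ) ⟪x, B y⟫_ℂ :=
    h.mapL ((innerSL ℂ x).comp (ContinuousLinearMap.apply ℂ K y))
  have h2 (x : K) : HasSum (fun i => (⟪x, A i x⟫_ℂ).re) (⟪x, B x⟫_ℂ).re :=
    Complex.hasSum_re (h1 x x)
  refine ⟨isPositive_of_inner (fun x y => ?_) fun x => ?_, fun x => ?_⟩
  · have h3 := Complex.hasSum_conj'.mpr (h1 y x)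
    rw [inner_conj_symm] at h3
    refine h3.unique ?_
    convert h1 x y using 2 with i
    rw [inner_conj_symm, inner_self_symm (hA i)]
  · exact (h2 x).nonneg fun i => re_inner_nonneg (hA i) x
  · rw [qf, ← (h2 x).tsum_eq, ENNReal.ofReal_tsum_of_nonneg (fun i => re_inner_nonneg (hA i) x)
      (h2 x).summable]
    rfl

theorem summable_of_tr {A : ι → K →L[ℂ] K} (hA : ∀ i, (A i).IsPositive)
    (h : ∑' i, tr (A i) ≠ ⊤) : Summable A := by
  refine Summable.of_norm_bounded (ENNReal.summable_toReal h) fun i => ?_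
  refine norm_le_trace (hA i) ENNReal.toReal_nonneg (le_of_eq ?_)
  rw [ENNReal.ofReal_toReal (ENNReal.ne_top_of_tsum_ne_top h i)]

end Traces

/-! ### The partial trace of positive trace class operators. -/

section PartialTrace

variable {H : Type*} [NormedAddCommGroup H] [InnerProductSpace ℂ H] [CompleteSpace H] {ι κ : Type*}

/-- The summands of the partial trace. -/
def slice (X : Two H →L[ℂ] Two H) (y : H) : H →L[ℂ] H :=
  (tmulRight y).adjoint ∘L X ∘L tmulRight y

theorem qf_slice (X : Two H →L[ℂ] Two H) (y x : H) : qf (slice X y) x = qf X (tmul x y) := by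
  rw [qf, slice, ContinuousLinearMap.comp_apply, ContinuousLinearMap.adjoint_inner_right]
  rfl

theorem slice_isPositive {X : Two H →L[ℂ] Two H} (hX : X.IsPositive) (y : H) :
    (slice X y).IsPositive := hX.adjoint_conj (tmulRight y)

theorem tsum_tr_slice {X : Two H →L[ℂ] Two H} (hX : X.IsPositive) (b : HilbertBasis ι ℂ H)
    : ∑' j, tr (slice X (b j)) = tr X := by
  simp only [tr, traceOn_univ_eq (slice_isPositive hX _) b, traceOn_univ_eq hX (prodBasis b b),
    qf_slice, prodBasis_apply]
  rw [ENNReal.tsum_comm, ← ENNReal.tsum_prod]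

theorem hasSum_partialTrace {X : Two H →L[ℂ] Two H} (hX : IsTrPos X) :
    HasSum (fun j => slice X (stdBasis H j)) (partialTrace X) :=
  (summable_of_tr (fun _ => slice_isPositive hX.pos _)
    (by rw [tsum_tr_slice hX.pos]; exact hX.tr_ne_top)).hasSum

theorem partialTrace_isPositive {X : Two H →L[ℂ] Two H} (hX : IsTrPos X) :
    (partialTrace X).IsPositive :=
  (isPositive_of_hasSum (fun _ => slice_isPositive hX.pos _) (hasSum_partialTrace hX)).1

theorem qf_partialTrace {X : Two H →L[ℂ] Two H} (hX : IsTrPos X) (x : H) :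
    qf (partialTrace X) x = ∑' j, qf X (tmul x (stdBasis H j)) := by
  rw [(isPositive_of_hasSum (fun _ => slice_isPositive hX.pos _) (hasSum_partialTrace hX)).2]
  simp only [qf_slice]

theorem tr_partialTrace {X : Two H →L[ℂ] Two H} (hX : IsTrPos X) :
    tr (partialTrace X) = tr X := by
  rw [tr, tr, traceOn_univ_eq (partialTrace_isPositive hX) (stdBasis H),
    traceOn_univ_eq hX.pos (prodBasis (stdBasis H) (stdBasis H))]
  simp only [qf_partialTrace hX, prodBasis_apply]
  rw [← ENNReal.tsum_prod]

theorem partialTrace_add {X Y : Two H →L[ℂ] Two H} (hX : IsTrPos X) (hY : IsTrPos Y) :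
    partialTrace (X + Y) = partialTrace X + partialTrace Y := by
  refine HasSum.tsum_eq ?_
  convert (hasSum_partialTrace hX).add (hasSum_partialTrace hY) using 2 with j
  ext x
  simp [slice]

theorem partialTrace_smul (c : ℝ) {X : Two H →L[ℂ] Two H} (hX : IsTrPos X) :
    partialTrace (c • X) = c • partialTrace X := by
  refine HasSum.tsum_eq ?_
  convert (hasSum_partialTrace hX).const_smul c using 2 with j
  ext x
  simp only [slice, ContinuousLinearMap.comp_apply, smul_apply, ← Complex.coe_smul, map_smul]

theorem qf_opTensor {A B : H →L[ℂ] H} (hA : A.IsPositive) (hB : B.IsPositive) (x y : H) :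
    qf (opTensor A B) (tmul x y) = qf A x * qf B y := by
  obtain ⟨Y, hY, hY'⟩ := exists_factor hA
  obtain ⟨Z, hZ, hZ'⟩ := exists_factor hB
  have : opTensor A B = (opTensor Y Z).adjoint ∘L opTensor Y Z := by
    rw [adjoint_opTensor, hY, hZ]
    exact clm_ext_tmul fun x y => by simp [opTensor_tmul]
  rw [qf, this, ContinuousLinearMap.comp_apply, ContinuousLinearMap.adjoint_inner_right,
    opTensor_tmul, inner_tmul, hY', hZ', ← ofReal_norm_sq, ← ofReal_norm_sq,
    ← ENNReal.ofReal_mul (sq_nonneg _), inner_self_eq_norm_sq_to_K, inner_self_eq_norm_sq_to_K]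
  norm_cast

theorem tr_opTensor {A B : H →L[ℂ] H} (hA : A.IsPositive) (hB : B.IsPositive) :
    tr (opTensor A B) = tr A * tr B := by
  have b := stdBasis H
  rw [tr, tr, tr, traceOn_univ_eq hA b, traceOn_univ_eq hB b,
    traceOn_univ_eq (opTensor_isPositive hA hB) (prodBasis b b), ENNReal.tsum_prod']
  simp only [prodBasis_apply, qf_opTensor hA hB, ENNReal.tsum_mul_left, ENNReal.tsum_mul_right]

theorem IsTrPos.opTensor {A B : H →L[ℂ] H} (hA : IsTrPos A) (hB : IsTrPos B) :
    IsTrPos (opTensor A B) :=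
  ⟨opTensor_isPositive hA.pos hB.pos, by
    rw [tr_opTensor hA.pos hB.pos]; exact ENNReal.mul_ne_top hA.2 hB.2⟩

end PartialTrace

/-! ### The Wild convolution: trace, bilinearity and marginals. -/

section Wild

variable {H : Type*} [NormedAddCommGroup H] [InnerProductSpace ℂ H] [CompleteSpace H]
  [TopologicalSpace.SeparableSpace H] {ι κ : Type*}
  {h : H →ₗ.[ℂ] H}
  {C : Type*} [MetricSpace C] [CompactSpace C] [MeasurableSpace C] [BorelSpace C]

/-- For each fixed collision the trace is a squared Hilbert-Schmidt norm, which does not change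
under a unitary; a countable basis lets the trace pass under the integral. -/
theorem CollisionSpec.tr_collision (S : CollisionSpec h C) {X : Two H →L[ℂ] Two H}
    (hX : X.IsPositive) : tr (S.collision X) = tr X := by
  have := S.isProbability
  have := countable_of_basis (stdBasis H)
  obtain ⟨Y, -, hY⟩ := exists_factor hX
  set b := prodBasis (stdBasis H) (stdBasis H)
  rw [tr, traceOn_univ_eq (S.collision_isPositive hX) b]
  simp only [S.qf_collision hX]
  rw [← lintegral_tsum fun i => (S.measurable_qf X _).aemeasurable]
  have h1 (σ : C) : ∑' i, qf X ((star (S.U σ) : Two H →L[ℂ] Two H) (b i)) = tr X := by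
    simp only [hY, tr, traceOn_univ_eq hX b]
    rw [tsum_enorm_adjoint Y b b]
    have h2 := tsum_enorm_adjoint (Y ∘L (star (S.U σ) : Two H →L[ℂ] Two H)) b b
    simp only [ContinuousLinearMap.comp_apply] at h2
    rw [h2]
    refine tsum_congr fun j => ?_
    rw [ContinuousLinearMap.adjoint_comp, ContinuousLinearMap.comp_apply,
      ContinuousLinearMap.star_eq_adjoint, ContinuousLinearMap.adjoint_adjoint,
      ← ofReal_norm_sq, S.norm_U, ofReal_norm_sq]
  simp only [h1]
  simp

theorem CollisionSpec.isTrPos_collision (S : CollisionSpec h C) {X : Two H →L[ℂ] Two H}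
    (hX : IsTrPos X) : IsTrPos (S.collision X) :=
  ⟨S.collision_isPositive hX.pos, by rw [S.tr_collision hX.pos]; exact hX.2⟩

variable (S : CollisionSpec h C)

theorem CollisionSpec.tr_wild {A B : H →L[ℂ] H} (hA : IsTrPos A) (hB : IsTrPos B) :
    tr (S.wild A B) = tr A * tr B := by
  rw [CollisionSpec.wild, tr_partialTrace (S.isTrPos_collision (hA.opTensor hB)),
    S.tr_collision (hA.opTensor hB).pos, tr_opTensor hA.pos hB.pos]

theorem CollisionSpec.isTrPos_wild {A B : H →L[ℂ] H} (hA : IsTrPos A) (hB : IsTrPos B) :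
    IsTrPos (S.wild A B) :=
  ⟨partialTrace_isPositive (S.isTrPos_collision (hA.opTensor hB)), by
    rw [S.tr_wild hA hB]; exact ENNReal.mul_ne_top hA.2 hB.2⟩

theorem CollisionSpec.isDensity_wild {A B : H →L[ℂ] H} (hA : IsDensity A) (hB : IsDensity B) :
    IsDensity (S.wild A B) :=
  ⟨(S.isTrPos_wild hA.isTrPos hB.isTrPos).pos, by
    have := S.tr_wild hA.isTrPos hB.isTrPos
    rwa [tr, tr, tr, hA.2, hB.2, one_mul] at this⟩

theorem CollisionSpec.wild_add_left {A A' B : H →L[ℂ] H} (hA : IsTrPos A) (hA' : IsTrPos A')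
    (hB : IsTrPos B) : S.wild (A + A') B = S.wild A B + S.wild A' B := by
  rw [CollisionSpec.wild, opTensor_add_left, S.collision_add, partialTrace_add
    (S.isTrPos_collision (hA.opTensor hB)) (S.isTrPos_collision (hA'.opTensor hB))]
  rfl

theorem CollisionSpec.wild_add_right {A B B' : H →L[ℂ] H} (hA : IsTrPos A) (hB : IsTrPos B)
    (hB' : IsTrPos B') : S.wild A (B + B') = S.wild A B + S.wild A B' := by
  rw [CollisionSpec.wild, opTensor_add_right, S.collision_add, partialTrace_add
    (S.isTrPos_collision (hA.opTensor hB)) (S.isTrPos_collision (hA.opTensor hB'))]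
  rfl

theorem CollisionSpec.wild_smul_left (c : ℝ) {A B : H →L[ℂ] H} (hA : IsTrPos A)
    (hB : IsTrPos B) : S.wild (c • A) B = c • S.wild A B := by
  rw [CollisionSpec.wild, opTensor_smul_left, S.collision_smul,
    partialTrace_smul _ (S.isTrPos_collision (hA.opTensor hB))]
  rfl

theorem CollisionSpec.wild_smul_right (c : ℝ) {A B : H →L[ℂ] H} (hA : IsTrPos A)
    (hB : IsTrPos B) : S.wild A (c • B) = c • S.wild A B := by
  rw [CollisionSpec.wild, opTensor_smul_right, S.collision_smul,
    partialTrace_smul _ (S.isTrPos_collision (hA.opTensor hB))]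
  rfl

theorem CollisionSpec.wild_zero_left {B : H →L[ℂ] H} (hB : IsTrPos B) : S.wild 0 B = 0 := by
  have h0 : IsTrPos (0 : H →L[ℂ] H) := ⟨ContinuousLinearMap.isPositive_zero, by simp [tr_zero]⟩
  have := S.wild_smul_left 0 h0 hB
  rwa [zero_smul, zero_smul] at this

theorem CollisionSpec.wild_zero_right {A : H →L[ℂ] H} (hA : IsTrPos A) : S.wild A 0 = 0 := by
  have h0 : IsTrPos (0 : H →L[ℂ] H) := ⟨ContinuousLinearMap.isPositive_zero, by simp [tr_zero]⟩
  have := S.wild_smul_right 0 hA h0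
  rwa [zero_smul, zero_smul] at this

theorem CollisionSpec.wild_sum_left {s : Finset ι} {A : ι → H →L[ℂ] H} {B : H →L[ℂ] H}
    (hA : ∀ i ∈ s, IsTrPos (A i)) (hB : IsTrPos B) :
    S.wild (∑ i ∈ s, A i) B = ∑ i ∈ s, S.wild (A i) B := by
  classical
  induction s using Finset.induction_on with
  | empty => simp only [Finset.sum_empty, S.wild_zero_left hB]
  | insert i s hi ih =>
    have h1 : ∀ j ∈ s, IsTrPos (A j) := fun j hj => hA j (Finset.mem_insert_of_mem hj)
    rw [Finset.sum_insert hi, Finset.sum_insert hi, S.wild_add_left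
      (hA i (Finset.mem_insert_self _ _)) (IsTrPos.sum h1) hB, ih h1]

theorem CollisionSpec.wild_sum_right {s : Finset ι} {A : H →L[ℂ] H} {B : ι → H →L[ℂ] H}
    (hA : IsTrPos A) (hB : ∀ i ∈ s, IsTrPos (B i)) :
    S.wild A (∑ i ∈ s, B i) = ∑ i ∈ s, S.wild A (B i) := by
  classical
  induction s using Finset.induction_on with
  | empty => simp only [Finset.sum_empty, S.wild_zero_right hA]
  | insert i s hi ih =>
    have h1 : ∀ j ∈ s, IsTrPos (B j) := fun j hj => hB j (Finset.mem_insert_of_mem hj)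
    rw [Finset.sum_insert hi, Finset.sum_insert hi, S.wild_add_right hA
      (hB i (Finset.mem_insert_self _ _)) (IsTrPos.sum h1), ih h1]

/-- The Wild convolution in terms of the spectral decompositions of the factors. -/
theorem CollisionSpec.qf_wild {A B : H →L[ℂ] H} (hA : IsTrPos A) (hB : IsTrPos B)
    (α : HilbertBasis ι ℂ H) (a : ι → ℝ) (ha : ∀ i, 0 ≤ a i) (hα : ∀ i, A (α i) = (a i : ℂ) • α i)
    (β : HilbertBasis κ ℂ H) (b : κ → ℝ) (hb : ∀ i, 0 ≤ b i) (hβ : ∀ i, B (β i) = (b i : ℂ) • β i)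
    (x : H) :
    qf (S.wild A B) x = ∫⁻ σ, ∑' p : ι × κ, ENNReal.ofReal (a p.1 * b p.2) *
      marg₁ x ((S.U σ : Two H →L[ℂ] Two H) (prodBasis α β p)) ∂S.ν := by
  have := countable_of_basis (stdBasis H)
  rw [CollisionSpec.wild, qf_partialTrace (S.isTrPos_collision (hA.opTensor hB))]
  simp only [S.qf_collision (hA.opTensor hB).pos]
  rw [← lintegral_tsum fun i => (S.measurable_qf _ _).aemeasurable]
  refine lintegral_congr fun σ => ?_
  have h1 (z : Two H) : qf (opTensor A B) z =
      ∑' p, ENNReal.ofReal (a p.1 * b p.2) * ‖⟪prodBasis α β p, z⟫_ℂ‖ₑ ^ 2 :=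
    qf_eq_tsum (hA.opTensor hB).pos (prodBasis α β) (fun p => a p.1 * b p.2)
      (fun p => mul_nonneg (ha _) (hb _)) (fun p => by
        rw [prodBasis_apply, opTensor_tmul, hα, hβ, tmul_smul_left, tmul_smul_right, smul_smul]
        push_cast
        rfl) z
  simp only [h1]
  rw [ENNReal.tsum_comm]
  refine tsum_congr fun p => ?_
  rw [ENNReal.tsum_mul_left, marg₁_eq (stdBasis H)]
  congr 1
  refine tsum_congr fun j => ?_
  rw [enorm_inner_symm, S.inner_star_U]

theorem marg₁_swap (x : H) (u : Two H) : marg₁ x (swap u) = marg₂ x u := by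
  rw [marg₁_eq (stdBasis H), marg₂_eq (stdBasis H)]
  refine tsum_congr fun j => ?_
  rw [← ContinuousLinearMap.adjoint_inner_left, ← ContinuousLinearMap.star_eq_adjoint, star_swap,
    swap_tmul]

theorem continuous_marg₁ (x : H) : Continuous fun u : Two H => marg₁ x u :=
  (ENNReal.continuous_pow 2).comp (tmulLeft x).adjoint.continuous.enorm

/-- B ⊗ A is A ⊗ B conjugated by the swap, and conjugating the collisions by the swap preserves `ν`.
So the first marginal after a collision of B ⊗ A has the same average as the second marginal after a
collision of A ⊗ B. One collision thus carries both A ⋆ B and B ⋆ A. -/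
theorem CollisionSpec.qf_wild_swap {A B : H →L[ℂ] H} (hA : IsTrPos A) (hB : IsTrPos B)
    (α : HilbertBasis ι ℂ H) (a : ι → ℝ) (ha : ∀ i, 0 ≤ a i) (hα : ∀ i, A (α i) = (a i : ℂ) • α i)
    (β : HilbertBasis κ ℂ H) (b : κ → ℝ) (hb : ∀ i, 0 ≤ b i) (hβ : ∀ i, B (β i) = (b i : ℂ) • β i)
    (x : H) :
    qf (S.wild B A) x = ∫⁻ σ, ∑' p : ι × κ, ENNReal.ofReal (a p.1 * b p.2) *
      marg₂ x ((S.U σ : Two H →L[ℂ] Two H) (prodBasis α β p)) ∂S.ν := by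
  have := countable_of_basis α
  have := countable_of_basis β
  obtain ⟨r, hr, hr'⟩ := S.symmetric
  rw [S.qf_wild hB hA β b hb hβ α a ha hα, ← hr.lintegral_comp]
  · refine lintegral_congr fun σ => ?_
    rw [← (Equiv.prodComm ι κ).tsum_eq]
    refine tsum_congr fun p => ?_
    simp only [Equiv.prodComm_apply, Prod.fst_swap, Prod.snd_swap, hr', star_swap,
      mul_apply_eq_comp, prodBasis_apply, swap_tmul, marg₁_swap]
    rw [mul_comm (b p.2)]
  · exact Measurable.tsum fun p =>
      ((continuous_marg₁ x).comp (S.continuous_U _)).measurable.const_mul _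

end Wild

/-! ### The Wild expansion of solutions and its analyticity. -/

section Expansion

variable {H : Type*} [NormedAddCommGroup H] [InnerProductSpace ℂ H] [CompleteSpace H]
  [TopologicalSpace.SeparableSpace H] {ι κ : Type*}
  {h : H →ₗ.[ℂ] H}
  {C : Type*} [MetricSpace C] [CompactSpace C] [MeasurableSpace C] [BorelSpace C]
  (S : CollisionSpec h C)

/-- The normalized terms of the Wild expansion. -/
def CollisionSpec.wildTerm (ρ : H →L[ℂ] H) : ℕ → H →L[ℂ] H
  | 0 => ρ
  | n + 1 => ((n + 1 : ℝ)⁻¹) • ∑ k : Fin (n + 1),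
      S.wild (CollisionSpec.wildTerm ρ k) (CollisionSpec.wildTerm ρ (n - k))
decreasing_by all_goals omega

theorem CollisionSpec.wildTerm_zero (ρ : H →L[ℂ] H) : S.wildTerm ρ 0 = ρ := by
  rw [CollisionSpec.wildTerm]

theorem CollisionSpec.wildTerm_succ (ρ : H →L[ℂ] H) (n : ℕ) :
    S.wildTerm ρ (n + 1) = ((n + 1 : ℝ)⁻¹) • ∑ k ∈ Finset.range (n + 1),
      S.wild (S.wildTerm ρ k) (S.wildTerm ρ (n - k)) := by
  rw [CollisionSpec.wildTerm,
    ← Fin.sum_univ_eq_sum_range fun k => S.wild (S.wildTerm ρ k) (S.wildTerm ρ (n - k))]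

theorem CollisionSpec.isDensity_wildTerm {ρ : H →L[ℂ] H} (hρ : IsDensity ρ) (n : ℕ) :
    IsDensity (S.wildTerm ρ n) := by
  induction n using Nat.strong_induction_on with
  | _ n ih =>
    cases n with
    | zero => rwa [S.wildTerm_zero]
    | succ n =>
      have h1 : ∀ k ∈ Finset.range (n + 1),
          IsDensity (S.wild (S.wildTerm ρ k) (S.wildTerm ρ (n - k))) := fun k hk =>
        S.isDensity_wild (ih k (Finset.mem_range.mp hk)) (ih _ (by omega))
      have hn : (0 : ℝ) ≤ (n + 1 : ℝ)⁻¹ := by positivity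
      have h2 := isPositive_sum fun k hk => (h1 k hk).1
      rw [S.wildTerm_succ]
      refine ⟨isPositive_smul hn h2, ?_⟩
      have h3 := tr_smul hn h2
      rw [tr_sum fun k hk => (h1 k hk).1, Finset.sum_congr rfl fun k hk => (h1 k hk).2] at h3
      refine h3.trans ?_
      rw [Finset.sum_const, Finset.card_range, nsmul_eq_mul, mul_one,
        ENNReal.ofReal_inv_of_pos (by positivity)]
      have : ENNReal.ofReal ((n : ℝ) + 1) = ((n + 1 : ℕ) : ℝ≥0∞) := by
        rw [← ENNReal.ofReal_natCast]; push_cast; rfl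
      rw [this]
      exact ENNReal.inv_mul_cancel (by simp) (ENNReal.natCast_ne_top _)

/-- The truncated double sum in the Wild expansion is dominated by the full product. -/
theorem sum_convolution_le (n : ℕ) (σ : ℝ) (hσ : 0 ≤ σ) (r : ℕ → ℕ → ℝ) (hr : ∀ k l, 0 ≤ r k l) :
    ∑ m ∈ Finset.range n, σ ^ m * ∑ k ∈ Finset.range (m + 1), r k (m - k) ≤
      ∑ k ∈ Finset.range n, ∑ l ∈ Finset.range n, σ ^ k * (σ ^ l * r k l) := by
  calc _ = ∑ m ∈ Finset.range n, ∑ k ∈ Finset.range (m + 1),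
        σ ^ k * (σ ^ (m - k) * r k (m - k)) := by
        refine Finset.sum_congr rfl fun m _ => ?_
        rw [Finset.mul_sum]
        refine Finset.sum_congr rfl fun k hk => ?_
        have : k ≤ m := by have := Finset.mem_range.mp hk; omega
        rw [← mul_assoc, ← pow_add, Nat.add_sub_cancel' this]
    _ = ∑ m ∈ Finset.range n, ∑ k ∈ Finset.range (n - m), σ ^ m * (σ ^ k * r m k) :=
        Finset.sum_range_diag_flip n fun k l => σ ^ k * (σ ^ l * r k l)
    _ ≤ _ := by
        refine Finset.sum_le_sum fun k _ => Finset.sum_le_sum_of_subset_of_nonneg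
          (Finset.range_mono (Nat.sub_le n k)) fun l _ _ => ?_
        have := hr k l
        positivity

/-- The real quadratic form as a continuous linear functional of the operator. -/
def reForm (x : H) : (H →L[ℂ] H) →L[ℝ] ℝ :=
  Complex.reCLM.comp (((innerSL ℂ x).comp (ContinuousLinearMap.apply ℂ H x)).restrictScalars ℝ)

theorem reForm_apply (x : H) (T : H →L[ℂ] H) : reForm x T = (⟪x, T x⟫_ℂ).re := rfl

theorem qf_eq_reForm (x : H) (T : H →L[ℂ] H) : qf T x = ENNReal.ofReal (reForm x T) := rfl

/-- With σ = 1 - e^(-2v), the function y = e^(2v) ρ(s+v) satisfies dy/dσ = y ⋆ y, while the partial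
sums Y_n of the series satisfy dY_(n+1)/dσ ≤ Y_n ⋆ Y_n, the derivative being a truncation of the
double sum. If y ≥ Y_n, bilinearity and positivity give y ⋆ y ≥ Y_n ⋆ Y_n. Hence y - Y_(n+1), which
vanishes at v = 0, has nondecreasing quadratic forms. -/
theorem CollisionSpec.isPositive_sub_wildTerm {ρ : ℝ → H →L[ℂ] H} (hρ : S.IsSolution ρ) {s : ℝ}
    (hs : 0 ≤ s) (n : ℕ) : ∀ v : ℝ, 0 ≤ v → (Real.exp (2 * v) • ρ (s + v) -
      ∑ k ∈ Finset.range n, (1 - Real.exp (-(2 * v))) ^ k • S.wildTerm (ρ s) k).IsPositive := by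
  set Q := S.wildTerm (ρ s) with hQ
  have hQd (k : ℕ) : IsTrPos (Q k) := (S.isDensity_wildTerm (hρ s hs).1 k).isTrPos
  have hσ (v : ℝ) (hv : 0 ≤ v) : 0 ≤ 1 - Real.exp (-(2 * v)) := by
    rw [sub_nonneg, Real.exp_le_one_iff]; linarith
  have hρd (v : ℝ) (hv : 0 ≤ v) : IsTrPos (ρ (s + v)) := (hρ _ (add_nonneg hs hv)).1.isTrPos
  induction n with
  | zero =>
    intro v hv
    rw [Finset.range_zero, Finset.sum_empty, sub_zero]
    exact isPositive_smul (Real.exp_pos _).le (hρd v hv).pos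
  | succ n ih =>
    have hW (v : ℝ) (hv : 0 ≤ v) (m : ℕ) :
        IsTrPos (∑ k ∈ Finset.range m, (1 - Real.exp (-(2 * v))) ^ k • Q k) :=
      IsTrPos.sum fun k _ => (hQd k).smul (pow_nonneg (hσ v hv) k)
    have hy (v : ℝ) (hv : 0 ≤ v) : IsTrPos (Real.exp (2 * v) • ρ (s + v)) :=
      (hρd v hv).smul (Real.exp_pos _).le
    -- the square of the solution dominates the square of the partial sum
    have hstar (x : H) (v : ℝ) (hv : 0 ≤ v) :
        ∑ m ∈ Finset.range n, (1 - Real.exp (-(2 * v))) ^ m *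
          ∑ k ∈ Finset.range (m + 1), reForm x (S.wild (Q k) (Q (m - k))) ≤
        Real.exp (2 * v) * (Real.exp (2 * v) * reForm x (S.wild (ρ (s + v)) (ρ (s + v)))) := by
      refine (sum_convolution_le n _ (hσ v hv) (fun k l => reForm x (S.wild (Q k) (Q l)))
        fun k l => re_inner_nonneg (S.isTrPos_wild (hQd k) (hQd l)).pos x).trans ?_
      set Y := ∑ k ∈ Finset.range n, (1 - Real.exp (-(2 * v))) ^ k • Q k with hY
      set Z := Real.exp (2 * v) • ρ (s + v) - Y with hZ
      have hYt : IsTrPos Y := hW v hv n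
      have hYZ : Real.exp (2 * v) • ρ (s + v) = Y + Z := by rw [hZ]; abel
      -- The remainder is dominated by the solution, so it is trace class and the bilinearity of the
      -- convolution applies to it.
      have hZt : IsTrPos Z := by
        refine ⟨ih v hv, fun htop => (hy v hv).2 ?_⟩
        rw [hYZ, tr_add hYt.pos (ih v hv), htop, add_top]
      have h1 : reForm x (S.wild Y Y) = ∑ k ∈ Finset.range n, ∑ l ∈ Finset.range n,
          (1 - Real.exp (-(2 * v))) ^ k * ((1 - Real.exp (-(2 * v))) ^ l *
            reForm x (S.wild (Q k) (Q l))) := by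
        have hk (k : ℕ) := (hQd k).smul (pow_nonneg (hσ v hv) k)
        conv_lhs => rw [hY, S.wild_sum_left (fun k _ => hk k) hYt, map_sum]
        refine Finset.sum_congr rfl fun k _ => ?_
        rw [hY, S.wild_sum_right (hk k) (fun k _ => hk k), map_sum]
        refine Finset.sum_congr rfl fun l _ => ?_
        rw [S.wild_smul_left _ (hQd k) (hk l), S.wild_smul_right _ (hQd k) (hQd l), map_smul,
          map_smul, smul_eq_mul, smul_eq_mul]
      have h2 : Real.exp (2 * v) * (Real.exp (2 * v) * reForm x (S.wild (ρ (s + v)) (ρ (s + v)))) =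
          reForm x (S.wild Y Y) + reForm x (S.wild Y Z) + reForm x (S.wild Z Y) +
            reForm x (S.wild Z Z) := by
        have h3 : reForm x (S.wild (Real.exp (2 * v) • ρ (s + v)) (Real.exp (2 * v) • ρ (s + v))) =
            Real.exp (2 * v) * (Real.exp (2 * v) * reForm x (S.wild (ρ (s + v)) (ρ (s + v)))) := by
          rw [S.wild_smul_left _ (hρd v hv) (hy v hv), S.wild_smul_right _ (hρd v hv) (hρd v hv),
            map_smul, map_smul, smul_eq_mul, smul_eq_mul]
        rw [← h3, hYZ, S.wild_add_left hYt hZt (hYt.add hZt), S.wild_add_right hYt hYt hZt,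
          S.wild_add_right hZt hYt hZt]
        simp only [map_add]
        ring
      have h4 := re_inner_nonneg (S.isTrPos_wild hYt hZt).pos x
      have h5 := re_inner_nonneg (S.isTrPos_wild hZt hYt).pos x
      have h6 := re_inner_nonneg (S.isTrPos_wild hZt hZt).pos x
      rw [← reForm_apply] at h4 h5 h6
      rw [h2, ← h1]
      linarith
    -- the difference of the quadratic forms is monotone in time
    have hmain (x : H) (v : ℝ) (hv : 0 ≤ v) :
        ∑ k ∈ Finset.range (n + 1), (1 - Real.exp (-(2 * v))) ^ k * reForm x (Q k) ≤
          Real.exp (2 * v) * reForm x (ρ (s + v)) := by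
      let g : ℝ → ℝ := fun v => Real.exp (2 * v) * reForm x (ρ (s + v)) -
        ∑ k ∈ Finset.range (n + 1), (1 - Real.exp (-(2 * v))) ^ k * reForm x (Q k)
      have hderiv (v : ℝ) (hv : 0 ≤ v) : HasDerivWithinAt g
          (2 * Real.exp (2 * v) * reForm x (S.wild (ρ (s + v)) (ρ (s + v))) -
            2 * Real.exp (-(2 * v)) * ∑ m ∈ Finset.range n, (1 - Real.exp (-(2 * v))) ^ m *
              ∑ k ∈ Finset.range (m + 1), reForm x (S.wild (Q k) (Q (m - k)))) (Set.Ici 0) v := by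
        have e1 : HasDerivAt (fun v : ℝ => Real.exp (2 * v)) (Real.exp (2 * v) * 2) v :=
          (by simpa using (hasDerivAt_id v).const_mul (2 : ℝ) :
            HasDerivAt (fun v : ℝ => 2 * v) 2 v).exp
        have e2 : HasDerivAt (fun v : ℝ => 1 - Real.exp (-(2 * v)))
            (2 * Real.exp (-(2 * v))) v := by
          refine HasDerivAt.congr_deriv
            (((hasDerivAt_id v).const_mul (2 : ℝ)).fun_neg.exp.const_sub 1) ?_
          simp only [id, mul_one]
          ring
        have e3 : HasDerivWithinAt (fun v => ρ (s + v))
            ((2 : ℝ) • (S.wild (ρ (s + v)) (ρ (s + v)) - ρ (s + v))) (Set.Ici 0) v := by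
          have h1 := (hρ (s + v) (add_nonneg hs hv)).2
          have h2 : HasDerivWithinAt (fun v : ℝ => s + v) 1 (Set.Ici 0) v :=
            ((hasDerivAt_id v).const_add s).hasDerivWithinAt
          have := h1.scomp v h2 (fun w hw => add_nonneg hs hw)
          rwa [one_smul] at this
        have e4 := (reForm x).hasFDerivAt.comp_hasDerivWithinAt v e3
        have e5 := e1.hasDerivWithinAt.mul e4
        have e6 : HasDerivAt (fun v : ℝ =>
            ∑ k ∈ Finset.range (n + 1), (1 - Real.exp (-(2 * v))) ^ k * reForm x (Q k))
            (∑ k ∈ Finset.range (n + 1), ((k : ℝ) * (1 - Real.exp (-(2 * v))) ^ (k - 1) *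
              (2 * Real.exp (-(2 * v)))) * reForm x (Q k)) v :=
          HasDerivAt.fun_sum fun k _ => (e2.pow k).mul_const _
        have e7 := e5.sub e6.hasDerivWithinAt
        refine HasDerivWithinAt.congr_deriv (f := g) e7 ?_
        -- The term k = 0 is constant in time. After the shift of the index, the factor k + 1
        -- cancels the normalization in the recursion for `wildTerm`.
        rw [Finset.sum_range_succ' (n := n)]
        have e8 (m : ℕ) : ∑ k ∈ Finset.range (m + 1), reForm x (S.wild (Q k) (Q (m - k))) =
            (m + 1 : ℝ) * reForm x (Q (m + 1)) := by
          rw [hQ, S.wildTerm_succ, map_smul, map_sum, smul_eq_mul,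
            mul_inv_cancel_left₀ (by positivity)]
        simp only [e8, map_smul, map_sub, smul_eq_mul, Nat.cast_zero, zero_mul, add_zero,
          Nat.add_sub_cancel, Finset.mul_sum, Nat.cast_add, Nat.cast_one, Function.comp_apply]
        have e9 : ∑ m ∈ Finset.range n, 2 * Real.exp (-(2 * v)) *
            ((1 - Real.exp (-(2 * v))) ^ m * ((m + 1 : ℝ) * reForm x (Q (m + 1)))) =
            ∑ m ∈ Finset.range n, ((m : ℝ) + 1) * (1 - Real.exp (-(2 * v))) ^ m *
              (2 * Real.exp (-(2 * v))) * reForm x (Q (m + 1)) :=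
          Finset.sum_congr rfl fun m _ => by ring
        rw [e9]
        ring
      have hmono : MonotoneOn g (Set.Ici 0) := by
        refine monotoneOn_of_deriv_nonneg (convex_Ici 0)
          (fun v hv => (hderiv v hv).continuousWithinAt) (fun v hv => ?_) fun v hv => ?_
        · rw [interior_Ici] at hv
          exact ((hderiv v (le_of_lt hv)).hasDerivAt (Ici_mem_nhds hv)).differentiableAt
            |>.differentiableWithinAt
        · rw [interior_Ici] at hv
          rw [((hderiv v (le_of_lt hv)).hasDerivAt (Ici_mem_nhds hv)).deriv]
          have h1 := hstar x v (le_of_lt hv)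
          have h2 : Real.exp (-(2 * v)) * Real.exp (2 * v) = 1 := by
            rw [← Real.exp_add, neg_add_cancel, Real.exp_zero]
          have h3 := mul_le_mul_of_nonneg_left h1 (by positivity : 0 ≤ 2 * Real.exp (-(2 * v)))
          have h4 : 2 * Real.exp (-(2 * v)) * (Real.exp (2 * v) * (Real.exp (2 * v) *
              reForm x (S.wild (ρ (s + v)) (ρ (s + v))))) =
              2 * Real.exp (2 * v) * reForm x (S.wild (ρ (s + v)) (ρ (s + v))) := by
            linear_combination (2 * Real.exp (2 * v) *
              reForm x (S.wild (ρ (s + v)) (ρ (s + v)))) * h2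
          linarith
      have h0 : g 0 = 0 := by
        simp only [g, mul_zero, neg_zero, Real.exp_zero, sub_self, add_zero, one_mul]
        rw [Finset.sum_range_succ' (n := n)]
        simp [hQ, S.wildTerm_zero]
      have := hmono Set.self_mem_Ici hv hv
      rw [h0] at this
      exact sub_nonneg.mp this
    intro v hv
    refine isPositive_of_inner (fun x y => ?_) fun x => ?_
    · rw [sub_apply, sub_apply, inner_sub_left, inner_sub_right, inner_self_symm (hy v hv).pos,
        inner_self_symm (hW v hv (n + 1)).pos]
    · rw [← reForm_apply, map_sub, map_smul, map_sum, sub_nonneg, smul_eq_mul]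
      simp only [map_smul, smul_eq_mul]
      exact hmain x v hv

/-- The Wild expansion of a solution. -/
theorem CollisionSpec.hasSum_wildTerm {ρ : ℝ → H →L[ℂ] H} (hρ : S.IsSolution ρ) {s : ℝ}
    (hs : 0 ≤ s) {v : ℝ} (hv : 0 ≤ v) :
    HasSum (fun n => (Real.exp (-(2 * v)) * (1 - Real.exp (-(2 * v))) ^ n) • S.wildTerm (ρ s) n)
      (ρ (s + v)) := by
  set σ := 1 - Real.exp (-(2 * v)) with hσd
  set Q := S.wildTerm (ρ s) with hQ
  have hQd (k : ℕ) : IsDensity (Q k) := S.isDensity_wildTerm (hρ s hs).1 k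
  have hσ : 0 ≤ σ := by rw [hσd, sub_nonneg, Real.exp_le_one_iff]; linarith
  have hσ1 : σ < 1 := by rw [hσd]; linarith [Real.exp_pos (-(2 * v))]
  have hexp : Real.exp (-(2 * v)) = 1 - σ := by rw [hσd]; ring
  rw [hexp]
  have hp (n : ℕ) : 0 ≤ (1 - σ) * σ ^ n := mul_nonneg (by linarith) (pow_nonneg hσ n)
  have hdiff (n : ℕ) :
      (ρ (s + v) - ∑ k ∈ Finset.range n, ((1 - σ) * σ ^ k) • Q k).IsPositive := by
    have h1 := isPositive_smul (Real.exp_pos (-(2 * v))).le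
      (S.isPositive_sub_wildTerm hρ hs n v hv)
    rw [← hσd, smul_sub, smul_smul, ← Real.exp_add, neg_add_cancel, Real.exp_zero, one_smul,
      Finset.smul_sum, hexp] at h1
    simpa only [smul_smul] using h1
  have hgeom (n : ℕ) : ∑ k ∈ Finset.range n, (1 - σ) * σ ^ k = 1 - σ ^ n := by
    rw [← Finset.mul_sum, mul_neg_geom_sum]
  -- The remainder is positive and its trace is 1 - (1 - σ^n) = σ^n, which bounds its norm. No a
  -- priori uniqueness of solutions is needed.
  have hnorm (n : ℕ) :
      ‖ρ (s + v) - ∑ k ∈ Finset.range n, ((1 - σ) * σ ^ k) • Q k‖ ≤ σ ^ n := by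
    refine norm_le_trace (hdiff n) (pow_nonneg hσ n) (le_of_eq ?_)
    have h1 := tr_add (isPositive_sum (s := Finset.range n) fun k _ =>
      isPositive_smul (hp k) (hQd k).1) (hdiff n)
    rw [add_sub_cancel, tr, (hρ _ (add_nonneg hs hv)).1.2, tr_sum fun k _ =>
      isPositive_smul (hp k) (hQd k).1] at h1
    have h2 (k : ℕ) : tr (((1 - σ) * σ ^ k) • Q k) = ENNReal.ofReal ((1 - σ) * σ ^ k) := by
      rw [tr_smul (hp k) (hQd k).1, tr, (hQd k).2, mul_one]
    simp only [h2] at h1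
    rw [← ENNReal.ofReal_sum_of_nonneg fun k _ => hp k, hgeom] at h1
    have h3 : ENNReal.ofReal (1 - σ ^ n) + ENNReal.ofReal (σ ^ n) = 1 := by
      rw [← ENNReal.ofReal_add (sub_nonneg.mpr (pow_le_one₀ hσ hσ1.le)) (pow_nonneg hσ n),
        sub_add_cancel, ENNReal.ofReal_one]
    exact (ENNReal.add_right_inj ENNReal.ofReal_ne_top).mp (h1.symm.trans h3.symm)
  have hsum : Summable fun n => ((1 - σ) * σ ^ n) • Q n := by
    refine Summable.of_norm_bounded
      ((summable_geometric_of_lt_one hσ hσ1).mul_left (1 - σ)) fun n => ?_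
    rw [norm_smul, Real.norm_of_nonneg (hp n)]
    refine mul_le_of_le_one_right (hp n) (norm_le_trace (hQd n).1 zero_le_one ?_)
    rw [(hQd n).2, ENNReal.ofReal_one]
  have hlim : Filter.Tendsto (fun n => ∑ k ∈ Finset.range n, ((1 - σ) * σ ^ k) • Q k)
      Filter.atTop (nhds (ρ (s + v))) := by
    rw [tendsto_iff_norm_sub_tendsto_zero]
    refine squeeze_zero (fun _ => norm_nonneg _) (fun n => ?_)
      (tendsto_pow_atTop_nhds_zero_of_lt_one hσ hσ1)
    rw [norm_sub_rev]
    exact hnorm n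
  rw [← tendsto_nhds_unique hsum.hasSum.tendsto_sum_nat hlim]
  exact hsum.hasSum

theorem CollisionSpec.wildTerm_eq_self {ρ : H →L[ℂ] H} (hρ : S.wild ρ ρ = ρ) (n : ℕ) :
    S.wildTerm ρ n = ρ := by
  induction n using Nat.strong_induction_on with
  | _ n ih =>
    cases n with
    | zero => rw [S.wildTerm_zero]
    | succ n =>
      rw [S.wildTerm_succ, Finset.sum_congr rfl fun k hk => by
        rw [ih k (Finset.mem_range.mp hk), ih (n - k) (by omega), hρ]]
      rw [Finset.sum_const, Finset.card_range, ← Nat.cast_smul_eq_nsmul ℝ, smul_smul]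
      push_cast
      rw [inv_mul_cancel₀ (by positivity), one_smul]

/-- A power series with bounded coefficients that vanishes near `1` on the left vanishes on
`[0,1)`. -/
theorem tsum_pow_eq_zero {d : ℕ → ℝ} {M : ℝ} (hd : ∀ n, |d n| ≤ M) {a : ℝ} (ha : 0 ≤ a)
    (ha1 : a < 1) (hz : ∀ x, a ≤ x → x < 1 → ∑' n, d n * x ^ n = 0) {x : ℝ} (hx : 0 ≤ x)
    (hx1 : x < 1) : ∑' n, d n * x ^ n = 0 := by
  let p := FormalMultilinearSeries.ofScalars ℝ d
  have hr : ((1 : NNReal) : ℝ≥0∞) ≤ p.radius := p.le_radius_of_bound M fun n => by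
    rw [FormalMultilinearSeries.ofScalars_norm]
    simpa using hd n
  have hps (x : ℝ) : p.sum x = ∑' n, d n * x ^ n := by
    have := FormalMultilinearSeries.ofScalars_sum_eq (𝕜 := ℝ) (E := ℝ) d x
    simp only [smul_eq_mul] at this
    exact this
  have hball : AnalyticOnNhd ℝ p.sum (Metric.ball 0 1) := by
    refine (p.hasFPowerSeriesOnBall (lt_of_lt_of_le (by simp) hr)).analyticOnNhd.mono ?_
    rw [show (1 : ℝ) = ((1 : NNReal) : ℝ) from rfl, ← Metric.eball_coe]
    exact Metric.eball_subset_eball hr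
  -- At the midpoint of [a, 1] the sum vanishes in a whole neighbourhood, so the identity theorem
  -- applies on the unit ball.
  have hmid : (a + 1) / 2 ∈ Metric.ball (0 : ℝ) 1 := by
    rw [mem_ball_zero_iff, Real.norm_of_nonneg (by linarith)]
    linarith
  have hev : p.sum =ᶠ[nhds ((a + 1) / 2)] 0 := by
    filter_upwards [Ioo_mem_nhds (by linarith : a < (a + 1) / 2) (by linarith : (a + 1) / 2 < 1)]
      with y hy
    rw [hps, hz y hy.1.le hy.2, Pi.zero_apply]
  have := hball.eqOn_zero_of_preconnected_of_eventuallyEq_zero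
    (convex_ball (0 : ℝ) 1).isPreconnected hmid hev
    (by rwa [mem_ball_zero_iff, Real.norm_of_nonneg hx] : x ∈ Metric.ball (0 : ℝ) 1)
  rwa [hps] at this

/-- Solutions that reach a fixed point of the Wild convolution are constant. -/
theorem CollisionSpec.eq_of_wild_eq {ρ : ℝ → H →L[ℂ] H} (hρ : S.IsSolution ρ) {s : ℝ}
    (hs : 0 ≤ s) (hw : S.wild (ρ s) (ρ s) = ρ s) : ∀ t, 0 ≤ t → ρ t = ρ s := by
  -- Forward in time: at a fixed point all Wild terms coincide and the geometric weights add up to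
  -- one.
  have hlate (v : ℝ) (hv : 0 ≤ v) : ρ (s + v) = ρ s := by
    have h1 := S.hasSum_wildTerm hρ hs hv
    simp only [S.wildTerm_eq_self hw] at h1
    have hlt : 1 - Real.exp (-(2 * v)) < 1 := by linarith [Real.exp_pos (-(2 * v))]
    have hge : 0 ≤ 1 - Real.exp (-(2 * v)) := by
      rw [sub_nonneg, Real.exp_le_one_iff]; linarith
    have h2 := ((hasSum_geometric_of_lt_one hge hlt).mul_left (Real.exp (-(2 * v)))).smul_const
      (ρ s)
    rw [sub_sub_cancel, mul_inv_cancel₀ (Real.exp_ne_zero _), one_smul] at h2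
    exact h1.unique h2
  set Q := S.wildTerm (ρ 0)
  have hQ (n : ℕ) : IsDensity (Q n) := S.isDensity_wildTerm (hρ 0 le_rfl).1 n
  have hform (x : H) (T : H →L[ℂ] H) (hT : IsDensity T) : |reForm x T| ≤ ‖x‖ ^ 2 := by
    have h1 := qf_le_trace hT.1 x
    rw [hT.2, one_mul, ← ofReal_norm_sq, qf_eq_reForm,
      ENNReal.ofReal_le_ofReal_iff (sq_nonneg _)] at h1
    rwa [abs_of_nonneg (show 0 ≤ reForm x T from re_inner_nonneg hT.1 x)]
  have hσ (v : ℝ) (hv : 0 ≤ v) : 0 ≤ 1 - Real.exp (-(2 * v)) ∧ 1 - Real.exp (-(2 * v)) < 1 :=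
    ⟨by rw [sub_nonneg, Real.exp_le_one_iff]; linarith, by linarith [Real.exp_pos (-(2 * v))]⟩
  -- the power series of the difference to the late state
  have hser (x : H) (v : ℝ) (hv : 0 ≤ v) :
      HasSum (fun n => (reForm x (Q n) - reForm x (ρ s)) * (1 - Real.exp (-(2 * v))) ^ n)
        (Real.exp (2 * v) * (reForm x (ρ v) - reForm x (ρ s))) := by
    have h1 := (S.hasSum_wildTerm hρ le_rfl hv).mapL (reForm x)
    rw [zero_add] at h1
    have h2 := (hasSum_geometric_of_lt_one (hσ v hv).1 (hσ v hv).2).mul_right (reForm x (ρ s))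
    have h3 := h1.mul_left (Real.exp (2 * v))
    have he : Real.exp (2 * v) * Real.exp (-(2 * v)) = 1 := by
      rw [← Real.exp_add, add_neg_cancel, Real.exp_zero]
    convert h3.sub h2 using 1
    · rfl
    · funext n
      rw [map_smul, smul_eq_mul]
      linear_combination (-(1 - Real.exp (-(2 * v))) ^ n * reForm x (Q n)) * he
    · rw [sub_sub_cancel, ← Real.exp_neg, neg_neg]
      ring
  intro t ht
  refine eq_of_qf (hρ t ht).1.1 (hρ s hs).1.1 fun x => ?_
  -- Backward in time: the series started at time 0 vanishes for v ≥ s, that is for y = 1 - e^(-2v)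
  -- close to 1, hence on all of [0,1). The time that belongs to y is v = -log(1 - y)/2.
  have hz := tsum_pow_eq_zero (d := fun n => reForm x (Q n) - reForm x (ρ s))
    (M := ‖x‖ ^ 2 + ‖x‖ ^ 2)
    (fun n => (abs_sub _ _).trans (add_le_add (hform x _ (hQ n)) (hform x _ (hρ s hs).1)))
    (hσ s hs).1 (hσ s hs).2 (fun y hy hy1 => by
      have hv0 : 0 ≤ -Real.log (1 - y) / 2 := by
        have := Real.log_nonpos (by linarith : 0 ≤ 1 - y) (by linarith [(hσ s hs).1])
        linarith
      have hexp : Real.exp (-(2 * (-Real.log (1 - y) / 2))) = 1 - y := by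
        rw [show -(2 * (-Real.log (1 - y) / 2)) = Real.log (1 - y) by ring,
          Real.exp_log (by linarith)]
      have hsv : s ≤ -Real.log (1 - y) / 2 := by
        have h1 : Real.exp (-(2 * (-Real.log (1 - y) / 2))) ≤ Real.exp (-(2 * s)) := by
          rw [hexp]; linarith
        have := Real.exp_le_exp.mp h1
        linarith
      have h1 := hser x _ hv0
      have h2 := hlate (-Real.log (1 - y) / 2 - s) (by linarith)
      rw [add_sub_cancel] at h2
      rw [h2, sub_self, mul_zero, hexp, sub_sub_cancel] at h1
      exact h1.tsum_eq)
    (hσ t ht).1 (hσ t ht).2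
  rw [(hser x t ht).tsum_eq] at hz
  have h3 := (mul_eq_zero.mp hz).resolve_left (Real.exp_ne_zero _)
  rw [qf_eq_reForm, qf_eq_reForm, sub_eq_zero.mp h3]

end Expansion

/-! ### Scalar entropy identities in [0,∞]. -/

section Scalar

/-- `-log s` in `[0,∞]`, for `0 ≤ s ≤ 1`. -/
def nl (s : ℝ) : ℝ≥0∞ := if s = 0 then ⊤ else ENNReal.ofReal (-Real.log s)

/-- The summand `a log a - a log s + s - a` of the relative entropy. -/
def kl (a s : ℝ) : ℝ≥0∞ := if s = 0 then ⊤ * ENNReal.ofReal a else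
  ENNReal.ofReal (a * Real.log a - a * Real.log s + s - a)

theorem nl_mul {s t : ℝ} (hs : 0 ≤ s) (hs1 : s ≤ 1) (ht : 0 ≤ t) (ht1 : t ≤ 1) :
    nl (s * t) = nl s + nl t := by
  unfold nl
  by_cases h0 : s = 0
  · simp [h0]
  by_cases h1 : t = 0
  · simp [h1]
  rw [if_neg (mul_ne_zero h0 h1), if_neg h0, if_neg h1, Real.log_mul h0 h1, neg_add,
    ENNReal.ofReal_add (neg_nonneg.mpr (Real.log_nonpos hs hs1))
      (neg_nonneg.mpr (Real.log_nonpos ht ht1))]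

theorem ofReal_mul_nl {a : ℝ} (ha : 0 ≤ a) :
    ENNReal.ofReal a * nl a = ENNReal.ofReal (Real.negMulLog a) := by
  unfold nl
  split_ifs with h
  · simp [h]
  · rw [← ENNReal.ofReal_mul ha, Real.negMulLog]
    congr 1
    ring

/-- Apply log x ≤ x - 1 to x = √s/√a and multiply by 2a. -/
theorem sub_sqrt_sq_le {a s : ℝ} (ha : 0 ≤ a) (hs : 0 < s) :
    (Real.sqrt a - Real.sqrt s) ^ 2 ≤ a * Real.log a - a * Real.log s + s - a := by
  rcases ha.eq_or_lt with rfl | ha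
  · simp [Real.sq_sqrt hs.le]
  set x := Real.sqrt a with hx
  set y := Real.sqrt s with hy
  have hxp : 0 < x := Real.sqrt_pos.mpr ha
  have hyp : 0 < y := Real.sqrt_pos.mpr hs
  have hax : a = x ^ 2 := (Real.sq_sqrt ha.le).symm
  have hsy : s = y ^ 2 := (Real.sq_sqrt hs.le).symm
  have h1 := Real.log_le_sub_one_of_pos (div_pos hyp hxp)
  rw [Real.log_div hyp.ne' hxp.ne'] at h1
  have h2 := mul_le_mul_of_nonneg_left h1 (by positivity : 0 ≤ 2 * x ^ 2)
  have h3 : 2 * x ^ 2 * (y / x - 1) = 2 * x * y - 2 * x ^ 2 := by field_simp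
  rw [hax, hsy, Real.log_pow, Real.log_pow]
  push_cast
  nlinarith

theorem kl_arg_nonneg {a s : ℝ} (ha : 0 ≤ a) (hs : 0 < s) :
    0 ≤ a * Real.log a - a * Real.log s + s - a :=
  (sq_nonneg _).trans (sub_sqrt_sq_le ha hs)

/-- Combine `sub_sqrt_sq_le` with (a - s)² = (√a - √s)² (√a + √s)² and √a + √s ≤ 2. This quadratic
bound is the source of the strict decrease. -/
theorem le_kl {a s : ℝ} (ha : 0 ≤ a) (ha1 : a ≤ 1) (hs : 0 ≤ s) (hs1 : s ≤ 1) :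
    ENNReal.ofReal ((a - s) ^ 2 / 4) ≤ kl a s := by
  unfold kl
  split_ifs with h
  · rcases ha.eq_or_lt with rfl | ha
    · simp [h]
    · rw [ENNReal.top_mul (by simpa using ha)]
      exact le_top
  · refine ENNReal.ofReal_le_ofReal (le_trans ?_ (sub_sqrt_sq_le ha (hs.lt_of_ne' h)))
    have h1 := Real.sq_sqrt ha
    have h2 := Real.sq_sqrt hs
    have h3 := Real.sqrt_le_one.mpr ha1
    have h4 := Real.sqrt_le_one.mpr hs1
    have h5 := Real.sqrt_nonneg a
    have h6 := Real.sqrt_nonneg s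
    have h7 : (a - s) ^ 2 = (Real.sqrt a - Real.sqrt s) ^ 2 * (Real.sqrt a + Real.sqrt s) ^ 2 := by
      rw [← mul_pow, mul_comm, ← sq_sub_sq, h1, h2]
    rw [h7]
    have h8 : (Real.sqrt a + Real.sqrt s) ^ 2 ≤ 4 := by nlinarith
    nlinarith [mul_le_mul_of_nonneg_left h8 (sq_nonneg (Real.sqrt a - Real.sqrt s))]

/-- The definition of `kl` rearranged so that all terms are nonnegative; it survives s = 0, where
both sides may be infinite. The bracket on the left is finite and can be cancelled later. -/
theorem kl_add {a s : ℝ} (ha : 0 ≤ a) (ha1 : a ≤ 1) (hs : 0 ≤ s) (hs1 : s ≤ 1) :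
    kl a s + (ENNReal.ofReal a + ENNReal.ofReal (Real.negMulLog a)) =
      ENNReal.ofReal a * nl s + ENNReal.ofReal s := by
  unfold kl nl
  split_ifs with h
  · rcases ha.eq_or_lt with rfl | ha
    · simp [h]
    · rw [ENNReal.top_mul (by simpa using ha), ENNReal.mul_top (by simpa using ha)]
      simp
  · have h1 := Real.negMulLog_nonneg ha ha1
    have h2 := mul_nonneg ha (neg_nonneg.mpr (Real.log_nonpos hs hs1))
    rw [← ENNReal.ofReal_mul ha, ← ENNReal.ofReal_add ha h1, ← ENNReal.ofReal_add h2 hs,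
      ← ENNReal.ofReal_add (kl_arg_nonneg ha (hs.lt_of_ne' h)) (add_nonneg ha h1), Real.negMulLog]
    congr 1
    ring

/-- The logarithm of a product gives b·kl(a,s) + a·kl(b,t); the mass terms left over are (s - a)(t -
b), whose positive and negative parts are put on opposite sides. -/
theorem kl_mul {a b s t : ℝ} (ha : 0 ≤ a) (hb : 0 ≤ b) (hs : 0 ≤ s) (ht : 0 ≤ t) :
    kl (a * b) (s * t) + (ENNReal.ofReal b * ENNReal.ofReal s +
        ENNReal.ofReal a * ENNReal.ofReal t) =
      ENNReal.ofReal b * kl a s + ENNReal.ofReal a * kl b t +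
        (ENNReal.ofReal s * ENNReal.ofReal t + ENNReal.ofReal a * ENNReal.ofReal b) := by
  rcases ha.eq_or_lt with rfl | ha
  · by_cases h0 : s = 0
    · simp [kl, h0]
    by_cases h1 : t = 0
    · simp [kl, h0, h1]
    · simp only [kl, h0, h1, mul_eq_zero, or_self, if_false, zero_mul, sub_zero, zero_add,
        ENNReal.ofReal_zero, add_zero, ENNReal.ofReal_mul hs]
      ring
  rcases hb.eq_or_lt with rfl | hb
  · by_cases h0 : s = 0
    · by_cases h1 : t = 0 <;> simp [kl, h0, h1]
    by_cases h1 : t = 0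
    · simp [kl, h0, h1]
    · simp only [kl, h0, h1, mul_eq_zero, or_self, if_false, zero_mul, mul_zero, sub_zero, zero_add,
        ENNReal.ofReal_zero, add_zero, ENNReal.ofReal_mul hs]
      ring
  have ha' : ENNReal.ofReal a ≠ 0 := by simpa using ha
  have hb' : ENNReal.ofReal b ≠ 0 := by simpa using hb
  have hab' : ENNReal.ofReal (a * b) ≠ 0 := by simpa using mul_pos ha hb
  by_cases h0 : s = 0
  · simp [kl, h0, ENNReal.top_mul, ENNReal.mul_top, ha', hb', hab', -ENNReal.ofReal_eq_zero]
  by_cases h1 : t = 0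
  · simp [kl, h1, ENNReal.top_mul, ENNReal.mul_top, ha', hb', hab', -ENNReal.ofReal_eq_zero]
  have hs := hs.lt_of_ne' h0
  have ht := ht.lt_of_ne' h1
  have e1 := kl_arg_nonneg ha.le hs
  have e2 := kl_arg_nonneg hb.le ht
  have e3 := kl_arg_nonneg (mul_pos ha hb).le (mul_pos hs ht)
  simp only [kl, h0, h1, mul_eq_zero, or_self, if_false]
  rw [← ENNReal.ofReal_mul hb.le, ← ENNReal.ofReal_mul ha.le, ← ENNReal.ofReal_mul hb.le,
    ← ENNReal.ofReal_mul ha.le, ← ENNReal.ofReal_mul hs.le, ← ENNReal.ofReal_mul ha.le,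
    ← ENNReal.ofReal_add (by positivity) (by positivity),
    ← ENNReal.ofReal_add e3 (by positivity),
    ← ENNReal.ofReal_add (mul_nonneg hb.le e1) (mul_nonneg ha.le e2),
    ← ENNReal.ofReal_add (by positivity) (by positivity),
    ← ENNReal.ofReal_add (add_nonneg (mul_nonneg hb.le e1) (mul_nonneg ha.le e2)) (by positivity),
    Real.log_mul ha.ne' hb.ne', Real.log_mul h0 h1]
  congr 1
  ring

end Scalar

/-! ### Relative entropy in an eigenbasis, and its behaviour under compression. -/

section Entropy

variable {K : Type*} [NormedAddCommGroup K] [InnerProductSpace ℂ K] [CompleteSpace K] {ι κ : Type*}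

theorem IsDensity.eigenvalue_mem {T : K →L[ℂ] K} (hT : IsDensity T) {x : K} (hx : ‖x‖ = 1) {a : ℝ}
    (h : T x = (a : ℂ) • x) : 0 ≤ a ∧ a ≤ 1 := by
  have h1 := re_inner_nonneg hT.1 x
  have h2 := qf_le_trace hT.1 x
  rw [qf_eigenvector h hx, hT.2, one_mul, ← ofReal_norm_sq, hx, one_pow,
    ENNReal.ofReal_le_ofReal_iff zero_le_one] at h2
  rw [h, inner_smul_right, inner_self_eq_norm_sq_to_K, hx] at h1
  exact ⟨by simpa using h1, h2⟩

theorem IsDensity.exists_eigenbasis {K : Type u} [NormedAddCommGroup K] [InnerProductSpace ℂ K]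
    [CompleteSpace K] {T : K →L[ℂ] K} (hT : IsDensity T) :
    ∃ (ι : Type u) (b : HilbertBasis ι ℂ K) (a : ι → ℝ), ∀ i, T (b i) = (a i : ℂ) • b i := by
  obtain ⟨ι, b, a, -, h⟩ := exists_eigenbasis_of_trace hT.1 hT.isTrPos.2
  exact ⟨ι, b, a, h⟩

/-- The function whose trace is the relative entropy. -/
def klFun (s x : ℝ) : ℝ := x * Real.log x - x * Real.log s + s - x

theorem continuous_klFun (s : ℝ) : Continuous (klFun s) := by
  unfold klFun
  exact ((Real.continuous_mul_log.sub (continuous_id.mul continuous_const)).add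
    continuous_const).sub continuous_id

/-- The contribution of an eigenvector `x` of the reference state, with eigenvalue `s`, to the
relative entropy. -/
def entTerm (T : K →L[ℂ] K) (x : K) (s : ℝ) : ℝ≥0∞ :=
  if s = 0 then ⊤ * qf T x else qf (cfc (klFun s) T) x

theorem eigB_eq {σ : K →L[ℂ] K} (hσ : σ.IsPositive) (b : HilbertBasis ι ℂ K) (s : ι → ℝ)
    (hb : ∀ p, σ (b p) = (s p : ℂ) • b p) (t : ℝ) :
    eigB σ t = {z | ∀ p, ¬ s p = t → ⟪b p, z⟫_ℂ = 0} := by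
  have h1 (z : K) (p : ι) : ⟪b p, σ z⟫_ℂ = (s p : ℂ) * ⟪b p, z⟫_ℂ := by
    rw [← inner_self_symm hσ, hb, inner_smul_left, Complex.conj_ofReal]
  ext z
  constructor
  · intro hz p hp
    have h2 := h1 z p
    rw [show σ z = (t : ℂ) • z from hz, inner_smul_right, ← sub_eq_zero, ← sub_mul,
      mul_eq_zero] at h2
    refine h2.resolve_left fun h3 => hp ?_
    exact_mod_cast (sub_eq_zero.mp h3).symm
  · intro hz
    have : σ z - (t : ℂ) • z = 0 := eq_zero_of_inner_basis b fun p => by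
      rw [inner_sub_right, h1, inner_smul_right, ← sub_mul]
      by_cases hp : s p = t
      · rw [hp, sub_self, zero_mul]
      · rw [hz p hp, mul_zero]
    exact sub_eq_zero.mp this

theorem cfc_klFun_isPositive {T : K →L[ℂ] K} (hT : T.IsPositive) {s : ℝ} (hs : 0 < s) :
    (cfc (klFun s) T).IsPositive := by
  rw [← ContinuousLinearMap.nonneg_iff_isPositive]
  exact cfc_nonneg fun x hx => kl_arg_nonneg
    (spectrum_nonneg_of_nonneg ((ContinuousLinearMap.nonneg_iff_isPositive T).mpr hT) hx) hs

theorem traceOn_zero_of_trivial {S : Set K} (hS : ∀ z ∈ S, z = 0) (T : K →L[ℂ] K) :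
    traceOn S T = 0 := by
  refine le_antisymm (iSup₂_le fun F hF => le_of_eq ?_) zero_le
  refine Finset.sum_eq_zero fun x hx => ?_
  rw [hS x (hF.1 hx)]
  simp

/-- Each eigenspace of `σ` is the closed span of the basis vectors with that eigenvalue, so the sum
over eigenvalues regroups into a sum over the basis. Negative reals contribute nothing because their
eigenspaces are trivial. -/
theorem relEntropy_eq_tsum {ρ σ : K →L[ℂ] K} (hρ : ρ.IsPositive) (hσ : σ.IsPositive)
    (b : HilbertBasis ι ℂ K) (s : ι → ℝ) (hs : ∀ p, 0 ≤ s p)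
    (hb : ∀ p, σ (b p) = (s p : ℂ) • b p) :
    relEntropy ρ σ = ∑' p, entTerm ρ (b p) (s p) := by
  classical
  have h1 (t : ℝ) : (if t = 0 then ⊤ * traceOn (eigB σ 0) ρ else
      traceOn (eigB σ t) (cfc (fun x : ℝ => x * Real.log x - x * Real.log t + t - x) ρ)) =
      1 * ∑' p, if s p = t then entTerm ρ (b p) (s p) else 0 := by
    rw [one_mul]
    split_ifs with ht
    · rw [ht, eigB_eq hσ b s hb, traceOn_eq hρ b, ← ENNReal.tsum_mul_left]
      refine tsum_congr fun p => ?_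
      split_ifs with hp
      · rw [entTerm, if_pos hp]
      · rw [mul_zero]
    · rcases lt_or_ge t 0 with h0 | h0
      · have hne (p : ι) : ¬ s p = t := fun h => by linarith [hs p]
        rw [traceOn_zero_of_trivial fun z hz => ?_]
        · simp [hne]
        · rw [eigB_eq hσ b s hb] at hz
          exact eq_zero_of_inner_basis b fun p => hz p (hne p)
      · rw [eigB_eq hσ b s hb]
        refine (traceOn_eq (cfc_klFun_isPositive hρ (h0.lt_of_ne' ht)) b _).trans ?_
        refine tsum_congr fun p => ?_
        split_ifs with hp
        · rw [entTerm, if_neg (hp ▸ ht), hp]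
        · rfl
  rw [relEntropy]
  simp only [h1]
  rw [tsum_fiber (fun _ => 1) s fun p => entTerm ρ (b p) (s p)]
  simp only [one_mul]

theorem entTerm_eq_tsum {T : K →L[ℂ] K} (hT : T.IsPositive) (b : HilbertBasis ι ℂ K) (a : ι → ℝ)
    (ha : ∀ i, 0 ≤ a i) (hb : ∀ i, T (b i) = (a i : ℂ) • b i) (x : K) {s : ℝ} (hs : 0 ≤ s) :
    entTerm T x s = ∑' i, kl (a i) s * ‖⟪b i, x⟫_ℂ‖ₑ ^ 2 := by
  unfold entTerm kl
  split_ifs with h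
  · rw [qf_eq_tsum hT b a ha hb, ← ENNReal.tsum_mul_left]
    simp only [mul_assoc]
  · have h1 := inner_cfc_eq_tsum hT.isSelfAdjoint b a hb (continuous_klFun s) x
    have h2 (i : ι) : 0 ≤ klFun s (a i) := kl_arg_nonneg (ha i) (hs.lt_of_ne' h)
    rw [qf, ← h1.tsum_eq, ENNReal.ofReal_tsum_of_nonneg
      (fun i => mul_nonneg (h2 i) (sq_nonneg _)) h1.summable]
    refine tsum_congr fun i => ?_
    rw [ENNReal.ofReal_mul (h2 i), ofReal_norm_sq]
    rfl

theorem norm_compress_le (b : HilbertBasis ι ℂ K) (F : Finset ι) (T : K →L[ℂ] K) :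
    ‖compress b F T‖ ≤ ‖T‖ := by
  have h1 := ContinuousLinearMap.opNorm_comp_le (proj b F) (T ∘L proj b F)
  have h2 := ContinuousLinearMap.opNorm_comp_le T (proj b F)
  have h3 := norm_proj_le b F
  calc _ ≤ ‖proj b F‖ * (‖T‖ * ‖proj b F‖) := h1.trans (by gcongr)
    _ ≤ 1 * (‖T‖ * 1) := by gcongr
    _ = ‖T‖ := by ring

theorem inner_compress [DecidableEq ι] (b : HilbertBasis ι ℂ K) (F : Finset ι) (T : K →L[ℂ] K)
    {p q : ι} (hp : p ∈ F) (hq : q ∈ F) : ⟪b p, compress b F T (b q)⟫_ℂ = ⟪b p, T (b q)⟫_ℂ := by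
  rw [compress, ContinuousLinearMap.comp_apply, ContinuousLinearMap.comp_apply, ← proj_symm,
    proj_basis, proj_basis, if_pos hp, if_pos hq]

theorem qf_compress [DecidableEq ι] (b : HilbertBasis ι ℂ K) (F : Finset ι) (T : K →L[ℂ] K)
    {p : ι} (hp : p ∈ F) : qf (compress b F T) (b p) = qf T (b p) := by
  rw [qf, inner_compress b F T hp hp, qf]

/-- For `s = 0` the value is constant once `p ∈ F`. Otherwise the compressions converge in norm with
spectra in one compact set, and the continuous functional calculus is continuous there. -/
theorem tendsto_entTerm (b : HilbertBasis ι ℂ K) {T : K →L[ℂ] K} (hT : IsTrPos T) (p : ι) (s : ℝ) :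
    Filter.Tendsto (fun F => entTerm (compress b F T) (b p) s) Filter.atTop
      (nhds (entTerm T (b p) s)) := by
  classical
  unfold entTerm
  split_ifs with h
  · refine tendsto_const_nhds.congr' ?_
    filter_upwards [Filter.eventually_ge_atTop {p}] with F hF
    rw [qf_compress b F T (hF (Finset.mem_singleton_self p))]
  · have hsp (X : K →L[ℂ] K) (hX : ‖X‖ ≤ ‖T‖) :
        spectrum ℝ X ⊆ Metric.closedBall 0 (‖T‖ * ‖(1 : K →L[ℂ] K)‖) := by
      intro x hx
      rw [mem_closedBall_zero_iff]
      exact (spectrum.norm_le_norm_mul_of_mem hx).trans (by gcongr)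
    have h1 := Filter.Tendsto.cfc (isCompact_closedBall (0 : ℝ) (‖T‖ * ‖(1 : K →L[ℂ] K)‖)) (klFun s)
      (tendsto_compress b hT.pos hT.tr_ne_top)
      (Filter.Eventually.of_forall fun F => hsp _ (norm_compress_le b F T))
      (Filter.Eventually.of_forall fun F => (compress_isPositive b F hT.pos).isSelfAdjoint)
      (hsp T le_rfl) hT.pos.isSelfAdjoint (continuous_klFun s).continuousOn
    exact ENNReal.tendsto_ofReal (((reForm (b p)).continuous.tendsto _).comp h1)

/-- An orthonormal basis that diagonalizes the compression of a positive operator and agrees with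
the given basis away from finitely many indices. -/
theorem exists_compress_basis (b : HilbertBasis ι ℂ K) (F : Finset ι) {T : K →L[ℂ] K}
    (hT : T.IsPositive) : ∃ (ψ : HilbertBasis ι ℂ K) (m : ι → ℝ), (∀ k ∉ F, ψ k = b k ∧ m k = 0) ∧
      (∀ k ∈ F, proj b F (ψ k) = ψ k) ∧ ∀ k, compress b F T (ψ k) = (m k : ℂ) • ψ k := by
  classical
  -- The eigenvectors of this finite matrix, together with the untouched `b k` for `k ∉ F`, form the
  -- new basis; keeping the index type makes the two bases comparable term by term.
  let M : Matrix F F ℂ := fun p q => ⟪b p, T (b q)⟫_ℂ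
  have hM : M.IsHermitian := by
    ext p q
    rw [Matrix.conjTranspose_apply]
    change (starRingEnd ℂ) ⟪b q, T (b p)⟫_ℂ = ⟪b p, T (b q)⟫_ℂ
    rw [inner_conj_symm, inner_self_symm hT]
  let v := hM.eigenvectorBasis
  let f : ι → K := fun k => if h : k ∈ F then ∑ p : F, (v ⟨k, h⟩) p • b p else b k
  have hf (k : ι) (h : k ∈ F) : f k = ∑ p : F, (v ⟨k, h⟩) p • b p := dif_pos h
  have hf' (k : ι) (h : k ∉ F) : f k = b k := dif_neg h
  have hin (k : ι) (h : k ∈ F) (x : K) : ⟪f k, x⟫_ℂ =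
      ⟪v ⟨k, h⟩, WithLp.toLp 2 fun p : F => ⟪b p, x⟫_ℂ⟫_ℂ := by
    rw [hf k h, sum_inner, PiLp.inner_apply]
    refine Finset.sum_congr rfl fun p _ => ?_
    rw [inner_smul_left, RCLike.inner_apply, mul_comm]
  have hbf (p : F) (k : ι) (h : k ∈ F) : ⟪b p, f k⟫_ℂ = (v ⟨k, h⟩) p := by
    rw [hf k h, inner_sum]
    simp only [inner_smul_right, inner_basis]
    rw [Finset.sum_eq_single p]
    · simp
    · intro q _ hq
      rw [if_neg (fun h => hq (Subtype.ext h.symm)), mul_zero]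
    · simp
  have hbf' (p : ι) (hp : p ∉ F) (k : ι) (h : k ∈ F) : ⟪b p, f k⟫_ℂ = 0 := by
    rw [hf k h, inner_sum]
    refine Finset.sum_eq_zero fun q _ => ?_
    rw [inner_smul_right, inner_basis, if_neg, mul_zero]
    rintro rfl
    exact hp q.2
  have hon : Orthonormal ℂ f := by
    rw [orthonormal_iff_ite]
    intro k l
    by_cases hk : k ∈ F
    · by_cases hl : l ∈ F
      · rw [hin k hk]
        have : (WithLp.toLp 2 fun p : F => ⟪b p, f l⟫_ℂ) = v ⟨l, hl⟩ := by
          ext p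
          exact hbf p l hl
        rw [this, orthonormal_iff_ite.mp v.orthonormal]
        simp
      · rw [hf' l hl, ← inner_conj_symm, hbf' l hl k hk, map_zero, if_neg]
        rintro rfl
        exact hl hk
    · rw [hf' k hk]
      by_cases hl : l ∈ F
      · rw [hbf' k hk l hl, if_neg]
        rintro rfl
        exact hk hl
      · rw [hf' l hl, inner_basis]
  have hcomp : (Submodule.span ℂ (Set.range f))ᗮ = ⊥ := by
    rw [Submodule.eq_bot_iff]
    intro x hx
    have hx' (k : ι) : ⟪f k, x⟫_ℂ = 0 :=
      (Submodule.mem_orthogonal _ _).mp hx _ (Submodule.subset_span ⟨k, rfl⟩)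
    have h0 : (WithLp.toLp 2 fun p : F => ⟪b p, x⟫_ℂ) = 0 := by
      refine (LinearIsometryEquiv.map_eq_zero_iff v.repr).mp ?_
      ext k
      rw [OrthonormalBasis.repr_apply_apply, ← hin k.1 k.2, hx', PiLp.zero_apply]
    refine eq_zero_of_inner_basis b fun p => ?_
    by_cases hp : p ∈ F
    · exact congrArg (fun w : EuclideanSpace ℂ F => w ⟨p, hp⟩) h0
    · rw [← hf' p hp, hx']
  have hproj (k : ι) (hk : k ∈ F) : proj b F (f k) = f k := by
    rw [← sub_eq_zero]
    refine eq_zero_of_inner_basis b fun p => ?_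
    rw [inner_sub_right, inner_proj]
    split_ifs with hp
    · rw [sub_self]
    · rw [hbf' p hp k hk, sub_self]
  refine ⟨HilbertBasis.mkOfOrthogonalEqBot hon hcomp,
    fun k => if h : k ∈ F then hM.eigenvalues ⟨k, h⟩ else 0, fun k hk => ⟨?_, dif_neg hk⟩,
    fun k hk => ?_, fun k => ?_⟩
  · rw [HilbertBasis.coe_mkOfOrthogonalEqBot, hf' k hk]
  · rw [HilbertBasis.coe_mkOfOrthogonalEqBot, hproj k hk]
  · rw [HilbertBasis.coe_mkOfOrthogonalEqBot]
    by_cases hk : k ∈ F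
    · simp only [dif_pos hk]
      rw [compress, ContinuousLinearMap.comp_apply, ContinuousLinearMap.comp_apply,
        hproj k hk, ← sub_eq_zero]
      refine eq_zero_of_inner_basis b fun p => ?_
      rw [inner_sub_right, inner_proj, inner_smul_right]
      split_ifs with hp
      · rw [hbf ⟨p, hp⟩ k hk, hf k hk, map_sum, inner_sum, sub_eq_zero]
        have h1 := congrFun (hM.mulVec_eigenvectorBasis ⟨k, hk⟩) ⟨p, hp⟩
        rw [Pi.smul_apply, Complex.real_smul] at h1
        rw [← h1]
        simp only [Matrix.mulVec, dotProduct, map_smul, inner_smul_right]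
        exact Finset.sum_congr rfl fun q _ => mul_comm _ _
      · rw [hbf' p hp k hk, mul_zero, sub_zero]
    · simp only [dif_neg hk]
      rw [hf' k hk, compress, ContinuousLinearMap.comp_apply,
        ContinuousLinearMap.comp_apply, proj_basis, if_neg hk]
      simp

end Entropy

/-! ### Exchanging finitely many terms of infinite sums, and lower semicontinuity. -/

section Exchange

variable {ι : Type*}

/-- The common part off `F` may have infinite sum; only the terms on `F` are moved across, so
nothing infinite is subtracted. -/
theorem tsum_add_sum_exchange {F : Finset ι} {f g : ι → ℝ≥0∞} (h : ∀ k ∉ F, f k = g k) :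
    ∑' k, f k + ∑ k ∈ F, g k = ∑' k, g k + ∑ k ∈ F, f k := by
  classical
  have h1 (f : ι → ℝ≥0∞) : ∑' k, f k = ∑ k ∈ F, f k + ∑' k, if k ∈ F then 0 else f k := by
    have h2 : ∑ k ∈ F, f k = ∑' k, if k ∈ F then f k else 0 := by
      rw [tsum_eq_sum (s := F) fun k hk => if_neg hk]
      exact Finset.sum_congr rfl fun k hk => (if_pos hk).symm
    rw [h2, ← ENNReal.tsum_add]
    refine tsum_congr fun k => ?_
    split_ifs <;> simp
  have h2 : ∑' k, (if k ∈ F then 0 else f k) = ∑' k, if k ∈ F then 0 else g k :=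
    tsum_congr fun k => by
      split_ifs with hk
      · rfl
      · exact h k hk
  rw [h1 f, h1 g, h2]
  ring

/-- The change of reference. `D` and `Δ` play the role of the entropies for the old and the new
reference, `N` and `N'` of the means of -log, `S` and `S'` of the masses. The means differ only
through the finite parts `n` and `n'`, and only the finite `c` is cancelled. -/
theorem kl_exchange {D Δ X N N' n n' S S' c : ℝ≥0∞} (hc : c ≠ ⊤) (h1 : D + c = X * N + S)
    (h2 : Δ + c = X * N' + S') (h3 : N + n' = N' + n) : D + X * n' + S' = Δ + X * n + S := by
  refine (ENNReal.add_left_inj hc).mp ?_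
  calc D + X * n' + S' + c = (D + c) + X * n' + S' := by ring
    _ = X * (N + n') + S + S' := by rw [h1]; ring
    _ = (Δ + c) + X * n + S := by rw [h3, h2]; ring
    _ = Δ + X * n + S + c := by ring

/-- Keep only the terms in a fixed `G ⊆ F`, pass to the limit in `F`, then take the supremum over
`G`. The auxiliary terms have the same finite limit and cancel. -/
theorem tsum_add_le_of_tendsto {g : Finset ι → ι → ℝ≥0∞} {g' : ι → ℝ≥0∞}
    (hg : ∀ p, Filter.Tendsto (fun F => g F p) Filter.atTop (nhds (g' p)))
    {a b : Finset ι → ℝ≥0∞} {A K X : ℝ≥0∞} (hA : A ≠ ⊤)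
    (ha : Filter.Tendsto a Filter.atTop (nhds A)) (hb : Filter.Tendsto b Filter.atTop (nhds A))
    (h : ∀ᶠ F in Filter.atTop, ∑ p ∈ F, g F p + K + a F ≤ X + b F) : ∑' p, g' p + K ≤ X := by
  rw [ENNReal.tsum_eq_iSup_sum, ENNReal.iSup_add]
  refine iSup_le fun G => ?_
  have h1 : Filter.Tendsto (fun F => ∑ p ∈ G, g F p + K + a F) Filter.atTop
      (nhds (∑ p ∈ G, g' p + K + A)) :=
    ((tendsto_finsetSum G fun p _ => hg p).add tendsto_const_nhds).add ha
  have h2 := le_of_tendsto_of_tendsto h1 (tendsto_const_nhds.add hb)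
    (h.mp ((Filter.eventually_ge_atTop G).mono fun F hF hle => le_trans
      (add_le_add_left (add_le_add_left (Finset.sum_le_sum_of_subset hF) _) _) hle))
  exact (ENNReal.add_le_add_iff_right hA).mp h2

end Exchange

/-! ### Convexity of the relative entropy with a quadratic remainder. -/

section Convexity

variable {K : Type*} [NormedAddCommGroup K] [InnerProductSpace ℂ K] {ι κ : Type*}

theorem tsum_kl_add (b : HilbertBasis ι ℂ K) {s : ι → ℝ} (hs : ∀ k, 0 ≤ s k) (hs1 : ∀ k, s k ≤ 1)
    {x : ℝ} (hx : 0 ≤ x) (hx1 : x ≤ 1) {u : K} (hu : ‖u‖ₑ = 1) :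
    ∑' k, kl x (s k) * ‖⟪b k, u⟫_ℂ‖ₑ ^ 2 + (ENNReal.ofReal x + ENNReal.ofReal (Real.negMulLog x)) =
      ENNReal.ofReal x * ∑' k, nl (s k) * ‖⟪b k, u⟫_ℂ‖ₑ ^ 2 +
        ∑' k, ENNReal.ofReal (s k) * ‖⟪b k, u⟫_ℂ‖ₑ ^ 2 := by
  have h1 : ENNReal.ofReal x + ENNReal.ofReal (Real.negMulLog x) =
      ∑' k, (ENNReal.ofReal x + ENNReal.ofReal (Real.negMulLog x)) * ‖⟪b k, u⟫_ℂ‖ₑ ^ 2 := by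
    rw [ENNReal.tsum_mul_left, tsum_enorm_inner, hu, one_pow, mul_one]
  rw [h1, ← ENNReal.tsum_add, ← ENNReal.tsum_mul_left, ← ENNReal.tsum_add]
  refine tsum_congr fun k => ?_
  rw [← add_mul, kl_add hx hx1 (hs k) (hs1 k)]
  ring

variable [CompleteSpace K]

/-- The relative entropy with respect to the state with eigenbasis `χ` and eigenvalues `s`. -/
def basisEntropy (χ : HilbertBasis ι ℂ K) (s : ι → ℝ) (T : K →L[ℂ] K) : ℝ≥0∞ :=
  ∑' p, entTerm T (χ p) (s p)

/-- The basis `ψ` diagonalizes, with eigenvalues `m`, the compression of `T` to the span of the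
`χ p` with `p ∈ F`, and agrees with `χ` off `F`. -/
structure IsCompressBasis (χ : HilbertBasis ι ℂ K) (F : Finset ι) (T : K →L[ℂ] K)
    (ψ : HilbertBasis ι ℂ K) (m : ι → ℝ) : Prop where
  eq_of_notMem : ∀ k ∉ F, ψ k = χ k
  zero_of_notMem : ∀ k ∉ F, m k = 0
  proj_eq : ∀ k ∈ F, proj χ F (ψ k) = ψ k
  apply_eq : ∀ k, compress χ F T (ψ k) = (m k : ℂ) • ψ k

variable {χ ψ : HilbertBasis ι ℂ K} {F : Finset ι} {T : K →L[ℂ] K} {m s : ι → ℝ}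

theorem IsCompressBasis.qf_eq (h : IsCompressBasis χ F T ψ m) {k : ι} (hk : k ∈ F) :
    qf T (ψ k) = ENNReal.ofReal (m k) := by
  rw [← qf_eigenvector (h.apply_eq k) (norm_basis ψ k), qf, qf, compress,
    ContinuousLinearMap.comp_apply, ContinuousLinearMap.comp_apply, ← proj_symm, h.proj_eq k hk]

theorem IsCompressBasis.nonneg (h : IsCompressBasis χ F T ψ m) (hT : T.IsPositive) (k : ι) :
    0 ≤ m k := by
  have h1 := re_inner_nonneg (compress_isPositive χ F hT) (ψ k)
  rw [h.apply_eq, inner_smul_right, inner_self_eq_norm_sq_to_K, norm_basis] at h1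
  simpa using h1

theorem IsCompressBasis.le_one (h : IsCompressBasis χ F T ψ m) (hT : IsDensity T) (k : ι) :
    m k ≤ 1 := by
  by_cases hk : k ∈ F
  · have h2 := qf_le_trace hT.1 (ψ k)
    rwa [h.qf_eq hk, hT.2, one_mul, enorm_basis, one_pow, ENNReal.ofReal_le_one] at h2
  · rw [h.zero_of_notMem k hk]
    exact zero_le_one

theorem IsCompressBasis.inner_eq_zero (h : IsCompressBasis χ F T ψ m) {k p : ι} (hk : k ∈ F)
    (hp : p ∉ F) : ⟪χ p, ψ k⟫_ℂ = 0 := by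
  classical
  rw [← h.proj_eq k hk, inner_proj, if_neg hp]

theorem IsCompressBasis.sum_enorm_inner (h : IsCompressBasis χ F T ψ m) {k : ι} (hk : k ∈ F) :
    ∑ p ∈ F, ‖⟪ψ k, χ p⟫_ℂ‖ₑ ^ 2 = 1 := by
  have h1 := tsum_enorm_inner' χ (ψ k)
  rw [enorm_basis, one_pow, tsum_eq_sum (s := F)] at h1
  · exact h1
  · intro p hp
    rw [enorm_inner_symm, h.inner_eq_zero hk hp]
    simp

theorem qf_compress_notMem [DecidableEq ι] {k : ι} (hk : k ∉ F) :
    qf (compress χ F T) (χ k) = 0 := by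
  rw [qf, compress, ContinuousLinearMap.comp_apply, ContinuousLinearMap.comp_apply, proj_basis,
    if_neg hk]
  simp

theorem IsCompressBasis.sum_ofReal (h : IsCompressBasis χ F T ψ m) (hT : T.IsPositive) :
    ∑ k ∈ F, ENNReal.ofReal (m k) = ∑ p ∈ F, qf T (χ p) := by
  classical
  have h1 := tsum_qf_basis (compress_isPositive χ F hT) χ ψ
  rw [tsum_eq_sum (s := F) fun k hk => qf_compress_notMem hk,
    tsum_eq_sum (s := F) fun k hk => ?_] at h1
  · rw [Finset.sum_congr rfl fun k hk => (qf_eigenvector (h.apply_eq k) (norm_basis ψ k)).symm, ← h1]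
    exact Finset.sum_congr rfl fun p hp => qf_compress χ F T hp
  · rw [h.eq_of_notMem k hk, qf_compress_notMem hk]

/-- `kl_add` summed over both bases: the relative entropy of the compression, with its trace and its
von Neumann entropy added rather than subtracted. -/
theorem IsCompressBasis.sum_entTerm (h : IsCompressBasis χ F T ψ m) (hT : IsDensity T)
    (hs : ∀ p, 0 ≤ s p) (hs1 : ∀ p, s p ≤ 1) :
    ∑ p ∈ F, entTerm (compress χ F T) (χ p) (s p) +
        (∑ p ∈ F, qf T (χ p) + ∑ k ∈ F, ENNReal.ofReal (Real.negMulLog (m k))) =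
      ∑ p ∈ F, nl (s p) * qf T (χ p) + ∑ p ∈ F, ENNReal.ofReal (s p) := by
  classical
  have hm := h.nonneg hT.1
  have hm1 := h.le_one hT
  have hpos := compress_isPositive χ F hT.1
  have h1 (p : ι) (hp : p ∈ F) : entTerm (compress χ F T) (χ p) (s p) +
      ∑' k, (ENNReal.ofReal (m k) + ENNReal.ofReal (Real.negMulLog (m k))) *
        ‖⟪ψ k, χ p⟫_ℂ‖ₑ ^ 2 = nl (s p) * qf T (χ p) + ENNReal.ofReal (s p) := by
    rw [entTerm_eq_tsum hpos ψ m hm h.apply_eq _ (hs p), ← ENNReal.tsum_add,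
      ← qf_compress χ F T hp, qf_eq_tsum hpos ψ m hm h.apply_eq, ← ENNReal.tsum_mul_left]
    have h2 : ENNReal.ofReal (s p) = ∑' k, ENNReal.ofReal (s p) * ‖⟪ψ k, χ p⟫_ℂ‖ₑ ^ 2 := by
      rw [ENNReal.tsum_mul_left, tsum_enorm_inner, enorm_basis, one_pow, mul_one]
    rw [h2, ← ENNReal.tsum_add]
    refine tsum_congr fun k => ?_
    rw [← add_mul, kl_add (hm k) (hm1 k) (hs p) (hs1 p)]
    ring
  have h3 : ∑ p ∈ F, ∑' k, (ENNReal.ofReal (m k) + ENNReal.ofReal (Real.negMulLog (m k))) *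
        ‖⟪ψ k, χ p⟫_ℂ‖ₑ ^ 2 =
      ∑ p ∈ F, qf T (χ p) + ∑ k ∈ F, ENNReal.ofReal (Real.negMulLog (m k)) := by
    rw [← Summable.tsum_finsetSum fun _ _ => ENNReal.summable]
    simp only [← Finset.mul_sum]
    rw [tsum_eq_sum (s := F), ← h.sum_ofReal hT.1, ← Finset.sum_add_distrib]
    · refine Finset.sum_congr rfl fun k hk => ?_
      rw [h.sum_enorm_inner hk, mul_one]
    · intro k hk
      rw [h.zero_of_notMem k hk]
      simp
  rw [← h3, ← Finset.sum_add_distrib, ← Finset.sum_add_distrib]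
  exact Finset.sum_congr rfl h1

theorem exists_isCompressBasis (χ : HilbertBasis ι ℂ K) (F : Finset ι) (hT : T.IsPositive) :
    ∃ ψ m, IsCompressBasis χ F T ψ m := by
  obtain ⟨ψ, m, h1, h2, h3⟩ := exists_compress_basis χ F hT
  exact ⟨ψ, m, fun k hk => (h1 k hk).1, fun k hk => (h1 k hk).2, h2, h3⟩

/-- The eigenvalues of the compression on `F`, those of the reference state elsewhere. -/
def mixWeight [DecidableEq ι] (F : Finset ι) (m s : ι → ℝ) (k : ι) : ℝ :=
  if k ∈ F then m k else s k

/-- The mixed reference need not have trace one, so its trace is carried along in the comparisons.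
-/
theorem tsum_mixWeight [DecidableEq ι] (hs : ∑' p, ENNReal.ofReal (s p) = 1) :
    ∑' k, ENNReal.ofReal (mixWeight F m s k) + ∑ p ∈ F, ENNReal.ofReal (s p) =
      1 + ∑ k ∈ F, ENNReal.ofReal (m k) := by
  rw [tsum_add_sum_exchange (g := fun p => ENNReal.ofReal (s p)), hs]
  · congr 1
    exact Finset.sum_congr rfl fun k hk => by rw [mixWeight, if_pos hk]
  · intro k hk
    rw [mixWeight, if_neg hk]

theorem basisEntropy_eq {Q : K →L[ℂ] K} (hQ : Q.IsPositive) (α : HilbertBasis κ ℂ K) (q : κ → ℝ)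
    (hq : ∀ i, 0 ≤ q i) (hα : ∀ i, Q (α i) = (q i : ℂ) • α i) (χ : HilbertBasis ι ℂ K)
    (hs : ∀ p, 0 ≤ s p) :
    basisEntropy χ s Q = ∑' i, ∑' p, kl (q i) (s p) * ‖⟪χ p, α i⟫_ℂ‖ₑ ^ 2 := by
  rw [ENNReal.tsum_comm, basisEntropy]
  refine tsum_congr fun p => ?_
  rw [entTerm_eq_tsum hQ α q hq hα _ (hs p)]
  exact tsum_congr fun i => by rw [enorm_inner_symm]

theorem tsum_tsum_ofReal (α : HilbertBasis κ ℂ K) (χ : HilbertBasis ι ℂ K) (f : ι → ℝ≥0∞) :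
    ∑' i, ∑' p, f p * ‖⟪χ p, α i⟫_ℂ‖ₑ ^ 2 = ∑' p, f p := by
  rw [ENNReal.tsum_comm]
  refine tsum_congr fun p => ?_
  rw [ENNReal.tsum_mul_left, tsum_enorm_inner', enorm_basis, one_pow, mul_one]

/-- The `χ k` and the `ψ k` with `k ∈ F` are orthonormal bases of the same space, so `Y` restricted
to it has the same Hilbert-Schmidt norm in both. -/
theorem IsCompressBasis.norm_sub_le (h : IsCompressBasis χ F T ψ m) (Y : K →L[ℂ] K) {q : ι}
    (hq : q ∈ F) : ‖Y (χ q)‖ₑ ^ 2 ≤ ∑ k ∈ F, ‖Y (ψ k)‖ₑ ^ 2 := by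
  classical
  have h1 := tsum_enorm_map_basis (Y ∘L proj χ F) ψ χ
  have h2 : ∑' k, ‖(Y ∘L proj χ F) (ψ k)‖ₑ ^ 2 = ∑ k ∈ F, ‖Y (ψ k)‖ₑ ^ 2 := by
    rw [tsum_eq_sum (s := F)]
    · exact Finset.sum_congr rfl fun k hk => by
        rw [ContinuousLinearMap.comp_apply, h.proj_eq k hk]
    · intro k hk
      rw [ContinuousLinearMap.comp_apply, h.eq_of_notMem k hk, proj_basis, if_neg hk]
      simp
  rw [← h2, h1]
  refine le_trans (le_of_eq ?_) (ENNReal.le_tsum q)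
  rw [ContinuousLinearMap.comp_apply, proj_basis, if_pos hq]

/-- Comparison of the relative entropy with the one obtained after replacing the eigenvalues of the
reference state on `F` by those of a compression. -/
theorem IsCompressBasis.le_basisEntropy [DecidableEq ι] {K : Type u} [NormedAddCommGroup K]
    [InnerProductSpace ℂ K] [CompleteSpace K] {χ ψ : HilbertBasis ι ℂ K} {T Q : K →L[ℂ] K}
    (h : IsCompressBasis χ F T ψ m) (hT : IsDensity T)
    (hQ : IsDensity Q) (hs : ∀ p, 0 ≤ s p) (hs1 : ∀ p, s p ≤ 1)
    (hss : ∑' p, ENNReal.ofReal (s p) = 1) {p q : ι} (hp : p ∈ F) (hq : q ∈ F) :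
    ∑ k ∈ F, nl (s k) * qf Q (χ k) + 1 + ENNReal.ofReal (‖⟪χ p, (Q - T) (χ q)⟫_ℂ‖ ^ 2 / 4) ≤
      basisEntropy χ s Q + ∑ k ∈ F, nl (m k) * qf Q (ψ k) +
        ∑' k, ENNReal.ofReal (mixWeight F m s k) := by
  obtain ⟨κ, α, r, hα⟩ := hQ.exists_eigenbasis
  have hr (i : κ) := hQ.eigenvalue_mem (norm_basis α i) (hα i)
  set t := mixWeight F m s with ht
  have hm := h.nonneg hT.1
  have hm1 := h.le_one hT
  have htF (k : ι) (hk : k ∈ F) : t k = m k := if_pos hk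
  have ht0 (k : ι) : 0 ≤ t k := by
    rw [ht, mixWeight]
    split_ifs
    exacts [hm k, hs k]
  have ht1 (k : ι) : t k ≤ 1 := by
    rw [ht, mixWeight]
    split_ifs
    exacts [hm1 k, hs1 k]
  -- The reference changes from `(χ, s)` to `(ψ, t)`, separately for each eigenvector of `Q`; the
  -- two agree off `F`.
  have e1 (i : κ) := kl_exchange (ENNReal.add_ne_top.mpr ⟨ENNReal.ofReal_ne_top,
    ENNReal.ofReal_ne_top⟩) (tsum_kl_add χ hs hs1 (hr i).1 (hr i).2 (enorm_basis α i))
    (tsum_kl_add ψ ht0 ht1 (hr i).1 (hr i).2 (enorm_basis α i))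
    (tsum_add_sum_exchange (F := F) fun k hk => by
      rw [h.eq_of_notMem k hk, ht, mixWeight, if_neg hk])
  have e2 := congrArg (fun f : κ → ℝ≥0∞ => ∑' i, f i) (funext e1)
  have e3 (b : HilbertBasis ι ℂ K) (w : ι → ℝ≥0∞) :
      ∑' i, ENNReal.ofReal (r i) * ∑ k ∈ F, w k * ‖⟪b k, α i⟫_ℂ‖ₑ ^ 2 =
        ∑ k ∈ F, w k * qf Q (b k) := by
    simp only [Finset.mul_sum]
    rw [Summable.tsum_finsetSum fun _ _ => ENNReal.summable]
    refine Finset.sum_congr rfl fun k _ => ?_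
    rw [qf_eq_tsum hQ.1 α r (fun i => (hr i).1) hα, ← ENNReal.tsum_mul_left]
    refine tsum_congr fun i => ?_
    rw [enorm_inner_symm]
    ring
  simp only [ENNReal.tsum_add, e3, tsum_tsum_ofReal] at e2
  rw [hss, ← basisEntropy_eq hQ.1 α r (fun i => (hr i).1) hα χ hs,
    Finset.sum_congr rfl fun k hk => by rw [htF k hk]] at e2
  rw [e2, add_comm, ← add_assoc]
  gcongr
  -- What remains is the entropy relative to the new reference. By `le_kl` it is at least a quarter
  -- of the squared Hilbert-Schmidt norm of `Q - compress χ F T` on the span of the `ψ k`, which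
  -- dominates a single matrix element.
  have e4 (k : ι) (hk : k ∈ F) : ‖(Q - compress χ F T) (ψ k)‖ₑ ^ 2 =
      ∑' i, ENNReal.ofReal ((r i - t k) ^ 2) * ‖⟪ψ k, α i⟫_ℂ‖ₑ ^ 2 := by
    rw [← tsum_enorm_inner α]
    refine tsum_congr fun i => ?_
    rw [sub_apply, inner_sub_right, ← inner_self_symm hQ.1, hα, h.apply_eq,
      inner_smul_left, inner_smul_right, Complex.conj_ofReal, ← htF k hk, ← sub_mul, enorm_mul,
      mul_pow, enorm_inner_symm, ← Complex.ofReal_sub, ← ofReal_norm_sq, Complex.norm_real,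
      Real.norm_eq_abs, sq_abs]
  have e5 : ‖⟪χ p, (Q - T) (χ q)⟫_ℂ‖ₑ ^ 2 ≤ ‖(Q - compress χ F T) (χ q)‖ₑ ^ 2 := by
    have : ⟪χ p, (Q - T) (χ q)⟫_ℂ = ⟪χ p, (Q - compress χ F T) (χ q)⟫_ℂ := by
      rw [sub_apply, sub_apply, inner_sub_right,
        inner_sub_right, inner_compress χ F T hp hq]
    rw [this, ← tsum_enorm_inner χ]
    exact ENNReal.le_tsum p
  calc ENNReal.ofReal (‖⟪χ p, (Q - T) (χ q)⟫_ℂ‖ ^ 2 / 4)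
      = ENNReal.ofReal (1 / 4) * ‖⟪χ p, (Q - T) (χ q)⟫_ℂ‖ₑ ^ 2 := by
        rw [← ofReal_norm_sq, ← ENNReal.ofReal_mul (by norm_num)]
        congr 1
        ring
    _ ≤ ENNReal.ofReal (1 / 4) * ∑ k ∈ F, ‖(Q - compress χ F T) (ψ k)‖ₑ ^ 2 := by
        gcongr
        exact e5.trans (h.norm_sub_le _ hq)
    _ = ∑ k ∈ F, ∑' i, ENNReal.ofReal ((r i - t k) ^ 2 / 4) * ‖⟪ψ k, α i⟫_ℂ‖ₑ ^ 2 := by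
        rw [Finset.mul_sum]
        refine Finset.sum_congr rfl fun k hk => ?_
        rw [e4 k hk, ← ENNReal.tsum_mul_left]
        refine tsum_congr fun i => ?_
        rw [← mul_assoc, ← ENNReal.ofReal_mul (by norm_num)]
        congr 2
        ring
    _ ≤ ∑' k, ∑' i, kl (r i) (t k) * ‖⟪ψ k, α i⟫_ℂ‖ₑ ^ 2 := by
        refine (ENNReal.sum_le_tsum F).trans ?_
        gcongr with k i
        exact le_kl (hr i).1 (hr i).2 (ht0 k) (ht1 k)
    _ = _ := ENNReal.tsum_comm

theorem tendsto_sum_qf (χ : HilbertBasis ι ℂ K) (hT : IsDensity T) :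
    Filter.Tendsto (fun F : Finset ι => ∑ p ∈ F, qf T (χ p)) Filter.atTop (nhds 1) := by
  rw [← hT.2, traceOn_univ_eq hT.1 χ]
  exact ENNReal.summable.hasSum

/-- Convexity of the relative entropy, with a remainder that detects equality. -/
theorem basisEntropy_mixture_le {K : Type u} [NormedAddCommGroup K]
    [InnerProductSpace ℂ K] [CompleteSpace K] (χ : HilbertBasis ι ℂ K) (hs : ∀ p, 0 ≤ s p)
    (hs1 : ∀ p, s p ≤ 1) (hss : ∑' p, ENNReal.ofReal (s p) = 1) {R : K →L[ℂ] K}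
    (hR : IsDensity R) {Q : κ → K →L[ℂ] K} (hQ : ∀ n, IsDensity (Q n)) {c : κ → ℝ≥0∞}
    (hc : ∑' n, c n = 1) (hqf : ∀ x, qf R x = ∑' n, c n * qf (Q n) x) (n : κ) (p q : ι) :
    basisEntropy χ s R + c n * ENNReal.ofReal (‖⟪χ p, (Q n - R) (χ q)⟫_ℂ‖ ^ 2 / 4) ≤
      ∑' n, c n * basisEntropy χ s (Q n) := by
  classical
  have hss' : Filter.Tendsto (fun F : Finset ι => ∑ p ∈ F, ENNReal.ofReal (s p)) Filter.atTop
      (nhds 1) := by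
    rw [← hss]
    exact ENNReal.summable.hasSum
  refine tsum_add_le_of_tendsto (fun p => tendsto_entTerm χ hR.isTrPos p (s p))
    (a := fun F => ∑ p ∈ F, qf R (χ p) + 1) (b := fun F => 1 + ∑ p ∈ F, qf R (χ p)) (A := 1 + 1)
    (by simp) ((tendsto_sum_qf χ hR).add tendsto_const_nhds)
    (tendsto_const_nhds.add (tendsto_sum_qf χ hR)) ?_
  filter_upwards [Filter.eventually_ge_atTop {p, q}] with F hF
  obtain ⟨ψ, m, h⟩ := exists_isCompressBasis χ F hR.1
  have hp : p ∈ F := hF (by simp)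
  have hq : q ∈ F := hF (by simp)
  -- The reference adapted to the mixture `R` is used for every component `Q l`; terms linear in `Q
  -- l` average to those of `R`.
  have e1 := ENNReal.tsum_le_tsum fun l =>
    mul_le_mul_right (h.le_basisEntropy hR (hQ l) hs hs1 hss hp hq) (c l)
  have e2 (b : HilbertBasis ι ℂ K) (w : ι → ℝ≥0∞) :
      ∑' l, c l * ∑ k ∈ F, w k * qf (Q l) (b k) = ∑ k ∈ F, w k * qf R (b k) := by
    simp only [Finset.mul_sum]
    rw [Summable.tsum_finsetSum fun _ _ => ENNReal.summable]
    refine Finset.sum_congr rfl fun k _ => ?_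
    rw [hqf, ← ENNReal.tsum_mul_left]
    exact tsum_congr fun i => by ring
  simp only [mul_add, ENNReal.tsum_add, e2, ENNReal.tsum_mul_right, hc, one_mul] at e1
  -- Because `ψ` diagonalizes the compression of `R`, the mean of -log m is the entropy of that
  -- compression. It is finite and cancels against the one in `sum_entTerm`.
  have e3 : ∑ k ∈ F, nl (m k) * qf R (ψ k) = ∑ k ∈ F, ENNReal.ofReal (Real.negMulLog (m k)) :=
    Finset.sum_congr rfl fun k hk => by
      rw [h.qf_eq hk, mul_comm, ofReal_mul_nl (h.nonneg hR.1 k)]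
  have e4 := h.sum_entTerm hR hs hs1
  have e5 := tsum_mixWeight (F := F) (m := m) hss
  rw [h.sum_ofReal hR.1] at e5
  have e6 : c n * ENNReal.ofReal (‖⟪χ p, (Q n - R) (χ q)⟫_ℂ‖ ^ 2 / 4) ≤
    ∑' l, c l * ENNReal.ofReal (‖⟪χ p, (Q l - R) (χ q)⟫_ℂ‖ ^ 2 / 4) := ENNReal.le_tsum n
  rw [e3] at e1
  have hfin : ∑ k ∈ F, ENNReal.ofReal (Real.negMulLog (m k)) ≠ ⊤ :=
    ENNReal.sum_ne_top.mpr fun _ _ => ENNReal.ofReal_ne_top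
  generalize ∑ k ∈ F, ENNReal.ofReal (Real.negMulLog (m k)) = η at *
  generalize ∑ k ∈ F, nl (s k) * qf R (χ k) = N at *
  generalize ∑' l, c l * basisEntropy χ s (Q l) = X at *
  generalize ∑' k, ENNReal.ofReal (mixWeight F m s k) = t at *
  generalize ∑ p ∈ F, ENNReal.ofReal (s p) = s' at *
  generalize ∑ p ∈ F, qf R (χ p) = c' at *
  generalize ∑ p ∈ F, entTerm (compress χ F R) (χ p) (s p) = E at *
  generalize c n * ENNReal.ofReal (‖⟪χ p, (Q n - R) (χ q)⟫_ℂ‖ ^ 2 / 4) = k at *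
  refine (ENNReal.add_le_add_iff_right hfin).mp ?_
  calc E + k + (c' + 1) + η = (E + (c' + η)) + 1 + k := by ring
    _ = N + 1 + k + s' := by rw [e4]; ring
    _ ≤ (X + η + t) + s' := add_le_add ((add_le_add le_rfl e6).trans e1) le_rfl
    _ = X + η + (t + s') := by ring
    _ = X + (1 + c') + η := by rw [e5]; ring

end Convexity

/-! ### Entropy of a pair of particles and its behaviour in a collision. -/

section TwoParticleEntropy

variable {H : Type u} [NormedAddCommGroup H] [InnerProductSpace ℂ H] [CompleteSpace H]
  {ι κ : Type*}

theorem tsum_prod_mul {ι' κ' : Type*} (f : κ → ι → ℝ≥0∞) (g : κ' → ι' → ℝ≥0∞) :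
    ∑' v : κ × κ', ∑' k : ι × ι', f v.1 k.1 * g v.2 k.2 =
      (∑' i, ∑' p, f i p) * ∑' j, ∑' q, g j q := by
  have h1 (i : κ) (j : κ') : ∑' k : ι × ι', f i k.1 * g j k.2 = (∑' p, f i p) * ∑' q, g j q := by
    rw [ENNReal.tsum_prod', ← ENNReal.tsum_mul_right]
    exact tsum_congr fun p => by dsimp only; rw [ENNReal.tsum_mul_left]
  simp only [h1]
  rw [ENNReal.tsum_prod', ← ENNReal.tsum_mul_right]
  exact tsum_congr fun p => by dsimp only; rw [ENNReal.tsum_mul_left]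

theorem enorm_inner_prodBasis {ι' κ' : Type*} (φ : HilbertBasis ι ℂ H) (χ : HilbertBasis ι' ℂ H)
    (α : HilbertBasis κ ℂ H) (β : HilbertBasis κ' ℂ H) (k : ι × ι') (v : κ × κ') :
    ‖⟪prodBasis φ χ k, prodBasis α β v⟫_ℂ‖ₑ ^ 2 =
      ‖⟪φ k.1, α v.1⟫_ℂ‖ₑ ^ 2 * ‖⟪χ k.2, β v.2⟫_ℂ‖ₑ ^ 2 := by
  rw [prodBasis_apply, prodBasis_apply, inner_tmul, enorm_mul, mul_pow]

/-- The expectation of `-log` of the state with eigenbasis `φ` and eigenvalues `s`. -/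
def negLogMean (φ : HilbertBasis ι ℂ H) (s : ι → ℝ) (T : H →L[ℂ] H) : ℝ≥0∞ :=
  ∑' p, nl (s p) * qf T (φ p)

theorem IsDensity.tsum_eigenvalues {A : H →L[ℂ] H} (hA : IsDensity A) {α : HilbertBasis κ ℂ H}
    {a : κ → ℝ} (hα : ∀ i, A (α i) = (a i : ℂ) • α i) : ∑' i, ENNReal.ofReal (a i) = 1 := by
  rw [← trace_eq_tsum hA.1 α a hα, hA.2]

theorem IsDensity.tsum_tsum_eigenvalues {A : H →L[ℂ] H} (hA : IsDensity A)
    {α : HilbertBasis κ ℂ H} {a : κ → ℝ} (hα : ∀ i, A (α i) = (a i : ℂ) • α i)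
    (φ : HilbertBasis ι ℂ H) :
    ∑' i, ∑' p, ENNReal.ofReal (a i) * ‖⟪φ p, α i⟫_ℂ‖ₑ ^ 2 = 1 := by
  rw [← hA.tsum_eigenvalues hα]
  refine tsum_congr fun i => ?_
  rw [ENNReal.tsum_mul_left, tsum_enorm_inner, enorm_basis, one_pow, mul_one]

variable {A B : H →L[ℂ] H} {ι₁ ι₂ : Type*} {α : HilbertBasis ι₁ ℂ H} {a : ι₁ → ℝ}
  {β : HilbertBasis ι₂ ℂ H} {b : ι₂ → ℝ} {s : ι → ℝ}

/-- Additivity on product states: `kl_mul` summed over the product bases. The four mass sums all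
equal 1 and are added to both sides in order to be cancelled. -/
theorem tsum_kl_prodBasis (hA : IsDensity A) (hB : IsDensity B) (ha : ∀ i, 0 ≤ a i)
    (hα : ∀ i, A (α i) = (a i : ℂ) • α i) (hb : ∀ i, 0 ≤ b i)
    (hβ : ∀ i, B (β i) = (b i : ℂ) • β i) (φ : HilbertBasis ι ℂ H) (hs : ∀ p, 0 ≤ s p)
    (hss : ∑' p, ENNReal.ofReal (s p) = 1) :
    ∑' v : ι₁ × ι₂, ∑' k : ι × ι, kl (a v.1 * b v.2) (s k.1 * s k.2) *
      ‖⟪prodBasis φ φ k, prodBasis α β v⟫_ℂ‖ₑ ^ 2 =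
      basisEntropy φ s A + basisEntropy φ s B := by
  have h1 := tsum_prod_mul (fun i p => ENNReal.ofReal (s p) * ‖⟪φ p, α i⟫_ℂ‖ₑ ^ 2)
    (fun j q => ENNReal.ofReal (b j) * ‖⟪φ q, β j⟫_ℂ‖ₑ ^ 2)
  have h2 := tsum_prod_mul (fun i p => ENNReal.ofReal (a i) * ‖⟪φ p, α i⟫_ℂ‖ₑ ^ 2)
    (fun j q => ENNReal.ofReal (s q) * ‖⟪φ q, β j⟫_ℂ‖ₑ ^ 2)
  have h3 := tsum_prod_mul (fun i p => ENNReal.ofReal (s p) * ‖⟪φ p, α i⟫_ℂ‖ₑ ^ 2)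
    (fun j q => ENNReal.ofReal (s q) * ‖⟪φ q, β j⟫_ℂ‖ₑ ^ 2)
  have h4 := tsum_prod_mul (fun i p => ENNReal.ofReal (a i) * ‖⟪φ p, α i⟫_ℂ‖ₑ ^ 2)
    (fun j q => ENNReal.ofReal (b j) * ‖⟪φ q, β j⟫_ℂ‖ₑ ^ 2)
  have h5 := tsum_prod_mul (fun i p => kl (a i) (s p) * ‖⟪φ p, α i⟫_ℂ‖ₑ ^ 2)
    (fun j q => ENNReal.ofReal (b j) * ‖⟪φ q, β j⟫_ℂ‖ₑ ^ 2)
  have h6 := tsum_prod_mul (fun i p => ENNReal.ofReal (a i) * ‖⟪φ p, α i⟫_ℂ‖ₑ ^ 2)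
    (fun j q => kl (b j) (s q) * ‖⟪φ q, β j⟫_ℂ‖ₑ ^ 2)
  rw [hA.tsum_tsum_eigenvalues hα] at h2 h4 h6
  rw [hB.tsum_tsum_eigenvalues hβ] at h1 h4 h5
  rw [tsum_tsum_ofReal, hss] at h1 h3
  rw [tsum_tsum_ofReal, hss] at h2 h3
  rw [← basisEntropy_eq hA.1 α a ha hα φ hs] at h5
  rw [← basisEntropy_eq hB.1 β b hb hβ φ hs] at h6
  refine (ENNReal.add_left_inj (a := 1 * 1 + 1 * 1) (by simp)).mp ?_
  rw [← mul_one (basisEntropy φ s A), ← one_mul (basisEntropy φ s B)]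
  refine ((congrArg₂ (· + ·) rfl (congrArg₂ (· + ·) h1.symm h2.symm)).trans ?_).trans
    (congrArg₂ (· + ·) (congrArg₂ (· + ·) h5 h6) (congrArg₂ (· + ·) h3 h4))
  simp only [← ENNReal.tsum_add]
  refine tsum_congr fun v => tsum_congr fun k => ?_
  rw [enorm_inner_prodBasis]
  generalize ‖⟪φ k.1, α v.1⟫_ℂ‖ₑ ^ 2 = x
  generalize ‖⟪φ k.2, β v.2⟫_ℂ‖ₑ ^ 2 = y
  calc _ = (kl (a v.1 * b v.2) (s k.1 * s k.2) +
        (ENNReal.ofReal (b v.2) * ENNReal.ofReal (s k.1) +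
        ENNReal.ofReal (a v.1) * ENNReal.ofReal (s k.2))) * (x * y) := by ring
    _ = _ := by
      rw [kl_mul (ha _) (hb _) (hs _) (hs _)]
      ring

theorem negLogMean_eq (hA : A.IsPositive) (ha : ∀ i, 0 ≤ a i)
    (hα : ∀ i, A (α i) = (a i : ℂ) • α i) (φ : HilbertBasis ι ℂ H) (s : ι → ℝ) :
    negLogMean φ s A =
      ∑' i, ∑' p, (ENNReal.ofReal (a i) * nl (s p)) * ‖⟪φ p, α i⟫_ℂ‖ₑ ^ 2 := by
  rw [ENNReal.tsum_comm, negLogMean]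
  refine tsum_congr fun p => ?_
  rw [qf_eq_tsum hA α a ha hα, ← ENNReal.tsum_mul_left]
  refine tsum_congr fun i => ?_
  rw [enorm_inner_symm]
  ring

variable [TopologicalSpace.SeparableSpace H] {h : H →ₗ.[ℂ] H} {C : Type*} [MetricSpace C]
  [CompactSpace C] [MeasurableSpace C] [BorelSpace C] (S : CollisionSpec h C)

theorem CollisionSpec.measurable_marg₁ (x : H) (u : Two H) :
    Measurable fun σ => marg₁ x ((S.U σ : Two H →L[ℂ] Two H) u) :=
  ((continuous_marg₁ x).comp (S.continuous_U u)).measurable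

theorem CollisionSpec.measurable_marg₂ (x : H) (u : Two H) :
    Measurable fun σ => marg₂ x ((S.U σ : Two H →L[ℂ] Two H) u) := by
  simp only [← marg₁_swap]
  exact (((continuous_marg₁ x).comp swap.continuous).comp (S.continuous_U u)).measurable

/-- The vectors U(α i ⊗ β j) with weights a i b j diagonalize the collided state. After averaging,
its first marginal is A ⋆ B and its second is B ⋆ A, and the weights only multiply these. -/
theorem CollisionSpec.lintegral_marg (hA : IsDensity A) (hB : IsDensity B) (ha : ∀ i, 0 ≤ a i)
    (hα : ∀ i, A (α i) = (a i : ℂ) • α i) (hb : ∀ i, 0 ≤ b i)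
    (hβ : ∀ i, B (β i) = (b i : ℂ) • β i) (φ ψ : HilbertBasis ι ℂ H) (f g : ι → ℝ≥0∞) :
    ∫⁻ σ, ∑' v : ι₁ × ι₂, ENNReal.ofReal (a v.1 * b v.2) *
      (∑' k, f k * marg₁ (φ k) ((S.U σ : Two H →L[ℂ] Two H) (prodBasis α β v)) +
        ∑' k, g k * marg₂ (ψ k) ((S.U σ : Two H →L[ℂ] Two H) (prodBasis α β v))) ∂S.ν =
      ∑' k, f k * qf (S.wild A B) (φ k) + ∑' k, g k * qf (S.wild B A) (ψ k) := by
  have := countable_of_basis φ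
  have := countable_of_basis α
  have := countable_of_basis β
  have m1 (k : ι) : Measurable fun σ => ∑' v : ι₁ × ι₂, ENNReal.ofReal (a v.1 * b v.2) *
      marg₁ (φ k) ((S.U σ : Two H →L[ℂ] Two H) (prodBasis α β v)) :=
    Measurable.tsum fun v => (S.measurable_marg₁ _ _).const_mul _
  have m2 (k : ι) : Measurable fun σ => ∑' v : ι₁ × ι₂, ENNReal.ofReal (a v.1 * b v.2) *
      marg₂ (ψ k) ((S.U σ : Two H →L[ℂ] Two H) (prodBasis α β v)) :=
    Measurable.tsum fun v => (S.measurable_marg₂ _ _).const_mul _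
  have h1 (x : ι₁ × ι₂ → ℝ≥0∞) (f : ι → ℝ≥0∞) (M : ι₁ × ι₂ → ι → ℝ≥0∞) :
      ∑' v, x v * ∑' k, f k * M v k = ∑' k, f k * ∑' v, x v * M v k := by
    simp only [← ENNReal.tsum_mul_left]
    rw [ENNReal.tsum_comm]
    exact tsum_congr fun k => tsum_congr fun v => by ring
  simp only [mul_add, ENNReal.tsum_add, h1]
  rw [lintegral_add_left (Measurable.tsum fun k => (m1 k).const_mul _),
    lintegral_tsum fun k => ((m1 k).const_mul _).aemeasurable,
    lintegral_tsum fun k => ((m2 k).const_mul _).aemeasurable]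
  simp only [lintegral_const_mul _ (m1 _), lintegral_const_mul _ (m2 _)]
  simp only [S.qf_wild hA.isTrPos hB.isTrPos α a ha hα β b hb hβ,
    S.qf_wild_swap hA.isTrPos hB.isTrPos α a ha hα β b hb hβ]

theorem CollisionSpec.tsum_tsum_enorm_U {ι' : Type*} (σ : C) (α : HilbertBasis κ ℂ (Two H))
    (χ : HilbertBasis ι' ℂ (Two H)) (f : ι' → ℝ≥0∞) :
    ∑' v, ∑' k, f k * ‖⟪χ k, (S.U σ : Two H →L[ℂ] Two H) (α v)⟫_ℂ‖ₑ ^ 2 = ∑' k, f k := by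
  rw [ENNReal.tsum_comm]
  refine tsum_congr fun k => ?_
  simp only [← S.inner_star_U]
  rw [ENNReal.tsum_mul_left, tsum_enorm_inner', ← Unitary.coe_star, ← ofReal_norm_sq,
    norm_unitary_apply, norm_basis]
  simp

/-- The eigenvalues `s` of the reference state are such that `s p * s q` depends on the total
energy `e p + e q` only. -/
structure IsSteadyWeight (φ : HilbertBasis ι ℂ H) (e s : ι → ℝ) (h : H →ₗ.[ℂ] H) : Prop where
  mem_eig : ∀ i, φ i ∈ eig h (e i)
  nonneg : ∀ p, 0 ≤ s p
  le_one : ∀ p, s p ≤ 1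
  tsum_eq : ∑' p, ENNReal.ofReal (s p) = 1
  mul_eq : ∀ k i : ι × ι, e k.1 + e k.2 = e i.1 + e i.2 → s k.1 * s k.2 = s i.1 * s i.2

variable {S} {φ : HilbertBasis ι ℂ H} {e : ι → ℝ}

/-- The weight -log(s p s q) depends on the total energy only, so no collision changes its mean, and
before and after the collision it splits into one-particle terms. The argument controls only the sum
over the two orders of the factors. -/
theorem IsSteadyWeight.negLogMean_wild (hw : IsSteadyWeight φ e s h) (hh : IsSelfAdjoint h)
    (hA : IsDensity A) (hB : IsDensity B) :
    negLogMean φ s (S.wild A B) + negLogMean φ s (S.wild B A) =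
      negLogMean φ s A + negLogMean φ s B := by
  have := S.isProbability
  obtain ⟨ι₁, α, a, hα⟩ := hA.exists_eigenbasis
  obtain ⟨ι₂, β, b, hβ⟩ := hB.exists_eigenbasis
  have ha (i : ι₁) := (hA.eigenvalue_mem (norm_basis α i) (hα i)).1
  have hb (i : ι₂) := (hB.eigenvalue_mem (norm_basis β i) (hβ i)).1
  rw [negLogMean, negLogMean, ← S.lintegral_marg hA hB ha hα hb hβ φ φ]
  have h1 (σ : C) (v : ι₁ × ι₂) :
      ∑' k, nl (s k) * marg₁ (φ k) ((S.U σ : Two H →L[ℂ] Two H) (prodBasis α β v)) +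
        ∑' k, nl (s k) * marg₂ (φ k) ((S.U σ : Two H →L[ℂ] Two H) (prodBasis α β v)) =
      ∑' k : ι × ι, (nl (s k.1) + nl (s k.2)) *
        ‖⟪prodBasis φ φ k, prodBasis α β v⟫_ℂ‖ₑ ^ 2 := by
    rw [← tsum_prod_marg, S.tsum_weight hh φ e hw.mem_eig σ
      (fun k : ι × ι => nl (s k.1) + nl (s k.2))]
    intro k i hki
    rw [← nl_mul (hw.nonneg _) (hw.le_one _) (hw.nonneg _) (hw.le_one _), hw.mul_eq k i hki,
      nl_mul (hw.nonneg _) (hw.le_one _) (hw.nonneg _) (hw.le_one _)]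
  simp only [h1, lintegral_const, measure_univ, mul_one]
  have h2 := tsum_prod_mul (fun i p => (ENNReal.ofReal (a i) * nl (s p)) * ‖⟪φ p, α i⟫_ℂ‖ₑ ^ 2)
    (fun j q => ENNReal.ofReal (b j) * ‖⟪φ q, β j⟫_ℂ‖ₑ ^ 2)
  have h3 := tsum_prod_mul (fun i p => ENNReal.ofReal (a i) * ‖⟪φ p, α i⟫_ℂ‖ₑ ^ 2)
    (fun j q => (ENNReal.ofReal (b j) * nl (s q)) * ‖⟪φ q, β j⟫_ℂ‖ₑ ^ 2)
  rw [← negLogMean_eq hA.1 ha hα, hB.tsum_tsum_eigenvalues hβ, mul_one] at h2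
  rw [← negLogMean_eq hB.1 hb hβ, hA.tsum_tsum_eigenvalues hα, one_mul] at h3
  rw [← h2, ← h3, ← ENNReal.tsum_add]
  refine tsum_congr fun v => ?_
  rw [← ENNReal.tsum_add, ← ENNReal.tsum_mul_left]
  refine tsum_congr fun k => ?_
  rw [enorm_inner_prodBasis, ENNReal.ofReal_mul (ha _)]
  ring

theorem mixWeight_mem [DecidableEq ι] {F : Finset ι} {m s : ι → ℝ} (hm : ∀ k, 0 ≤ m k)
    (hm1 : ∀ k, m k ≤ 1) (hs : ∀ k, 0 ≤ s k) (hs1 : ∀ k, s k ≤ 1) (k : ι) :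
    0 ≤ mixWeight F m s k ∧ mixWeight F m s k ≤ 1 := by
  rw [mixWeight]
  split_ifs
  exacts [⟨hm k, hm1 k⟩, ⟨hs k, hs1 k⟩]

theorem tsum_ofReal_prod {s t : ι → ℝ} (hs : ∀ k, 0 ≤ s k) :
    ∑' k : ι × ι, ENNReal.ofReal (s k.1 * t k.2) =
      (∑' p, ENNReal.ofReal (s p)) * ∑' p, ENNReal.ofReal (t p) := by
  simp only [ENNReal.ofReal_mul (hs _)]
  rw [ENNReal.tsum_prod', ← ENNReal.tsum_mul_right]
  exact tsum_congr fun p => by dsimp only; rw [ENNReal.tsum_mul_left]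

theorem sum_eq_tsum_ite [DecidableEq ι] (F : Finset ι) (f M : ι → ℝ≥0∞) :
    ∑ k ∈ F, f k * M k = ∑' k, (if k ∈ F then f k else 0) * M k := by
  rw [tsum_eq_sum (s := F) fun k hk => by rw [if_neg hk, zero_mul]]
  exact Finset.sum_congr rfl fun k hk => by rw [if_pos hk]

/-- Superadditivity in finite form. For each collision the reference ρ∞ ⊗ ρ∞ is replaced by the
product of the mixed references adapted to A ⋆ B and to B ⋆ A. The entropy for the old reference is
D(A) + D(B), the one for the new reference is nonnegative, and the logarithms split into marginals,
which become the two convolutions after integration. -/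
theorem IsSteadyWeight.le_of_isCompressBasis [DecidableEq ι] (hw : IsSteadyWeight φ e s h)
    (hh : IsSelfAdjoint h) (hA : IsDensity A) (hB : IsDensity B) {F : Finset ι}
    {ψ ψ' : HilbertBasis ι ℂ H} {m m' : ι → ℝ}
    (hψ : IsCompressBasis φ F (S.wild A B) ψ m) (hψ' : IsCompressBasis φ F (S.wild B A) ψ' m') :
    ∑ k ∈ F, nl (s k) * qf (S.wild A B) (φ k) + ∑ k ∈ F, nl (s k) * qf (S.wild B A) (φ k) + 1 ≤
      basisEntropy φ s A + basisEntropy φ s B +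
        (∑ k ∈ F, nl (m k) * qf (S.wild A B) (ψ k) +
          ∑ k ∈ F, nl (m' k) * qf (S.wild B A) (ψ' k)) +
        (∑' k, ENNReal.ofReal (mixWeight F m s k)) *
          ∑' k, ENNReal.ofReal (mixWeight F m' s k) := by
  have := S.isProbability
  obtain ⟨ι₁, α, a, hα⟩ := hA.exists_eigenbasis
  obtain ⟨ι₂, β, b, hβ⟩ := hB.exists_eigenbasis
  have ha (i : ι₁) := hA.eigenvalue_mem (norm_basis α i) (hα i)
  have hb (i : ι₂) := hB.eigenvalue_mem (norm_basis β i) (hβ i)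
  have hAB := S.isDensity_wild hA hB
  have hBA := S.isDensity_wild hB hA
  set t := mixWeight F m s with ht
  set t' := mixWeight F m' s with ht'
  have htm := mixWeight_mem (F := F) (hψ.nonneg hAB.1) (hψ.le_one hAB) hw.nonneg hw.le_one
  have htm' := mixWeight_mem (F := F) (hψ'.nonneg hBA.1) (hψ'.le_one hBA) hw.nonneg hw.le_one
  have key (σ : C) (v : ι₁ × ι₂) {w w' : ι → ℝ} (hw0 : ∀ k, 0 ≤ w k ∧ w k ≤ 1)
      (hw0' : ∀ k, 0 ≤ w' k ∧ w' k ≤ 1) (c c' : HilbertBasis ι ℂ H) :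
      ∑' k : ι × ι, kl (a v.1 * b v.2) (w k.1 * w' k.2) *
        ‖⟪prodBasis c c' k, (S.U σ : Two H →L[ℂ] Two H) (prodBasis α β v)⟫_ℂ‖ₑ ^ 2 +
        (ENNReal.ofReal (a v.1 * b v.2) + ENNReal.ofReal (Real.negMulLog (a v.1 * b v.2))) =
      ENNReal.ofReal (a v.1 * b v.2) *
        (∑' k, nl (w k) * marg₁ (c k) ((S.U σ : Two H →L[ℂ] Two H) (prodBasis α β v)) +
          ∑' k, nl (w' k) * marg₂ (c' k) ((S.U σ : Two H →L[ℂ] Two H) (prodBasis α β v))) +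
        ∑' k : ι × ι, ENNReal.ofReal (w k.1 * w' k.2) *
          ‖⟪prodBasis c c' k, (S.U σ : Two H →L[ℂ] Two H) (prodBasis α β v)⟫_ℂ‖ₑ ^ 2 := by
    rw [tsum_kl_add (prodBasis c c') (fun k => mul_nonneg (hw0 k.1).1 (hw0' k.2).1)
      (fun k => mul_le_one₀ (hw0 k.1).2 (hw0' k.2).1 (hw0' k.2).2)
      (mul_nonneg (ha v.1).1 (hb v.2).1) (mul_le_one₀ (ha v.1).2 (hb v.2).1 (hb v.2).2)
      (by rw [← ofReal_norm, S.norm_U, norm_basis, ENNReal.ofReal_one]), ← tsum_prod_marg]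
    simp only [nl_mul (hw0 _).1 (hw0 _).2 (hw0' _).1 (hw0' _).2]
  have hsm (k : ι) : 0 ≤ s k ∧ s k ≤ 1 := ⟨hw.nonneg k, hw.le_one k⟩
  have point (σ : C) (v : ι₁ × ι₂) := kl_exchange
    (ENNReal.add_ne_top.mpr ⟨ENNReal.ofReal_ne_top, ENNReal.ofReal_ne_top⟩)
    (key σ v hsm hsm φ φ) (key σ v htm htm' ψ ψ')
    (n' := ∑ k ∈ F, nl (m k) * marg₁ (ψ k) ((S.U σ : Two H →L[ℂ] Two H) (prodBasis α β v)) +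
      ∑ k ∈ F, nl (m' k) * marg₂ (ψ' k) ((S.U σ : Two H →L[ℂ] Two H) (prodBasis α β v)))
    (n := ∑ k ∈ F, nl (s k) * marg₁ (φ k) ((S.U σ : Two H →L[ℂ] Two H) (prodBasis α β v)) +
      ∑ k ∈ F, nl (s k) * marg₂ (φ k) ((S.U σ : Two H →L[ℂ] Two H) (prodBasis α β v))) (by
      rw [add_add_add_comm, add_add_add_comm (∑' k, nl (mixWeight F m s k) * _)]
      congr 1
      · rw [Finset.sum_congr rfl fun k hk => by rw [← show mixWeight F m s k = m k from if_pos hk]]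
        refine tsum_add_sum_exchange fun k hk => ?_
        rw [hψ.eq_of_notMem k hk, mixWeight, if_neg hk]
      · rw [Finset.sum_congr rfl fun k hk => by
          rw [← show mixWeight F m' s k = m' k from if_pos hk]]
        refine tsum_add_sum_exchange fun k hk => ?_
        rw [hψ'.eq_of_notMem k hk, mixWeight, if_neg hk])
  have summed (σ : C) := congrArg (fun f : ι₁ × ι₂ → ℝ≥0∞ => ∑' v, f v) (funext (point σ))
  -- Energy conservation enters here: for fixed `v` the weight depends on `k` only through its total
  -- energy, so the collision can be removed.
  have hkl (σ : C) : ∑' v : ι₁ × ι₂, ∑' k : ι × ι, kl (a v.1 * b v.2) (s k.1 * s k.2) *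
      ‖⟪prodBasis φ φ k, (S.U σ : Two H →L[ℂ] Two H) (prodBasis α β v)⟫_ℂ‖ₑ ^ 2 =
      basisEntropy φ s A + basisEntropy φ s B := by
    rw [← tsum_kl_prodBasis hA hB (fun i => (ha i).1) hα (fun i => (hb i).1) hβ φ hw.nonneg
      hw.tsum_eq]
    refine tsum_congr fun v => S.tsum_weight hh φ e hw.mem_eig σ
      (fun k : ι × ι => kl (a v.1 * b v.2) (s k.1 * s k.2)) (fun k i hki => ?_) _
    rw [hw.mul_eq k i hki]
  simp only [ENNReal.tsum_add, hkl, S.tsum_tsum_enorm_U, tsum_ofReal_prod hw.nonneg, hw.tsum_eq,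
    tsum_ofReal_prod fun k => (htm k).1, mul_one] at summed
  -- The entropy relative to the new reference is dropped.
  have hle (σ : C) := (add_le_add (le_add_of_nonneg_left zero_le) le_rfl).trans (summed σ).ge
  have hint := lintegral_mono (μ := S.ν) hle
  simp only [sum_eq_tsum_ite] at hint
  rw [lintegral_add_right _ measurable_const, lintegral_add_right _ measurable_const,
    lintegral_add_left measurable_const,
    S.lintegral_marg hA hB (fun i => (ha i).1) hα (fun i => (hb i).1) hβ,
    S.lintegral_marg hA hB (fun i => (ha i).1) hα (fun i => (hb i).1) hβ] at hint
  simp only [lintegral_const, measure_univ, mul_one] at hint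
  simpa only [sum_eq_tsum_ite] using hint

/-- The relative entropy with respect to a steady state decreases under the symmetrized Wild
convolution. -/
theorem IsSteadyWeight.basisEntropy_wild_le (hw : IsSteadyWeight φ e s h)
    (hh : IsSelfAdjoint h) (hA : IsDensity A) (hB : IsDensity B) :
    basisEntropy φ s (S.wild A B) + basisEntropy φ s (S.wild B A) ≤
      basisEntropy φ s A + basisEntropy φ s B := by
  classical
  have hAB := S.isDensity_wild hA hB
  have hBA := S.isDensity_wild hB hA
  have hss' : Filter.Tendsto (fun F : Finset ι => ∑ p ∈ F, ENNReal.ofReal (s p)) Filter.atTop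
      (nhds 1) := by
    rw [← hw.tsum_eq]
    exact ENNReal.summable.hasSum
  -- The trace of a mixed reference, written with truncated subtraction; by `tsum_mixWeight` nothing
  -- is truncated, and the limit is 1 + 1 - 1.
  have hsub {T : H →L[ℂ] H} (hT : IsDensity T) : Filter.Tendsto (fun F : Finset ι =>
      1 + ∑ p ∈ F, qf T (φ p) - ∑ p ∈ F, ENNReal.ofReal (s p)) Filter.atTop (nhds 1) := by
    have h1 := ENNReal.Tendsto.sub ((tendsto_const_nhds (x := (1 : ℝ≥0∞))).add
      (tendsto_sum_qf φ hT)) hss' (Or.inr ENNReal.one_ne_top)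
    rwa [ENNReal.add_sub_cancel_right ENNReal.one_ne_top] at h1
  have hlim := ((ENNReal.Tendsto.mul (hsub hAB) (Or.inl one_ne_zero) (hsub hBA)
    (Or.inl one_ne_zero)).add hss').add hss'
  have hlim' := ((tendsto_sum_qf φ hAB).add (tendsto_sum_qf φ hBA)).add
    (tendsto_const_nhds (x := (1 : ℝ≥0∞)))
  rw [one_mul] at hlim
  rw [basisEntropy, basisEntropy, ← ENNReal.tsum_add]
  refine (le_add_of_nonneg_right zero_le).trans (tsum_add_le_of_tendsto (K := 0)
    (fun p => (tendsto_entTerm φ hAB.isTrPos p (s p)).add (tendsto_entTerm φ hBA.isTrPos p (s p)))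
    (by simp) hlim' hlim (Filter.Eventually.of_forall fun F => ?_))
  obtain ⟨ψ, m, hψ⟩ := exists_isCompressBasis φ F hAB.1
  obtain ⟨ψ', m', hψ'⟩ := exists_isCompressBasis φ F hBA.1
  have e1 := hw.le_of_isCompressBasis hh hA hB hψ hψ'
  have e2 := hψ.sum_entTerm hAB hw.nonneg hw.le_one
  have e3 := hψ'.sum_entTerm hBA hw.nonneg hw.le_one
  have e4 {R : H →L[ℂ] H} {χ : HilbertBasis ι ℂ H} {n : ι → ℝ} (hR : IsDensity R)
      (hχ : IsCompressBasis φ F R χ n) : ∑ k ∈ F, nl (n k) * qf R (χ k) =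
        ∑ k ∈ F, ENNReal.ofReal (Real.negMulLog (n k)) :=
    Finset.sum_congr rfl fun k hk => by
      rw [hχ.qf_eq hk, mul_comm, ofReal_mul_nl (hχ.nonneg hR.1 k)]
  have hsF : ∑ p ∈ F, ENNReal.ofReal (s p) ≠ ⊤ :=
    ENNReal.sum_ne_top.mpr fun _ _ => ENNReal.ofReal_ne_top
  have e5 {R : H →L[ℂ] H} {χ : HilbertBasis ι ℂ H} {n : ι → ℝ} (hR : IsDensity R)
      (hχ : IsCompressBasis φ F R χ n) : ∑' k, ENNReal.ofReal (mixWeight F n s k) =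
        1 + ∑ p ∈ F, qf R (φ p) - ∑ p ∈ F, ENNReal.ofReal (s p) := by
    rw [← hχ.sum_ofReal hR.1, ← tsum_mixWeight hw.tsum_eq, ENNReal.add_sub_cancel_right hsF]
  rw [e4 hAB hψ, e4 hBA hψ', e5 hAB hψ, e5 hBA hψ'] at e1
  have hfin (n : ι → ℝ) : ∑ k ∈ F, ENNReal.ofReal (Real.negMulLog (n k)) ≠ ⊤ :=
    ENNReal.sum_ne_top.mpr fun _ _ => ENNReal.ofReal_ne_top
  have hη := ENNReal.add_ne_top.mpr ⟨hfin m, hfin m'⟩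
  rw [Finset.sum_add_distrib]
  generalize ∑ k ∈ F, ENNReal.ofReal (Real.negMulLog (m k)) = η at *
  generalize ∑ k ∈ F, ENNReal.ofReal (Real.negMulLog (m' k)) = η' at *
  generalize ∑ k ∈ F, nl (s k) * qf (S.wild A B) (φ k) = N at *
  generalize ∑ k ∈ F, nl (s k) * qf (S.wild B A) (φ k) = N' at *
  generalize (1 + ∑ p ∈ F, qf (S.wild A B) (φ p) - ∑ p ∈ F, ENNReal.ofReal (s p)) *
    (1 + ∑ p ∈ F, qf (S.wild B A) (φ p) - ∑ p ∈ F, ENNReal.ofReal (s p)) = t at *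
  generalize ∑ p ∈ F, ENNReal.ofReal (s p) = s' at *
  generalize ∑ p ∈ F, qf (S.wild A B) (φ p) = c at *
  generalize ∑ p ∈ F, qf (S.wild B A) (φ p) = c' at *
  generalize ∑ p ∈ F, entTerm (compress φ F (S.wild A B)) (φ p) (s p) = E at *
  generalize ∑ p ∈ F, entTerm (compress φ F (S.wild B A)) (φ p) (s p) = E' at *
  generalize basisEntropy φ s A + basisEntropy φ s B = X at *
  refine (ENNReal.add_le_add_iff_right hη).mp ?_
  calc E + E' + 0 + (c + c' + 1) + (η + η') = (E + (c + η)) + (E' + (c' + η')) + 1 := by ring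
    _ = (N + N' + 1) + (s' + s') := by rw [e2, e3]; ring
    _ ≤ (X + (η + η') + t) + (s' + s') := add_le_add e1 le_rfl
    _ = X + (t + s' + s') + (η + η') := by ring

end TwoParticleEntropy

/-! ### Steady states in the energy eigenbasis, and their logarithms. -/

section SteadyStates

variable {H : Type u} [NormedAddCommGroup H] [InnerProductSpace ℂ H] [CompleteSpace H]
  {h : H →ₗ.[ℂ] H}

theorem basis_ne_zero {ι : Type*} (φ : HilbertBasis ι ℂ H) (i : ι) : φ i ≠ 0 :=
  norm_ne_zero_iff.mp (by rw [norm_basis]; exact one_ne_zero)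

/-- The extended logarithm turns products into sums and is injective, so the additive condition,
with log 0 = -∞ included, becomes the multiplicative one. -/
theorem IsSteady.exists_isSteadyWeight (hh : IsHamiltonian h) {ρ : H →L[ℂ] H}
    (hρ : IsSteady h ρ) : ∃ (ι : Type u) (φ : HilbertBasis ι ℂ H) (e s : ι → ℝ),
      IsSteadyWeight φ e s h ∧ ∀ p, ρ (φ p) = (s p : ℂ) • φ p := by
  obtain ⟨ι, φ, e, hφ⟩ := hh.exists_basis
  obtain ⟨hd, l, -, hl, hlog⟩ := hρ
  have hspec (i : ι) : e i ∈ spec h := ⟨φ i, hφ i, basis_ne_zero φ i⟩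
  have hs (p : ι) : ρ (φ p) = (l (e p) : ℂ) • φ p := hl _ _ (hφ p)
  have hmem (p : ι) := hd.eigenvalue_mem (norm_basis φ p) (hs p)
  refine ⟨ι, φ, e, fun p => l (e p), ⟨hφ, fun p => (hmem p).1, fun p => (hmem p).2,
    hd.tsum_eigenvalues hs, fun k i hki => ?_⟩, hs⟩
  have h1 := hlog _ (hspec k.1) _ (hspec k.2) _ (hspec i.1) _ (hspec i.2) hki
  rw [← ENNReal.log_mul_add, ← ENNReal.log_mul_add] at h1
  have h2 := ENNReal.log_injective h1
  rw [← ENNReal.ofReal_mul (hmem _).1, ← ENNReal.ofReal_mul (hmem _).1,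
    ENNReal.ofReal_eq_ofReal_iff (mul_nonneg (hmem _).1 (hmem _).1)
      (mul_nonneg (hmem _).1 (hmem _).1)] at h2
  exact h2

variable {ι : Type*} {φ : HilbertBasis ι ℂ H} {s : ι → ℝ}

/-- Testing against an eigenbasis of `ρ` shows that `logGraph` is single valued, hence the graph of
`logOp`. Its eigenspace at `a` collects the eigenvectors of `ρ` whose eigenvalue has logarithm `a`.
-/
theorem eig_logOp {ρ : H →L[ℂ] H} (hρ : ρ.IsPositive) (hφ : ∀ p, ρ (φ p) = (s p : ℂ) • φ p)
    (a : ℝ) : eig (logOp ρ) a = {x | ∀ p, ¬ Real.log (s p) = a → ⟪φ p, x⟫_ℂ = 0} := by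
  have h1 (p : H × H) (hp : p ∈ logGraph ρ) (i : ι) :
      ⟪φ i, p.2⟫_ℂ = (Real.log (s i) : ℂ) * ⟪φ i, p.1⟫_ℂ := hp (s i) (φ i) (hφ i)
  have hgraph : (logOp ρ).graph = logGraph ρ := by
    refine Submodule.toLinearPMap_graph_eq _ fun p hp h0 => ?_
    refine eq_zero_of_inner_basis φ fun i => ?_
    rw [h1 p hp i, h0, inner_zero_right, mul_zero]
  ext x
  rw [eig, hgraph]
  constructor
  · intro hx i hi
    have h2 := h1 _ hx i
    dsimp only at h2
    rw [inner_smul_right, ← sub_eq_zero, ← sub_mul, mul_eq_zero] at h2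
    refine h2.resolve_left fun h3 => hi ?_
    exact_mod_cast (sub_eq_zero.mp h3).symm
  · intro hx t u hu
    rw [eigB_eq hρ φ s hφ] at hu
    dsimp only
    rw [inner_smul_right]
    by_cases ht : Real.log t = a
    · rw [ht]
    · have : ⟪u, x⟫_ℂ = 0 := by
        rw [← φ.tsum_inner_mul_inner u x]
        refine (tsum_congr fun i => ?_).trans tsum_zero
        by_cases hi : s i = t
        · rw [hx i (hi ▸ ht), mul_zero]
        · rw [← inner_conj_symm, hu i hi, map_zero, zero_mul]
      rw [this, mul_zero, mul_zero]

/-- Eigenvalues in (0,1] have nonpositive logarithms, so the positive part in `trMul` is zero and no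
∞ - ∞ arises. -/
theorem trMul_logOp {ρ : H →L[ℂ] H} (hρ : ρ.IsPositive) (hφ : ∀ p, ρ (φ p) = (s p : ℂ) • φ p)
    (hs : ∀ p, 0 < s p) (hs1 : ∀ p, s p ≤ 1) {T : H →L[ℂ] H} (hT : T.IsPositive) :
    trMul (logOp ρ) T = -(negLogMean φ s T : EReal) := by
  classical
  have h1 (c : ℝ → ℝ≥0∞) : ∑' a : ℝ, c a * traceOn (eig (logOp ρ) a) T =
      ∑' p, c (Real.log (s p)) * qf T (φ p) := by
    rw [← tsum_fiber c (fun p => Real.log (s p)) fun p => qf T (φ p)]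
    refine tsum_congr fun a => ?_
    rw [eig_logOp hρ hφ, traceOn_eq hT φ]
  rw [trMul, h1, h1 fun a => ENNReal.ofReal (-a)]
  have h2 : ∑' p, ENNReal.ofReal (Real.log (s p)) * qf T (φ p) = 0 := by
    refine (tsum_congr fun p => ?_).trans tsum_zero
    rw [ENNReal.ofReal_of_nonpos (Real.log_nonpos (hs p).le (hs1 p)), zero_mul]
  have h3 : ∑' p, ENNReal.ofReal (-Real.log (s p)) * qf T (φ p) = negLogMean φ s T :=
    tsum_congr fun p => by rw [nl, if_neg (hs p).ne']
  rw [h2, h3, EReal.coe_ennreal_zero, zero_sub]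

theorem StrictlyPositive.eigenvalue_pos {ρ : H →L[ℂ] H} (hρ : StrictlyPositive ρ)
    (hφ : ∀ p, ρ (φ p) = (s p : ℂ) • φ p) (p : ι) : 0 < s p := by
  have h1 := hρ (φ p) (basis_ne_zero φ p)
  rw [hφ, inner_smul_right, inner_self_eq_norm_sq_to_K, norm_basis] at h1
  simpa using h1

end SteadyStates

/-! ### Invariants and entropy along the Wild expansion. -/

section Evolution

theorem le_of_add_self_le {x y : ℝ≥0∞} (hxy : x + x ≤ y + y) : x ≤ y :=
  le_of_not_gt fun h => (ENNReal.add_lt_add h h).not_ge hxy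

theorem sum_range_add_reflect (n : ℕ) (f : ℕ → ℕ → ℝ≥0∞) :
    ∑ k ∈ Finset.range (n + 1), f k (n - k) + ∑ k ∈ Finset.range (n + 1), f k (n - k) =
      ∑ k ∈ Finset.range (n + 1), (f k (n - k) + f (n - k) k) := by
  rw [Finset.sum_add_distrib]
  congr 1
  rw [← Finset.sum_range_reflect]
  refine Finset.sum_congr rfl fun k hk => ?_
  have := Finset.mem_range.mp hk
  congr 1
  omega

theorem ofReal_inv_mul_natCast (n : ℕ) (x : ℝ≥0∞) :
    ENNReal.ofReal (n + 1 : ℝ)⁻¹ * (((n + 1 : ℕ) : ℝ≥0∞) * x) = x := by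
  rw [← mul_assoc, ← ENNReal.ofReal_natCast (n + 1), ← ENNReal.ofReal_mul (by positivity),
    Nat.cast_succ, inv_mul_cancel₀ (by positivity), ENNReal.ofReal_one, one_mul]

/-- The reflection k ↦ n - k turns twice the sum into a sum of symmetrized pairs. So bounds that
hold only for both orders together are enough for the Wild terms. -/
theorem average_le {n : ℕ} {f : ℕ → ℕ → ℝ≥0∞} {x : ℝ≥0∞}
    (hf : ∀ k ≤ n, f k (n - k) + f (n - k) k ≤ x + x) :
    ENNReal.ofReal (n + 1 : ℝ)⁻¹ * ∑ k ∈ Finset.range (n + 1), f k (n - k) ≤ x := by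
  rw [← ofReal_inv_mul_natCast n x]
  gcongr
  refine le_of_add_self_le ?_
  rw [sum_range_add_reflect, ← mul_add]
  refine (Finset.sum_le_sum fun k hk => hf k (Nat.lt_succ_iff.mp (Finset.mem_range.mp hk))).trans ?_
  simp [mul_add]

theorem le_average {n : ℕ} {f : ℕ → ℕ → ℝ≥0∞} {x : ℝ≥0∞}
    (hf : ∀ k ≤ n, x + x ≤ f k (n - k) + f (n - k) k) :
    x ≤ ENNReal.ofReal (n + 1 : ℝ)⁻¹ * ∑ k ∈ Finset.range (n + 1), f k (n - k) := by
  rw [← ofReal_inv_mul_natCast n x]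
  gcongr
  refine le_of_add_self_le ?_
  rw [sum_range_add_reflect, ← mul_add]
  refine le_trans ?_ (Finset.sum_le_sum fun k hk =>
    hf k (Nat.lt_succ_iff.mp (Finset.mem_range.mp hk)))
  simp [mul_add]

variable {H : Type u} [NormedAddCommGroup H] [InnerProductSpace ℂ H] [CompleteSpace H]
  [TopologicalSpace.SeparableSpace H] {h : H →ₗ.[ℂ] H} {C : Type*} [MetricSpace C]
  [CompactSpace C] [MeasurableSpace C] [BorelSpace C] {S : CollisionSpec h C}
  {ι κ : Type*} {φ : HilbertBasis ι ℂ H} {e s : ι → ℝ}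

theorem CollisionSpec.qf_wildTerm_succ {ρ : H →L[ℂ] H} (hρ : IsDensity ρ) (n : ℕ) (x : H) :
    qf (S.wildTerm ρ (n + 1)) x = ∑ k ∈ Finset.range (n + 1), ENNReal.ofReal (n + 1 : ℝ)⁻¹ *
      qf (S.wild (S.wildTerm ρ k) (S.wildTerm ρ (n - k))) x := by
  rw [S.wildTerm_succ, qf_smul _ (by positivity), qf_sum, Finset.mul_sum]
  exact fun k _ => (S.isDensity_wild (S.isDensity_wildTerm hρ k) (S.isDensity_wildTerm hρ _)).1

theorem negLogMean_mixture {R : H →L[ℂ] H} {Q : κ → H →L[ℂ] H} {c : κ → ℝ≥0∞}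
    (hqf : ∀ x, qf R x = ∑' n, c n * qf (Q n) x) :
    negLogMean φ s R = ∑' n, c n * negLogMean φ s (Q n) := by
  simp only [negLogMean, hqf, ← ENNReal.tsum_mul_left]
  rw [ENNReal.tsum_comm]
  exact tsum_congr fun n => tsum_congr fun p => by ring

theorem IsSteadyWeight.negLogMean_wildTerm (hw : IsSteadyWeight φ e s h) (hh : IsSelfAdjoint h)
    {ρ : H →L[ℂ] H} (hρ : IsDensity ρ) (n : ℕ) :
    negLogMean φ s (S.wildTerm ρ n) = negLogMean φ s ρ := by
  induction n using Nat.strong_induction_on with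
  | _ n ih =>
    cases n with
    | zero => rw [S.wildTerm_zero]
    | succ n =>
      have h1 (x : H) : qf (S.wildTerm ρ (n + 1)) x = ∑' k : Fin (n + 1),
          ENNReal.ofReal (n + 1 : ℝ)⁻¹ * qf (S.wild (S.wildTerm ρ k) (S.wildTerm ρ (n - k))) x := by
        rw [CollisionSpec.qf_wildTerm_succ hρ, tsum_fintype, Finset.sum_range]
      rw [negLogMean_mixture h1, tsum_fintype, ← Finset.mul_sum,
        Fin.sum_univ_eq_sum_range (fun k => negLogMean φ s
          (S.wild (S.wildTerm ρ k) (S.wildTerm ρ (n - k))))]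
      have h2 (k : ℕ) (hk : k ≤ n) :
          negLogMean φ s (S.wild (S.wildTerm ρ k) (S.wildTerm ρ (n - k))) +
            negLogMean φ s (S.wild (S.wildTerm ρ (n - k)) (S.wildTerm ρ k)) =
          negLogMean φ s ρ + negLogMean φ s ρ := by
        rw [hw.negLogMean_wild hh (S.isDensity_wildTerm hρ _) (S.isDensity_wildTerm hρ _),
          ih k (by omega), ih (n - k) (by omega)]
      let f (k j : ℕ) := negLogMean φ s (S.wild (S.wildTerm ρ k) (S.wildTerm ρ j))
      exact le_antisymm (average_le (f := f) fun k hk => (h2 k hk).le)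
        (le_average (f := f) fun k hk => (h2 k hk).ge)

theorem IsSteadyWeight.nonempty (hw : IsSteadyWeight φ e s h) : Nonempty ι := by
  by_contra hι
  rw [not_nonempty_iff] at hι
  simpa using hw.tsum_eq

theorem IsSteadyWeight.basisEntropy_wildTerm_le (hw : IsSteadyWeight φ e s h)
    (hh : IsSelfAdjoint h) {ρ : H →L[ℂ] H} (hρ : IsDensity ρ) (n : ℕ) :
    basisEntropy φ s (S.wildTerm ρ n) ≤ basisEntropy φ s ρ := by
  induction n using Nat.strong_induction_on with
  | _ n ih =>
    cases n with
    | zero => rw [S.wildTerm_zero]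
    | succ n =>
      have h1 (x : H) : qf (S.wildTerm ρ (n + 1)) x = ∑' k : Fin (n + 1),
          ENNReal.ofReal (n + 1 : ℝ)⁻¹ * qf (S.wild (S.wildTerm ρ k) (S.wildTerm ρ (n - k))) x := by
        rw [CollisionSpec.qf_wildTerm_succ hρ, tsum_fintype, Finset.sum_range]
      have hc : ∑' _ : Fin (n + 1), ENNReal.ofReal (n + 1 : ℝ)⁻¹ = 1 := by
        have := ofReal_inv_mul_natCast n 1
        rw [mul_one, mul_comm] at this
        simpa [tsum_fintype] using this
      -- Only plain convexity is wanted here, so the indices in the remainder are arbitrary.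
      obtain ⟨p⟩ := hw.nonempty
      have h3 := basisEntropy_mixture_le φ hw.nonneg hw.le_one hw.tsum_eq
        (S.isDensity_wildTerm hρ (n + 1)) (fun k : Fin (n + 1) => S.isDensity_wild
          (S.isDensity_wildTerm hρ k) (S.isDensity_wildTerm hρ (n - k))) hc h1 0 p p
      refine (le_add_of_nonneg_right zero_le).trans (h3.trans ?_)
      rw [tsum_fintype, ← Finset.mul_sum, Fin.sum_univ_eq_sum_range (fun k => basisEntropy φ s
          (S.wild (S.wildTerm ρ k) (S.wildTerm ρ (n - k))))]
      exact average_le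
        (f := fun k j => basisEntropy φ s (S.wild (S.wildTerm ρ k) (S.wildTerm ρ j)))
        fun k hk => (hw.basisEntropy_wild_le hh (S.isDensity_wildTerm hρ _)
          (S.isDensity_wildTerm hρ _)).trans (add_le_add (ih k (by omega)) (ih (n - k) (by omega)))

/-- The solution at a later time is a mixture of the Wild terms. -/
theorem CollisionSpec.IsSolution.exists_mixture {ρ : ℝ → H →L[ℂ] H} (hρ : S.IsSolution ρ) {t : ℝ}
    (ht : 0 ≤ t) {v : ℝ} (hv : 0 ≤ v) : ∃ c : ℕ → ℝ≥0∞, ∑' n, c n = 1 ∧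
      (∀ x, qf (ρ (t + v)) x = ∑' n, c n * qf (S.wildTerm (ρ t) n) x) ∧
      (0 < v → ∀ n, c n ≠ 0) := by
  have h1 : Real.exp (-(2 * v)) ≤ 1 := Real.exp_le_one_iff.mpr (by linarith)
  have hpos (n : ℕ) : 0 ≤ Real.exp (-(2 * v)) * (1 - Real.exp (-(2 * v))) ^ n :=
    mul_nonneg (Real.exp_pos _).le (pow_nonneg (sub_nonneg.mpr h1) _)
  have hQ (n : ℕ) := S.isDensity_wildTerm (hρ t ht).1 n
  have hqf (x : H) : qf (ρ (t + v)) x = ∑' n, ENNReal.ofReal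
      (Real.exp (-(2 * v)) * (1 - Real.exp (-(2 * v))) ^ n) * qf (S.wildTerm (ρ t) n) x := by
    rw [(isPositive_of_hasSum (fun n => isPositive_smul (hpos n) (hQ n).1)
      (S.hasSum_wildTerm hρ ht hv)).2]
    exact tsum_congr fun n => qf_smul _ (hpos n) _ _
  refine ⟨_, ?_, hqf, fun h0 n => ?_⟩
  · have hd := (hρ (t + v) (by linarith)).1
    obtain ⟨_, b, -⟩ := exists_hilbertBasis ℂ H
    have h2 := hd.2
    rw [traceOn_univ_eq hd.1 b] at h2
    simp only [hqf] at h2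
    rw [ENNReal.tsum_comm] at h2
    rw [← h2]
    refine tsum_congr fun n => ?_
    rw [ENNReal.tsum_mul_left, ← traceOn_univ_eq (hQ n).1 b, (hQ n).2, mul_one]
  · have h2 : Real.exp (-(2 * v)) < 1 := Real.exp_lt_one_iff.2 (by linarith)
    exact (ENNReal.ofReal_pos.mpr (mul_pos (Real.exp_pos _) (pow_pos (sub_pos.mpr h2) _))).ne'

theorem IsSteadyWeight.negLogMean_solution (hw : IsSteadyWeight φ e s h) (hh : IsSelfAdjoint h)
    {ρ : ℝ → H →L[ℂ] H} (hρ : S.IsSolution ρ) {t t' : ℝ} (ht : 0 ≤ t) (htt : t ≤ t') :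
    negLogMean φ s (ρ t') = negLogMean φ s (ρ t) := by
  obtain ⟨c, hc, hqf, -⟩ := hρ.exists_mixture ht (sub_nonneg.mpr htt)
  rw [add_sub_cancel] at hqf
  rw [negLogMean_mixture hqf]
  simp only [hw.negLogMean_wildTerm hh (hρ t ht).1]
  rw [ENNReal.tsum_mul_right, hc, one_mul]

/-- If the entropy did not drop, finiteness would force the convexity remainder to vanish for every
matrix element and every Wild term, because all the weights are nonzero. The terms 0 and 1 then show
that `ρ t` is a fixed point of the convolution, and such a solution is constant. -/
theorem IsSteadyWeight.basisEntropy_solution_lt (hw : IsSteadyWeight φ e s h)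
    (hh : IsSelfAdjoint h) {ρ : ℝ → H →L[ℂ] H} (hρ : S.IsSolution ρ)
    (hne : ¬ ∀ t : ℝ, 0 ≤ t → ρ t = ρ 0) {t t' : ℝ} (ht : 0 ≤ t) (htt : t < t')
    (hfin : basisEntropy φ s (ρ t) ≠ ⊤) :
    basisEntropy φ s (ρ t') < basisEntropy φ s (ρ t) := by
  obtain ⟨c, hc, hqf, hc0⟩ := hρ.exists_mixture ht (sub_nonneg.mpr htt.le)
  rw [add_sub_cancel] at hqf
  have hc0 := hc0 (sub_pos.mpr htt)
  have hd := (hρ t' (ht.trans htt.le)).1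
  have hle (n : ℕ) (p q : ι) : basisEntropy φ s (ρ t') +
      c n * ENNReal.ofReal (‖⟪φ p, (S.wildTerm (ρ t) n - ρ t') (φ q)⟫_ℂ‖ ^ 2 / 4) ≤
      basisEntropy φ s (ρ t) := by
    refine (basisEntropy_mixture_le φ hw.nonneg hw.le_one hw.tsum_eq hd
      (S.isDensity_wildTerm (ρ := ρ t) (hρ t ht).1) hc hqf n p q).trans ?_
    calc ∑' n, c n * basisEntropy φ s (S.wildTerm (ρ t) n)
        ≤ ∑' n, c n * basisEntropy φ s (ρ t) := by
          gcongr
          exact hw.basisEntropy_wildTerm_le hh (hρ t ht).1 _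
      _ = basisEntropy φ s (ρ t) := by rw [ENNReal.tsum_mul_right, hc, one_mul]
  by_contra hlt
  rw [not_lt] at hlt
  have heq (n : ℕ) : S.wildTerm (ρ t) n = ρ t' := by
    rw [← sub_eq_zero]
    refine ContinuousLinearMap.ext_on (Submodule.dense_iff_topologicalClosure_eq_top.mpr
      φ.dense_span) ?_
    rintro _ ⟨q, rfl⟩
    refine eq_zero_of_inner_basis φ fun p => ?_
    have h1 := (hle n p q).trans (hlt.trans (add_zero _).ge)
    have hfin' : basisEntropy φ s (ρ t') ≠ ⊤ :=
      ne_top_of_le_ne_top hfin ((le_add_of_nonneg_right zero_le).trans (hle n p q))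
    rw [ENNReal.add_le_add_iff_left hfin', nonpos_iff_eq_zero, mul_eq_zero] at h1
    have h2 := ENNReal.ofReal_eq_zero.mp (h1.resolve_left (hc0 n))
    have h3 : ‖⟪φ p, (S.wildTerm (ρ t) n - ρ t') (φ q)⟫_ℂ‖ ^ 2 = 0 :=
      le_antisymm (by linarith) (sq_nonneg _)
    exact norm_eq_zero.mp (pow_eq_zero_iff two_ne_zero |>.mp h3)
  have h0 := heq 0
  have h1 := heq 1
  rw [S.wildTerm_zero] at h0
  rw [S.wildTerm_succ, Finset.sum_range_one, S.wildTerm_zero, ← h0] at h1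
  have hconst := S.eq_of_wild_eq hρ ht (by simpa [S.wildTerm_zero] using h1)
  exact hne fun r hr => (hconst r hr).trans (hconst 0 le_rfl).symm

end Evolution

end QuantumKac

end

theorem theorem3p9 {H : Type*} [NormedAddCommGroup H] [InnerProductSpace ℂ H] [CompleteSpace H]
    [TopologicalSpace.SeparableSpace H] (h : H →ₗ.[ℂ] H) (hh : IsHamiltonian h)
    {C : Type*} [MetricSpace C] [CompactSpace C] [MeasurableSpace C] [BorelSpace C]
    (S : CollisionSpec h C) (hS : S.Ergodic) :
    (∀ ρ' : H →L[ℂ] H, IsSteady h ρ' → StrictlyPositive ρ' →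
      ∀ ρ : H →L[ℂ] H, IsDensity ρ →
        trMul (logOp ρ') ρ = trMul (logOp ρ') (S.wild ρ ρ)) ∧
    (∀ ρ : ℝ → H →L[ℂ] H, S.IsSolution ρ → ∀ A : H →ₗ.[ℂ] H, IsCollisionInvariant h A →
      ∀ s t : ℝ, 0 ≤ s → 0 ≤ t → trMul A (ρ s) = trMul A (ρ t)) ∧
    (∀ ρ' : H →L[ℂ] H, IsSteady h ρ' → ∀ ρ : ℝ → H →L[ℂ] H, S.IsSolution ρ →
      (¬ ∀ t : ℝ, 0 ≤ t → ρ t = ρ 0) →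
      ∀ s t : ℝ, 0 ≤ s → s < t → relEntropy (ρ s) ρ' ≠ ⊤ →
        relEntropy (ρ t) ρ' < relEntropy (ρ s) ρ') := by
  have hsa := hh.selfAdjoint
  have key : ∀ ρ' : H →L[ℂ] H, IsSteady h ρ' → StrictlyPositive ρ' →
      ∀ A B : H →L[ℂ] H, IsDensity A → IsDensity B →
        (∀ {ι : Type _} {φ : HilbertBasis ι ℂ H} {e s : ι → ℝ}, IsSteadyWeight φ e s h →
          negLogMean φ s A = negLogMean φ s B) → trMul (logOp ρ') A = trMul (logOp ρ') B := by
    intro ρ' hρ' hpos A B hA hB hAB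
    obtain ⟨ι, φ, e, s, hw, hφ⟩ := hρ'.exists_isSteadyWeight hh
    have hs := hpos.eigenvalue_pos hφ
    rw [trMul_logOp hρ'.1.1 hφ hs hw.le_one hA.1, trMul_logOp hρ'.1.1 hφ hs hw.le_one hB.1, hAB hw]
  refine ⟨fun ρ' hρ' hpos ρ hρ => ?_, fun ρ hρ A hA s t hs ht => ?_,
    fun ρ' hρ' ρ hρ hne s t hs hst hfin => ?_⟩
  · refine key ρ' hρ' hpos _ _ hρ (S.isDensity_wild hρ hρ) fun hw => ?_
    -- For equal factors both orders coincide, so the conservation law reads x + x = y + y, which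
    -- can be halved even in [0,∞].
    have h1 := hw.negLogMean_wild (S := S) hsa hρ hρ
    exact le_antisymm (le_of_add_self_le h1.ge) (le_of_add_self_le h1.le)
  · obtain ⟨ρ', hρ', hpos, rfl⟩ := hA
    refine key ρ' hρ' hpos _ _ (hρ s hs).1 (hρ t ht).1 fun hw => ?_
    rw [hw.negLogMean_solution hsa hρ le_rfl hs, hw.negLogMean_solution hsa hρ le_rfl ht]
  · obtain ⟨ι, φ, e, w, hw, hφ⟩ := hρ'.exists_isSteadyWeight hh
    have h1 (r : ℝ) (hr : 0 ≤ r) :=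
      relEntropy_eq_tsum (hρ r hr).1.1 hρ'.1.1 φ w hw.nonneg hφ
    rw [h1 s hs] at hfin ⊢
    rw [h1 t (hs.trans hst.le)]
    exact hw.basisEntropy_solution_lt hsa hρ hne hs hst hfin
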